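/- **Setting.** Let $I=(a,b)$ be a bounded interval, $0<m\le K$, $\sigma>0$, $T_0>0$. The coefficients satisfy $m\le\mu,D\le K$ on $[a,b]$, $\mu$ is measurable, $D$ is twice differentiable and $|D_x|,|D_{xx}|\le K$. Let $(u,v)$ be a sufficiently smooth solution on $[a,b]\times[0,T]$ of $u_t=v$, $\mu v_t=-(Du_{xx})_{xx}+f$ with the boundary conditions $$-a_1v_x+b_1Du_{xx}=0,\quad a_2v+b_2(Du_{xx})_x=0\ \text{ at } a,\qquad a_1v_x+b_1Du_{xx}=0,\quad a_2v-b_2(Du_{xx})_x=0\ \text{ at } b,$$ where $(a_1,b_1,a_2,b_2)$ is $(0,1,1,0)$ (simply supported), $(0,1,0,1)$ (free), $(1,0,1,0)$ (clamped) or $(1,0,0,1)$ (sliding). Let $a=x_0<\dots<x_n=b$, $I_j=(x_{j-1},x_j)$, $h_j=x_j-x_{j-1}$, $h=\max_jh_j$, $h/\min_jh_j<\sigma$. Let $q\ge3$, $s\ge 0$ be integers with $q-4\le s\le q$. The semi-discrete energy-based DG solution $(u^h,v^h)(t)$, with $u^h|_{I_j}\in\mathcal P^q$, $v^h|_{I_j}\in\mathcal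 P^s$, satisfies for $0\le t\le T$, all $j$, all $\phi\in\mathcal P^q$, $\psi\in\mathcal P^s$, $\tilde\phi\in\mathcal P^0$, $\hat\phi\in\mathcal P^1$: $$\int_{I_j}D\phi_{xx}(u^h_t-v^h)_{xx}\,dx=\Big[(D\phi_{xx})_x(v^h-v^*)+D\phi_{xx}((v_x)^*-v^h_x)\Big]_{x_{j-1}}^{x_j},$$ $$\int_{I_j}\mu\psi v^h_t+D\psi_{xx}u^h_{xx}\,dx=\int_{I_j}\psi f\,dx+\Big[-\psi((Du_{xx})_x)^*+\psi_x(Du_{xx})^*\Big]_{x_{j-1}}^{x_j},$$ $$\int_{I_j}\tilde\phi(u^h_t-v^h)\,dx=0,\qquad \int_{I_j}\hat\phi_x(u^h_t-v^h)_x\,dx=0.$$ With $w=Du^h_{xx}$, $p=(Du^h_{xx})_x$ and $\pm$ denoting right/left traces, the fluxes at interior nodes are $$v^*=\alpha_1v^{h,-}+(1-\alpha_1)v^{h,+}+\beta_1(p^--p^+),\qquad ((Du_{xx})_x)^*=(1-\alpha_1)p^-+\alpha_1p^++\tau_1(v^{h,-}-v^{h,+}),$$ $$(v_x)^*=\alpha_2v_x^{h,-}+(1-\alpha_2)v_x^{h,+}-\beta_2(w^--w^+),\qquad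 (Du_{xx})^*=(1-\alpha_2)w^-+\alpha_2w^+-\tau_2(v_x^{h,-}-v_x^{h,+}),$$ with $\alpha_1,\alpha_2\in[0,1]$. At $a$ (upper signs) and $b$ (lower signs), with $\zeta_1=\mp a_1v^h_x+b_1w$ and $\zeta_2=a_2v^h\pm b_2p$, $$(v_x)^*=v^h_x\pm(a_1-\eta_1b_1)\zeta_1,\quad (Du_{xx})^*=w-(b_1+\eta_1a_1)\zeta_1,\quad v^*=v^h-(a_2-\eta_2b_2)\zeta_2,\quad ((Du_{xx})_x)^*=p\mp(b_2+\eta_2a_2)\zeta_2 .$$ Sign condition (S): $\eta_1\le0\le\eta_2$ (simply supported); $\eta_1,\eta_2\le0$ (free); $\eta_1,\eta_2\ge0$ (clamped); $\eta_2\le0\le\eta_1$ (sliding). Initially, $(u^h,v^h)(0)$ is the projection of $(u,v)(\cdot,0)$: with $\delta^u=u^h-u$, $\delta^v=v^h-v$ at $t=0$, for all $j$ and all $\phi,\psi,\tilde\phi,\hat\phi$ as above, $$\int_{I_j}D\phi_{xx}\delta^u_{xx}\,dx=\int_{I_j}D\psi\,\delta^v\,dx=\int_{I_j}\tilde\phi\,\delta^u\,dx=\int_{I_j}\hat\phi_x\delta^u_x\,dx=0.$$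 **Theorem.** Let $\bar q=\min(q-3,s-1)$, $e^u=u-u^h$, $e^v=v-v^h$. Let $$\gamma=\begin{cases}\bar q, & \beta_1,\tau_1,\beta_2,\tau_2\ge0\ \text{and (S)},\\ \bar q+\tfrac12, & \beta_1,\tau_1,\beta_2,\tau_2>0,\ \text{(S) and }\eta_1\eta_2\ne0.\end{cases}$$ Then there is a constant $C$, depending only on $q,s,a,b,\sigma,m,K,T_0$, the boundary condition and the flux parameters (so independent of $h$, the mesh, $u$, $v$, $f$ and $T$), such that for every $T\ge T_0$ and all $0\le t\le T$ $$\|e^v\|_{L^2(I)}^2+\|De^u_{xx}\|_{L^2(I)}^2\le CT^2\max_{0\le t'\le T}\Big[h^{2\gamma}\big(|u(\cdot,t')|_{H^{q+1}(I)}^2+|v(\cdot,t')|_{H^{s+1}(I)}^2\big)+h^{2(s+1)}|v_t(\cdot,t')|_{H^{s+1}(I)}^2\Big],$$ where $e^u_{xx}$ is taken element by element. -/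

import Mathlib

open Set Polynomial MeasureTheory

noncomputable section

namespace BeamDG

/-- The four physical boundary conditions of the beam. -/
inductive BoundaryType where
  | simplySupported
  | free
  | clamped
  | sliding

/-- The coefficients `a₁, b₁, a₂, b₂` encoding the boundary condition: at the left end
`-a₁ v_x + b₁ D u_xx = 0`, `a₂ v + b₂ (D u_xx)_x = 0`, and at the right end
`a₁ v_x + b₁ D u_xx = 0`, `a₂ v - b₂ (D u_xx)_x = 0`. -/
def BoundaryType.a₁ : BoundaryType → ℝ
  | simplySupported => 0
  | free => 0
  | clamped => 1
  | sliding => 1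

def BoundaryType.b₁ : BoundaryType → ℝ
  | simplySupported => 1
  | free => 1
  | clamped => 0
  | sliding => 0

def BoundaryType.a₂ : BoundaryType → ℝ
  | simplySupported => 1
  | free => 0
  | clamped => 1
  | sliding => 0

def BoundaryType.b₂ : BoundaryType → ℝ
  | simplySupported => 0
  | free => 1
  | clamped => 0
  | sliding => 1

/-- The parameters of the numerical fluxes, together with the type of boundary condition. -/
structure FluxParams where
  bc : BoundaryType
  α₁ : ℝ
  α₂ : ℝ
  β₁ : ℝ
  β₂ : ℝ
  τ₁ : ℝ
  τ₂ : ℝ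
  η₁ : ℝ
  η₂ : ℝ

/-- The sign conditions on `η₁, η₂` for each boundary condition. -/
def EtaSign : BoundaryType → ℝ → ℝ → Prop
  | .simplySupported, η₁, η₂ => η₁ ≤ 0 ∧ 0 ≤ η₂
  | .free, η₁, η₂ => η₁ ≤ 0 ∧ η₂ ≤ 0
  | .clamped, η₁, η₂ => 0 ≤ η₁ ∧ 0 ≤ η₂
  | .sliding, η₁, η₂ => 0 ≤ η₁ ∧ η₂ ≤ 0

/-- General (energy-stable) flux parameters. -/
structure FluxParams.Admissible (F : FluxParams) : Prop where
  α₁_mem : F.α₁ ∈ Icc (0 : ℝ) 1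
  α₂_mem : F.α₂ ∈ Icc (0 : ℝ) 1
  β₁_nonneg : 0 ≤ F.β₁
  τ₁_nonneg : 0 ≤ F.τ₁
  β₂_nonneg : 0 ≤ F.β₂
  τ₂_nonneg : 0 ≤ F.τ₂
  eta_sign : EtaSign F.bc F.η₁ F.η₂

/-- Strictly dissipative flux parameters. -/
structure FluxParams.Dissipative (F : FluxParams) : Prop extends F.Admissible where
  β₁_pos : 0 < F.β₁
  τ₁_pos : 0 < F.τ₁
  β₂_pos : 0 < F.β₂
  τ₂_pos : 0 < F.τ₂
  eta_ne : F.η₁ * F.η₂ ≠ 0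

/-- A partition `a = x₀ < x₁ < ⋯ < xₙ = b`; the elements are `(x j, x (j+1))`, `j < n`
(the values `x i` for `i > n` are irrelevant). -/
structure Mesh (a b : ℝ) where
  n : ℕ
  x : ℕ → ℝ
  x_zero : x 0 = a
  x_last : x n = b
  x_lt : ∀ j < n, x j < x (j + 1)

/-- The mesh size `h = max_j h_j`. -/
def Mesh.h {a b : ℝ} (M : Mesh a b) : ℝ := ⨆ j : Fin M.n, (M.x (j + 1) - M.x j)

/-- Mesh regularity `h / min_j h_j < σ`. -/
def Mesh.Regular {a b : ℝ} (M : Mesh a b) (σ : ℝ) : Prop :=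
  ∀ j < M.n, M.h < σ * (M.x (j + 1) - M.x j)

/-- `D p_xx` for a polynomial `p`. -/
def moment (D : ℝ → ℝ) (p : ℝ[X]) (y : ℝ) : ℝ := D y * (derivative (derivative p)).eval y

/-- `(D p_xx)_x` for a polynomial `p`. -/
def shear (a b : ℝ) (D : ℝ → ℝ) (p : ℝ[X]) (y : ℝ) : ℝ :=
  derivWithin (moment D p) (Icc a b) y

section Fluxes

variable {a b : ℝ} (M : Mesh a b) (F : FluxParams) (D : ℝ → ℝ)

/-- The boundary quantity `ζ₁`, at the left end (`i = 0`) or the right end of the interval.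
Here and below `u j`, `v j` are the polynomials on the `j`-th element. -/
def ζ₁ (u v : ℕ → ℝ[X]) (i : ℕ) : ℝ :=
  if i = 0 then
    -F.bc.a₁ * (derivative (v 0)).eval a + F.bc.b₁ * moment D (u 0) a
  else
    F.bc.a₁ * (derivative (v (M.n - 1))).eval b + F.bc.b₁ * moment D (u (M.n - 1)) b

/-- The boundary quantity `ζ₂`, at the left end (`i = 0`) or the right end of the interval. -/
def ζ₂ (u v : ℕ → ℝ[X]) (i : ℕ) : ℝ :=
  if i = 0 then
    F.bc.a₂ * (v 0).eval a + F.bc.b₂ * shear a b D (u 0) a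
  else
    F.bc.a₂ * (v (M.n - 1)).eval b - F.bc.b₂ * shear a b D (u (M.n - 1)) b

/-- The numerical flux `v*` at the node `x i`. At an interior node the element on the left is
`i - 1` and the element on the right is `i`. -/
def vStar (u v : ℕ → ℝ[X]) (i : ℕ) : ℝ :=
  if i = 0 then
    (v 0).eval a - (F.bc.a₂ - F.η₂ * F.bc.b₂) * ζ₂ M F D u v i
  else if i = M.n then
    (v (M.n - 1)).eval b - (F.bc.a₂ - F.η₂ * F.bc.b₂) * ζ₂ M F D u v i
  else
    F.α₁ * (v (i - 1)).eval (M.x i) + (1 - F.α₁) * (v i).eval (M.x i)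
      + F.β₁ * (shear a b D (u (i - 1)) (M.x i) - shear a b D (u i) (M.x i))

/-- The numerical flux `((D u_xx)_x)*` at the node `x i`. -/
def shearStar (u v : ℕ → ℝ[X]) (i : ℕ) : ℝ :=
  if i = 0 then
    shear a b D (u 0) a - (F.bc.b₂ + F.η₂ * F.bc.a₂) * ζ₂ M F D u v i
  else if i = M.n then
    shear a b D (u (M.n - 1)) b + (F.bc.b₂ + F.η₂ * F.bc.a₂) * ζ₂ M F D u v i
  else
    (1 - F.α₁) * shear a b D (u (i - 1)) (M.x i) + F.α₁ * shear a b D (u i) (M.x i)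
      + F.τ₁ * ((v (i - 1)).eval (M.x i) - (v i).eval (M.x i))

/-- The numerical flux `(v_x)*` at the node `x i`. -/
def vxStar (u v : ℕ → ℝ[X]) (i : ℕ) : ℝ :=
  if i = 0 then
    (derivative (v 0)).eval a + (F.bc.a₁ - F.η₁ * F.bc.b₁) * ζ₁ M F D u v i
  else if i = M.n then
    (derivative (v (M.n - 1))).eval b - (F.bc.a₁ - F.η₁ * F.bc.b₁) * ζ₁ M F D u v i
  else
    F.α₂ * (derivative (v (i - 1))).eval (M.x i)
      + (1 - F.α₂) * (derivative (v i)).eval (M.x i)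
      - F.β₂ * (moment D (u (i - 1)) (M.x i) - moment D (u i) (M.x i))

/-- The numerical flux `(D u_xx)*` at the node `x i`. -/
def momentStar (u v : ℕ → ℝ[X]) (i : ℕ) : ℝ :=
  if i = 0 then
    moment D (u 0) a - (F.bc.b₁ + F.η₁ * F.bc.a₁) * ζ₁ M F D u v i
  else if i = M.n then
    moment D (u (M.n - 1)) b - (F.bc.b₁ + F.η₁ * F.bc.a₁) * ζ₁ M F D u v i
  else
    (1 - F.α₂) * moment D (u (i - 1)) (M.x i) + F.α₂ * moment D (u i) (M.x i)
      - F.τ₂ * ((derivative (v (i - 1))).eval (M.x i) - (derivative (v i)).eval (M.x i))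

end Fluxes

/-- `w` is (on each element and at each time in `[0,T]`) a polynomial of degree at most `r`. -/
def InPolySpace {a b : ℝ} (M : Mesh a b) (T : ℝ) (r : ℕ) (w : ℝ → ℕ → ℝ[X]) : Prop :=
  ∀ t ∈ Icc 0 T, ∀ j < M.n, (w t j).natDegree ≤ r

/-- `wt` is the time derivative on `[0,T]` of the piecewise polynomial function `w`. -/
def HasTimeDeriv {a b : ℝ} (M : Mesh a b) (T : ℝ) (w wt : ℝ → ℕ → ℝ[X]) : Prop :=
  ∀ t ∈ Icc 0 T, ∀ j < M.n, ∀ k : ℕ,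
    HasDerivWithinAt (fun r => (w r j).coeff k) ((wt t j).coeff k) (Icc 0 T) t

/-- `(u, v)` is a solution on `[0,T]` of the semi-discrete energy-based DG scheme with degrees
`(q, s)` and forcing `f`. -/
structure IsDGSolution {a b : ℝ} (M : Mesh a b) (F : FluxParams) (μ D : ℝ → ℝ)
    (f : ℝ → ℝ → ℝ) (T : ℝ) (q s : ℕ) (u v : ℝ → ℕ → ℝ[X]) : Prop where
  u_mem : InPolySpace M T q u
  v_mem : InPolySpace M T s v
  scheme : ∃ ut vt : ℝ → ℕ → ℝ[X],
    InPolySpace M T q ut ∧ InPolySpace M T s vt ∧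
    HasTimeDeriv M T u ut ∧ HasTimeDeriv M T v vt ∧
    ∀ t ∈ Icc 0 T, ∀ j < M.n,
      (∀ φ : ℝ[X], φ.natDegree ≤ q →
        ∫ y in (M.x j)..(M.x (j + 1)),
            moment D φ y * (derivative (derivative (ut t j - v t j))).eval y
          = (shear a b D φ (M.x (j + 1))
                * ((v t j).eval (M.x (j + 1)) - vStar M F D (u t) (v t) (j + 1))
              + moment D φ (M.x (j + 1))
                * (vxStar M F D (u t) (v t) (j + 1) - (derivative (v t j)).eval (M.x (j + 1))))
            - (shear a b D φ (M.x j)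
                * ((v t j).eval (M.x j) - vStar M F D (u t) (v t) j)
              + moment D φ (M.x j)
                * (vxStar M F D (u t) (v t) j - (derivative (v t j)).eval (M.x j)))) ∧
      (∀ ψ : ℝ[X], ψ.natDegree ≤ s →
        ∫ y in (M.x j)..(M.x (j + 1)),
            (μ y * ψ.eval y * (vt t j).eval y
              + D y * (derivative (derivative ψ)).eval y
                * (derivative (derivative (u t j))).eval y)
          = (∫ y in (M.x j)..(M.x (j + 1)), ψ.eval y * f t y)
            + ((-(ψ.eval (M.x (j + 1))) * shearStar M F D (u t) (v t) (j + 1)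
                + (derivative ψ).eval (M.x (j + 1)) * momentStar M F D (u t) (v t) (j + 1))
              - (-(ψ.eval (M.x j)) * shearStar M F D (u t) (v t) j
                + (derivative ψ).eval (M.x j) * momentStar M F D (u t) (v t) j))) ∧
      (∀ c : ℝ, ∫ y in (M.x j)..(M.x (j + 1)), c * (ut t j - v t j).eval y = 0) ∧
      (∀ χ : ℝ[X], χ.natDegree ≤ 1 →
        ∫ y in (M.x j)..(M.x (j + 1)),
          (derivative χ).eval y * (derivative (ut t j - v t j)).eval y = 0)

/-- Spatial derivative of order `k` of a function on `[a,b]` (one-sided at the end points). -/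
def dx (a b : ℝ) (k : ℕ) (w : ℝ → ℝ) (y : ℝ) : ℝ := iteratedDerivWithin k w (Icc a b) y

/-- `(u, v)`, piecewise polynomials of degrees `(q, s)`, are the projections of `(u₀, v₀)`:
the projection of `u₀` in the `D`-weighted `H²` seminorm with matching element means of the
function and of its first derivative, and the `D`-weighted `L²` projection of `v₀`. -/
structure IsProjection {a b : ℝ} (M : Mesh a b) (D : ℝ → ℝ) (q s : ℕ) (u₀ v₀ : ℝ → ℝ)
    (u v : ℕ → ℝ[X]) : Prop where
  u_deg : ∀ j < M.n, (u j).natDegree ≤ q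
  v_deg : ∀ j < M.n, (v j).natDegree ≤ s
  u_orth : ∀ j < M.n, ∀ φ : ℝ[X], φ.natDegree ≤ q →
    ∫ y in (M.x j)..(M.x (j + 1)),
      moment D φ y * ((derivative (derivative (u j))).eval y - dx a b 2 u₀ y) = 0
  v_orth : ∀ j < M.n, ∀ ψ : ℝ[X], ψ.natDegree ≤ s →
    ∫ y in (M.x j)..(M.x (j + 1)), D y * ψ.eval y * ((v j).eval y - v₀ y) = 0
  u_mean : ∀ j < M.n, ∀ c : ℝ,
    ∫ y in (M.x j)..(M.x (j + 1)), c * ((u j).eval y - u₀ y) = 0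
  ux_mean : ∀ j < M.n, ∀ χ : ℝ[X], χ.natDegree ≤ 1 →
    ∫ y in (M.x j)..(M.x (j + 1)),
      (derivative χ).eval y * ((derivative (u j)).eval y - dx a b 1 u₀ y) = 0

/-- `w(t, ·)` is `C^k` on `[a,b]` and all its spatial derivatives of order at most `k` are
jointly continuous on `[0,T] × [a,b]`. -/
def SpatiallySmooth (a b T : ℝ) (k : ℕ) (w : ℝ → ℝ → ℝ) : Prop :=
  (∀ t ∈ Icc 0 T, ContDiffOn ℝ k (w t) (Icc a b)) ∧
  ∀ i ≤ k, ContinuousOn (fun z : ℝ × ℝ => dx a b i (w z.1) z.2) (Icc 0 T ×ˢ Icc a b)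

/-- The material coefficients: `0 < m ≤ μ, D ≤ K`, `D` is twice differentiable on `[a,b]`, and
`|D_x|, |D_xx| ≤ K`. -/
structure CoeffBounds (a b m K : ℝ) (μ D : ℝ → ℝ) : Prop where
  μ_meas : AEMeasurable μ (volume.restrict (Icc a b))
  μ_bounds : ∀ y ∈ Icc a b, m ≤ μ y ∧ μ y ≤ K
  D_diff : DifferentiableOn ℝ D (Icc a b)
  Dx_diff : DifferentiableOn ℝ (derivWithin D (Icc a b)) (Icc a b)
  D_bounds : ∀ y ∈ Icc a b, m ≤ D y ∧ D y ≤ K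
  Dx_bound : ∀ y ∈ Icc a b, |dx a b 1 D y| ≤ K
  Dxx_bound : ∀ y ∈ Icc a b, |dx a b 2 D y| ≤ K

/-- `(u, v)` is a sufficiently smooth solution on `[0,T] × [a,b]` of `u_t = v`,
`μ v_t = -(D u_xx)_xx + f` with the boundary conditions encoded by `bc`; `vt` is `v_t`. -/
structure IsSmoothSolution (a b T : ℝ) (μ D : ℝ → ℝ) (f : ℝ → ℝ → ℝ) (bc : BoundaryType)
    (q s : ℕ) (u v vt : ℝ → ℝ → ℝ) : Prop where
  u_smooth : SpatiallySmooth a b T (q + 1) u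
  v_smooth : SpatiallySmooth a b T (max (s + 1) 2) v
  vt_smooth : SpatiallySmooth a b T (s + 1) vt
  u_t : ∀ t ∈ Icc 0 T, ∀ y ∈ Icc a b,
    HasDerivWithinAt (fun r => u r y) (v t y) (Icc 0 T) t
  v_t : ∀ t ∈ Icc 0 T, ∀ y ∈ Icc a b,
    HasDerivWithinAt (fun r => v r y) (vt t y) (Icc 0 T) t
  pde : ∀ t ∈ Icc 0 T, ∀ y ∈ Ioo a b,
    μ y * vt t y = -dx a b 2 (fun z => D z * dx a b 2 (u t) z) y + f t y
  bc_left₁ : ∀ t ∈ Icc 0 T, -bc.a₁ * dx a b 1 (v t) a + bc.b₁ * (D a * dx a b 2 (u t) a) = 0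
  bc_left₂ : ∀ t ∈ Icc 0 T,
    bc.a₂ * v t a + bc.b₂ * dx a b 1 (fun z => D z * dx a b 2 (u t) z) a = 0
  bc_right₁ : ∀ t ∈ Icc 0 T, bc.a₁ * dx a b 1 (v t) b + bc.b₁ * (D b * dx a b 2 (u t) b) = 0
  bc_right₂ : ∀ t ∈ Icc 0 T,
    bc.a₂ * v t b - bc.b₂ * dx a b 1 (fun z => D z * dx a b 2 (u t) z) b = 0

/-- The squared Sobolev seminorm `|w|²_{H^k(a,b)}`. -/
def sobolevSeminormSq (a b : ℝ) (k : ℕ) (w : ℝ → ℝ) : ℝ := ∫ y in a..b, (dx a b k w y) ^ 2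

/-- `‖w - wh‖²_{L²(a,b)} + ‖D (z - zh)_xx‖²_{L²(a,b)}` for `w = v`, `z = u` and the piecewise
polynomials `wh = vh`, `zh = uh` (the second derivative being taken on each element). -/
def energyErrorSq {a b : ℝ} (M : Mesh a b) (D : ℝ → ℝ) (u v : ℝ → ℝ) (uh vh : ℕ → ℝ[X]) : ℝ :=
  (∑ j ∈ Finset.range M.n, ∫ y in (M.x j)..(M.x (j + 1)), (v y - (vh j).eval y) ^ 2)
  + ∑ j ∈ Finset.range M.n, ∫ y in (M.x j)..(M.x (j + 1)),
      (D y * (dx a b 2 u y - (derivative (derivative (uh j))).eval y)) ^ 2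

/-- The quantity inside the maximum of the error bound, with rate `h ^ (2 γ)`. -/
def errorData (a b h γ : ℝ) (q s : ℕ) (u v vt : ℝ → ℝ → ℝ) (t : ℝ) : ℝ :=
  h ^ (2 * γ) * (sobolevSeminormSq a b (q + 1) (u t) + sobolevSeminormSq a b (s + 1) (v t))
    + h ^ (2 * (s + 1)) * sobolevSeminormSq a b (s + 1) (vt t)

end BeamDG

end

namespace BeamDG

/-! ### Polynomials and integrals on an interval -/

/-! The error is split at piecewise polynomials `U`, `V`: `V` is the `D`-weighted L² projection of
`v`, and `U_xx` is, up to a correction at the nodes, the `D`-weighted projection of `u_xx`. The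
parts `u - U` and `v - V` are approximation errors (`exists_projection_bound`). The differences `z =
U - uh`, `w = V - vh` are discrete, and their energy `∑ ∫ (D z_xx² + μ w²)` is estimated by
Gronwall's inequality.

Testing the two equations of the scheme with `z` and `w` and integrating by parts twice makes the
coupling terms `∫ D z_xx w_xx` cancel (`element_rate`). Two volume terms survive. In `∫ (D z_xx)_xx
(V - v)` the top part `D z_xxxx` has a polynomial factor of degree at most `q - 4 ≤ s` and vanishes
by orthogonality; the rest carries fewer derivatives of `z`. The term `∫ μ w (V_t - v_t)` remains
because the projection has the weight `D` and not `μ`; it produces the contribution of `v_t`.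

Everything else sits at the nodes. The fluxes reproduce the exact solution, so a node contributes
`-β X² ≤ 0` for jumps or boundary traces `X` of the difference, plus products of `X` with traces of
projection errors (`interior_node`, `boundary_node`, `sum_nodeTerm_le`). The worst squared trace
errors are those of the shear, of order `h^(2(q-3)+1)`, and of the slope velocity, of order
`h^(2(s-1)+1)`; hence the minimum of `q - 3` and `s - 1`. Inverse inequalities bound `X` by the
energy at the price of negative powers of `h`, and Young's inequality leaves `lam` times the energy
plus a source of size `1/lam`. Under strict dissipation the products are absorbed by `-β X²`
instead, no inverse inequality is needed for them, and the source gains a factor `h`: this is the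
additional `1/2` in the rate. With `lam = 1/T` the Gronwall factor does not depend on `T`, and a
source of size `1 + T` acting during a time `T` gives `T²` (`exists_energy_error_bound`).

The case `s = 0` is special: `V_x` vanishes, and a trace of `v_x` is not controlled by `|v|_{H¹}`.
There the nodal value of `v_x` is replaced by the slope of a projection of `v`, which is stable by
an inverse inequality (`exists_slope_bound`), and `U_xx` is corrected by boundary terms so that the
replacement is invisible in the error equation (`exists_comparison`). -/

theorem integral_mul_sq_le {c d : ℝ} (hcd : c ≤ d) {f g : ℝ → ℝ}
    (hf : ContinuousOn f (Icc c d)) (hg : ContinuousOn g (Icc c d)) :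
    (∫ y in c..d, f y * g y) ^ 2 ≤ (∫ y in c..d, f y ^ 2) * ∫ y in c..d, g y ^ 2 := by
  rw [← uIcc_of_le hcd] at hf hg
  have h : ∀ x : ℝ, 0 ≤ (∫ y in c..d, f y ^ 2) * (x * x) + (2 * ∫ y in c..d, f y * g y) * x
      + ∫ y in c..d, g y ^ 2 := by
    intro x
    have i1 : IntervalIntegrable (fun y => f y ^ 2) volume c d := (hf.pow 2).intervalIntegrable
    have i2 : IntervalIntegrable (fun y => f y * g y) volume c d := (hf.mul hg).intervalIntegrable
    have i3 : IntervalIntegrable (fun y => g y ^ 2) volume c d := (hg.pow 2).intervalIntegrable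
    have : (∫ y in c..d, f y ^ 2) * (x * x) + (2 * ∫ y in c..d, f y * g y) * x
      + ∫ y in c..d, g y ^ 2 = ∫ y in c..d, (f y * x + g y) ^ 2 := by
      have e : (fun y => (f y * x + g y) ^ 2)
          = fun y => (x * x) * f y ^ 2 + (2 * x) * (f y * g y) + g y ^ 2 := by
        funext y; ring
      rw [e, intervalIntegral.integral_add ((i1.const_mul _).add (i2.const_mul _)) i3,
        intervalIntegral.integral_add (i1.const_mul _) (i2.const_mul _),
        intervalIntegral.integral_const_mul, intervalIntegral.integral_const_mul]
      ring
    rw [this]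
    exact intervalIntegral.integral_nonneg hcd fun y _ => sq_nonneg _
  have := discrim_le_zero h
  rw [discrim] at this
  nlinarith

theorem integral_sq_le {c d : ℝ} (hcd : c ≤ d) {f : ℝ → ℝ} (hf : ContinuousOn f (Icc c d)) :
    (∫ y in c..d, f y) ^ 2 ≤ (d - c) * ∫ y in c..d, f y ^ 2 := by
  have := integral_mul_sq_le hcd (f := fun _ => 1) (g := f) continuousOn_const hf
  simpa using this

theorem eval_intervalIntegrable (p : ℝ[X]) {ρ : ℝ → ℝ} {c d : ℝ}
    (hρ : IntervalIntegrable ρ volume c d) :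
    IntervalIntegrable (fun y => ρ y * p.eval y) volume c d :=
  hρ.mul_continuousOn p.continuous.continuousOn

/-- The linear functional `p ↦ ∫ ρ p`. -/
noncomputable def weightInt (ρ : ℝ → ℝ) (c d : ℝ) (hρ : IntervalIntegrable ρ volume c d) :
    ℝ[X] →ₗ[ℝ] ℝ where
  toFun p := ∫ y in c..d, ρ y * p.eval y
  map_add' p r := by
    rw [← intervalIntegral.integral_add (eval_intervalIntegrable p hρ)
      (eval_intervalIntegrable r hρ)]
    simp [mul_add]
  map_smul' k p := by
    rw [RingHom.id_apply, smul_eq_mul, ← intervalIntegral.integral_const_mul]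
    simp [mul_left_comm]

theorem weightInt_apply (ρ : ℝ → ℝ) (c d : ℝ) (hρ : IntervalIntegrable ρ volume c d) (p : ℝ[X]) :
    weightInt ρ c d hρ p = ∫ y in c..d, ρ y * p.eval y := rfl

/-- A polynomial with vanishing weighted square integral is zero. -/
theorem eq_zero_of_integral_sq {c d m : ℝ} (hcd : c < d) (hm : 0 < m) {ρ : ℝ → ℝ}
    (hρ : ContinuousOn ρ (Icc c d)) (hρm : ∀ y ∈ Icc c d, m ≤ ρ y) {p : ℝ[X]}
    (hp : ∫ y in c..d, ρ y * (p.eval y * p.eval y) = 0) : p = 0 := by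
  by_contra hne
  have : ∃ y ∈ Icc c d, 0 < ρ y * (p.eval y * p.eval y) := by
    by_contra! hcon
    apply hne
    apply Polynomial.eq_zero_of_infinite_isRoot
    apply (Icc_infinite hcd).mono
    intro y hy
    have h1 := hcon y hy
    have h2 := hρm y hy
    have h3 : p.eval y * p.eval y ≤ 0 := by
      by_contra! h
      have := mul_pos (hm.trans_le h2) h
      linarith
    have := mul_self_nonneg (p.eval y)
    exact mul_self_eq_zero.1 (le_antisymm h3 this)
  have h := intervalIntegral.integral_pos hcd
    (hρ.mul (p.continuous.mul p.continuous).continuousOn)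
    (fun y hy => mul_nonneg (hm.le.trans (hρm y (Ioc_subset_Icc_self hy))) (mul_self_nonneg _)) this
  exact absurd hp h.ne'

/-- Riesz representation on the polynomials of degree at most `r`, with a dual basis. -/
theorem exists_dual_basis {c d m : ℝ} (hcd : c < d) (hm : 0 < m) {ρ : ℝ → ℝ}
    (hρ : ContinuousOn ρ (Icc c d)) (hρm : ∀ y ∈ Icc c d, m ≤ ρ y) (r : ℕ) :
    ∃ ψ : ℕ → ℝ[X], (∀ k, (ψ k).natDegree ≤ r) ∧
      (∀ p : ℝ[X], p.natDegree ≤ r → ∀ k, p.coeff k = ∫ y in c..d, ρ y * (ψ k).eval y * p.eval y) ∧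
      ∀ ℓ : ℝ[X] →ₗ[ℝ] ℝ, ∀ φ : ℝ[X], φ.natDegree ≤ r →
        ∫ y in c..d, ρ y * φ.eval y *
          (∑ k ∈ Finset.range (r + 1), monomial k (ℓ (ψ k))).eval y = ℓ φ := by
  classical
  have hint : ∀ p : ℝ[X], IntervalIntegrable (fun y => ρ y * p.eval y) volume c d := fun p =>
    ContinuousOn.intervalIntegrable
      (by rw [uIcc_of_le hcd.le]; exact hρ.mul p.continuous.continuousOn)
  let B : ℝ[X] →ₗ[ℝ] ℝ[X] →ₗ[ℝ] ℝ := LinearMap.mk₂ ℝ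
    (fun p φ => ∫ y in c..d, ρ y * (φ * p).eval y)
    (fun p p' φ => by
      rw [← intervalIntegral.integral_add (hint _) (hint _)]; simp [mul_add])
    (fun k p φ => by
      rw [smul_eq_mul, ← intervalIntegral.integral_const_mul]
      simp [mul_left_comm])
    (fun p φ φ' => by
      rw [← intervalIntegral.integral_add (hint _) (hint _)]; simp [mul_add, add_mul])
    (fun k p φ => by
      rw [smul_eq_mul, ← intervalIntegral.integral_const_mul]
      simp [mul_left_comm])
  have hB : ∀ p φ, B p φ = ∫ y in c..d, ρ y * (φ * p).eval y := fun _ _ => rfl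
  let W := degreeLT ℝ (r + 1)
  have hW : ∀ p : ℝ[X], p ∈ W ↔ p.natDegree ≤ r := by
    intro p
    rw [mem_degreeLT, ← Nat.lt_succ_iff]
    by_cases hp : p = 0
    · simp [hp]
    · rw [natDegree_lt_iff_degree_lt hp]
  have : FiniteDimensional ℝ W := Module.Finite.equiv (degreeLTEquiv ℝ (r + 1)).symm
  let A : W →ₗ[ℝ] Module.Dual ℝ W := (B.domRestrict₁₂ W W)
  have hA : ∀ p φ : W, A p φ = ∫ y in c..d, ρ y * ((φ : ℝ[X]) * p).eval y := fun _ _ => rfl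
  -- The weighted form is definite, so `A` is injective; equality of dimensions makes every
  -- functional representable.
  have hinj : Function.Injective A := by
    rw [← LinearMap.ker_eq_bot, LinearMap.ker_eq_bot']
    intro p hp
    have := hA p p
    rw [hp] at this
    ext1
    apply eq_zero_of_integral_sq hcd hm hρ hρm
    simpa using this.symm
  have hsurj : Function.Surjective A :=
    (LinearMap.injective_iff_surjective_of_finrank_eq_finrank
      (Subspace.dual_finrank_eq (K := ℝ) (V := W)).symm).1 hinj
  have hrep : ∀ ℓ : ℝ[X] →ₗ[ℝ] ℝ, ∃ p : W, ∀ φ : W, A p φ = ℓ φ := by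
    intro ℓ
    obtain ⟨p, hp⟩ := hsurj (ℓ.comp W.subtype)
    exact ⟨p, fun φ => by rw [hp]; rfl⟩
  choose g hg using hrep
  refine ⟨fun k => g (lcoeff ℝ k), fun k => (hW _).1 (g (lcoeff ℝ k)).2, ?_, ?_⟩
  · intro p hp k
    have := hg (lcoeff ℝ k) ⟨p, (hW p).2 hp⟩
    rw [hA] at this
    rw [lcoeff_apply] at this
    simp only at this
    rw [← this]
    congr 1; funext y; rw [eval_mul]; ring
  · intro ℓ φ hφ
    -- By symmetry of the form, the `k`-th coefficient of the representer of `ℓ` is `ℓ` applied to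
    -- the representer of the `k`-th coefficient functional. The representer is thus an explicit
    -- linear function of finitely many values of `ℓ`, which later gives differentiability in time.
    have hcoef : ∀ k, (g ℓ : ℝ[X]).coeff k = ℓ (g (lcoeff ℝ k)) := by
      intro k
      have h1 := hg (lcoeff ℝ k) (g ℓ)
      have h2 := hg ℓ (g (lcoeff ℝ k))
      rw [hA] at h1 h2
      rw [← h2, ← lcoeff_apply, ← h1]
      congr 1; funext y; rw [eval_mul, eval_mul]; ring
    have : ∑ k ∈ Finset.range (r + 1), monomial k (ℓ (g (lcoeff ℝ k))) = (g ℓ : ℝ[X]) := by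
      conv_rhs => rw [as_sum_range' (g ℓ : ℝ[X]) (r + 1) (Nat.lt_succ_of_le ((hW _).1 (g ℓ).2))]
      exact Finset.sum_congr rfl fun k _ => by rw [hcoef]
    rw [this]
    have h2 := hg ℓ ⟨φ, (hW φ).2 hφ⟩
    rw [hA] at h2
    rw [← h2]
    congr 1; funext y; simp only [eval_mul]; ring

/-- Inverse inequalities for polynomials on the unit interval. -/
theorem exists_unit_inverse_ineq (r : ℕ) : ∃ C : ℝ, 0 < C ∧ ∀ p : ℝ[X], p.natDegree ≤ r →
    ∀ y ∈ Icc (0 : ℝ) 1, (p.eval y) ^ 2 ≤ C * ∫ y in (0 : ℝ)..1, (p.eval y) ^ 2 ∧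
      ((derivative p).eval y) ^ 2 ≤ C * ∫ y in (0 : ℝ)..1, (p.eval y) ^ 2 := by
  obtain ⟨ψ, -, hψ, -⟩ := exists_dual_basis (c := 0) (d := 1) (m := 1) one_pos one_pos
    (ρ := fun _ => 1) continuousOn_const (fun _ _ => le_rfl) r
  set G : ℝ := ∑ k ∈ Finset.range (r + 1), ∫ y in (0 : ℝ)..1, ((ψ k).eval y) ^ 2 with hG
  have hG0 : 0 ≤ G := Finset.sum_nonneg fun k _ =>
    intervalIntegral.integral_nonneg zero_le_one fun y _ => sq_nonneg _
  have hr : (0 : ℝ) < (r + 1 : ℕ) := by positivity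
  refine ⟨(r + 1 : ℕ) * ((r + 1 : ℕ) ^ 2 * (G + 1)), by positivity, ?_⟩
  intro p hp y hy
  have hcoef : ∑ k ∈ Finset.range (r + 1), p.coeff k ^ 2
      ≤ G * ∫ y in (0 : ℝ)..1, (p.eval y) ^ 2 := by
    rw [hG, Finset.sum_mul]
    apply Finset.sum_le_sum
    intro k _
    rw [hψ p hp k]
    simp only [one_mul]
    exact integral_mul_sq_le zero_le_one (ψ k).continuous.continuousOn p.continuous.continuousOn
  have hI : 0 ≤ ∫ y in (0 : ℝ)..1, (p.eval y) ^ 2 :=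
    intervalIntegral.integral_nonneg zero_le_one fun y _ => sq_nonneg _
  have hS : 0 ≤ ∑ k ∈ Finset.range (r + 1), p.coeff k ^ 2 :=
    Finset.sum_nonneg fun k _ => sq_nonneg _
  -- Both `p` and its derivative at `y` are pairings of the coefficients with weights `y^k`,
  -- respectively `k y^(k-1)`, bounded by `r + 1`; the coefficients are bounded by the L² norm
  -- through the dual basis and Cauchy–Schwarz.
  have key : ∀ w : ℕ → ℝ, (∀ k ∈ Finset.range (r + 1), |w k| ≤ (r + 1 : ℕ)) →
      (∑ k ∈ Finset.range (r + 1), p.coeff k * w k) ^ 2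
        ≤ (r + 1 : ℕ) * ((r + 1 : ℕ) ^ 2 * (G + 1)) * ∫ y in (0 : ℝ)..1, (p.eval y) ^ 2 := by
    intro w hw
    have h1 := Finset.sum_mul_sq_le_sq_mul_sq (Finset.range (r + 1)) (fun k => p.coeff k) w
    have h2 : ∑ k ∈ Finset.range (r + 1), w k ^ 2 ≤ (r + 1 : ℕ) * ((r + 1 : ℕ) : ℝ) ^ 2 := by
      have := Finset.sum_le_card_nsmul (Finset.range (r + 1)) (fun k => w k ^ 2)
        (((r + 1 : ℕ) : ℝ) ^ 2) (fun k hk => sq_le_sq' (neg_le_of_abs_le (hw k hk))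
          (le_of_abs_le (hw k hk)))
      simpa using this
    calc _ ≤ _ := h1
      _ ≤ (G * ∫ y in (0 : ℝ)..1, (p.eval y) ^ 2) * ((r + 1 : ℕ) * ((r + 1 : ℕ) : ℝ) ^ 2) :=
          mul_le_mul hcoef h2 (Finset.sum_nonneg fun k _ => sq_nonneg _) (by positivity)
      _ ≤ _ := by
          have : 0 ≤ ((r + 1 : ℕ) * ((r + 1 : ℕ) : ℝ) ^ 2) * ∫ y in (0 : ℝ)..1, (p.eval y) ^ 2 := by
            positivity
          nlinarith
  have hyk : ∀ k : ℕ, |y ^ k| ≤ 1 := fun k => by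
    rw [abs_of_nonneg (pow_nonneg hy.1 k)]; exact pow_le_one₀ hy.1 hy.2
  constructor
  · rw [eval_eq_sum_range' (Nat.lt_succ_of_le hp)]
    refine key _ fun k _ => (hyk k).trans ?_
    push_cast; linarith [(Nat.cast_nonneg r : (0 : ℝ) ≤ r)]
  · rw [derivative_eval, sum_over_range' p (fun n => by simp) (r + 1) (Nat.lt_succ_of_le hp)]
    simp_rw [mul_assoc (p.coeff _)]
    refine key _ fun k hk => ?_
    rw [abs_mul, abs_of_nonneg (Nat.cast_nonneg k : (0 : ℝ) ≤ k)]
    have : (k : ℝ) ≤ (r + 1 : ℕ) := by exact_mod_cast (Finset.mem_range.1 hk).le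
    calc (k : ℝ) * |y ^ (k - 1)| ≤ k * 1 := by gcongr; exact hyk _
      _ ≤ _ := by linarith

/-- Inverse inequalities for polynomials on an interval. -/
theorem exists_inverse_ineq (r : ℕ) : ∃ C : ℝ, 0 < C ∧ ∀ c d : ℝ, c < d → ∀ p : ℝ[X],
    p.natDegree ≤ r → ∀ y ∈ Icc c d,
      (d - c) * (p.eval y) ^ 2 ≤ C * ∫ y in c..d, (p.eval y) ^ 2 ∧
      (d - c) ^ 3 * ((derivative p).eval y) ^ 2 ≤ C * ∫ y in c..d, (p.eval y) ^ 2 := by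
  obtain ⟨C, hC, h⟩ := exists_unit_inverse_ineq r
  refine ⟨C, hC, fun c d hcd p hp y hy => ?_⟩
  have hl : 0 < d - c := sub_pos.2 hcd
  set P : ℝ[X] := p.comp (Polynomial.C (d - c) * X + Polynomial.C c) with hP
  have hPd : P.natDegree ≤ r := by
    rw [hP, natDegree_comp]
    have : (Polynomial.C (d - c) * X + Polynomial.C c).natDegree ≤ 1 := natDegree_linear_le
    nlinarith
  have hPe : ∀ x, P.eval x = p.eval ((d - c) * x + c) := by intro x; simp [hP]
  have hPde : ∀ x, (derivative P).eval x = (d - c) * (derivative p).eval ((d - c) * x + c) := by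
    intro x; simp [hP, derivative_comp]
  have hint : ∫ x in (0 : ℝ)..1, (P.eval x) ^ 2 = (d - c)⁻¹ * ∫ y in c..d, (p.eval y) ^ 2 := by
    simp only [hPe]
    have := intervalIntegral.integral_comp_mul_add (a := 0) (b := 1) (fun y => (p.eval y) ^ 2)
      hl.ne' c
    rw [this]; simp
  have hx : (y - c) / (d - c) ∈ Icc (0 : ℝ) 1 :=
    ⟨div_nonneg (sub_nonneg.2 hy.1) hl.le, by rw [div_le_one hl]; linarith [hy.2]⟩
  have hxy : (d - c) * ((y - c) / (d - c)) + c = y := by field_simp; ring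
  obtain ⟨h1, h2⟩ := h P hPd _ hx
  rw [hPe, hxy, hint] at h1
  rw [hPde, hxy, hint] at h2
  have e : ∀ I : ℝ, C * ((d - c)⁻¹ * I) * (d - c) = C * I := by intro I; field_simp
  constructor
  · have := mul_le_mul_of_nonneg_right h1 hl.le
    rw [e] at this; linarith
  · have := mul_le_mul_of_nonneg_right h2 hl.le
    rw [e] at this; nlinarith

theorem exists_antiderivative (p : ℝ[X]) (c α : ℝ) :
    ∃ P : ℝ[X], derivative P = p ∧ P.eval c = α ∧ P.natDegree ≤ p.natDegree + 1 := by
  let Q : ℝ[X] := ∑ k ∈ Finset.range (p.natDegree + 1), monomial (k + 1) (p.coeff k / (k + 1))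
  have hQ : derivative Q = p := by
    conv_rhs => rw [as_sum_range p]
    simp only [Q, derivative_sum, derivative_monomial]
    refine Finset.sum_congr rfl fun k _ => ?_
    have : (k : ℝ) + 1 ≠ 0 := by positivity
    rw [Nat.add_sub_cancel]; congr 1; push_cast; field_simp
  have hQd : Q.natDegree ≤ p.natDegree + 1 := by
    refine natDegree_sum_le_of_forall_le _ _ fun k hk => ?_
    refine (natDegree_monomial_le _).trans ?_
    have := Finset.mem_range.1 hk
    omega
  refine ⟨Q + C (α - Q.eval c), by simp [hQ], by simp, ?_⟩
  exact (natDegree_add_le _ _).trans (max_le hQd (by simp))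

/-- A second antiderivative of a polynomial. -/
theorem exists_antiderivative_two : ∃ A : ℝ[X] → ℝ[X], ∀ p,
    derivative (derivative (A p)) = p ∧ (A p).natDegree ≤ p.natDegree + 2 := by
  have : ∀ p : ℝ[X], ∃ P : ℝ[X], derivative (derivative P) = p ∧ P.natDegree ≤ p.natDegree + 2 := by
    intro p
    obtain ⟨P, h1, -, h2⟩ := exists_antiderivative p 0 0
    obtain ⟨Q, h3, -, h4⟩ := exists_antiderivative P 0 0
    exact ⟨Q, by rw [h3, h1], by omega⟩
  choose A hA using this
  exact ⟨A, hA⟩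

/-! ### Taylor polynomials and weighted projections -/

theorem integral_eq_sub_of_hasDerivWithinAt_Icc {c d : ℝ} (hcd : c ≤ d) {f f' : ℝ → ℝ}
    (hf : ∀ y ∈ Icc c d, HasDerivWithinAt f (f' y) (Icc c d) y)
    (hi : IntervalIntegrable f' volume c d) : ∫ y in c..d, f' y = f d - f c :=
  intervalIntegral.integral_eq_sub_of_hasDerivAt_of_le hcd (fun y hy => (hf y hy).continuousWithinAt)
    (fun y hy => (hf y (Ioo_subset_Icc_self hy)).hasDerivAt (Icc_mem_nhds hy.1 hy.2)) hi

theorem intervalIntegrable_of_Icc {c d : ℝ} (hcd : c ≤ d) {f : ℝ → ℝ}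
    (hf : ContinuousOn f (Icc c d)) : IntervalIntegrable f volume c d :=
  ContinuousOn.intervalIntegrable (by rwa [uIcc_of_le hcd])

theorem integral_sq_add_sq {c d : ℝ} (hcd : c ≤ d) {f g : ℝ → ℝ}
    (hf : ContinuousOn f (Icc c d)) (hg : ContinuousOn g (Icc c d)) (α β : ℝ) :
    ∫ y in c..d, (α * f y ^ 2 + β * g y ^ 2)
      = α * (∫ y in c..d, f y ^ 2) + β * ∫ y in c..d, g y ^ 2 := by
  have h1 : IntervalIntegrable (fun y => f y ^ 2) volume c d :=
    intervalIntegrable_of_Icc hcd (hf.pow 2)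
  have h2 : IntervalIntegrable (fun y => g y ^ 2) volume c d :=
    intervalIntegrable_of_Icc hcd (hg.pow 2)
  rw [intervalIntegral.integral_add (h1.const_mul _) (h2.const_mul _),
    intervalIntegral.integral_const_mul, intervalIntegral.integral_const_mul]

theorem mul_sub_sq_le {l : ℝ} (hl : 0 ≤ l) (x y : ℝ) :
    l * (x - y) ^ 2 ≤ 2 * (l * x ^ 2) + 2 * (l * y ^ 2) := by
  have := mul_nonneg hl (sq_nonneg (x + y))
  linarith

theorem integral_sq_le_of_bound {c d B : ℝ} (hcd : c ≤ d) {f : ℝ → ℝ}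
    (hf : ContinuousOn f (Icc c d)) (hB : ∀ y ∈ Icc c d, f y ^ 2 ≤ B) :
    ∫ y in c..d, f y ^ 2 ≤ (d - c) * B := by
  have := intervalIntegral.integral_mono_on hcd (f := fun y => f y ^ 2) (g := fun _ => B)
    (intervalIntegrable_of_Icc hcd (hf.pow 2))
    intervalIntegrable_const hB
  simpa using this

/-- If `f c = 0` then `f` is controlled by its derivative. -/
theorem sq_le_of_hasDerivWithinAt {c d : ℝ} {f f' : ℝ → ℝ}
    (hf : ∀ y ∈ Icc c d, HasDerivWithinAt f (f' y) (Icc c d) y)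
    (hf' : ContinuousOn f' (Icc c d)) (h0 : f c = 0) {y : ℝ} (hy : y ∈ Icc c d) :
    f y ^ 2 ≤ (d - c) * ∫ x in c..d, f' x ^ 2 := by
  have hsub : Icc c y ⊆ Icc c d := Icc_subset_Icc_right hy.2
  have h1 : ∫ x in c..y, f' x = f y := by
    rw [integral_eq_sub_of_hasDerivWithinAt_Icc hy.1 (fun x hx => (hf x (hsub hx)).mono hsub)
      (ContinuousOn.intervalIntegrable (by rw [uIcc_of_le hy.1]; exact hf'.mono hsub)), h0, sub_zero]
  have h2 := integral_sq_le hy.1 (hf'.mono hsub)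
  rw [h1] at h2
  have h3 : ∫ x in c..y, f' x ^ 2 ≤ ∫ x in c..d, f' x ^ 2 :=
    intervalIntegral.integral_mono_interval le_rfl hy.1 hy.2
      (Filter.Eventually.of_forall fun x => sq_nonneg _)
      (ContinuousOn.intervalIntegrable (by
        rw [uIcc_of_le (hy.1.trans hy.2)]; exact hf'.pow 2))
  have h4 : 0 ≤ ∫ x in c..y, f' x ^ 2 :=
    intervalIntegral.integral_nonneg hy.1 fun x _ => sq_nonneg _
  calc _ ≤ _ := h2
    _ ≤ _ := mul_le_mul (by linarith [hy.2]) h3 h4 (by linarith [hy.1, hy.2])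

/-- `g 0, …, g (k+1)` are the successive derivatives of `g 0` on `[c,d]`. -/
structure DerivChain (c d : ℝ) (k : ℕ) (g : ℕ → ℝ → ℝ) : Prop where
  deriv : ∀ i ≤ k, ∀ y ∈ Icc c d, HasDerivWithinAt (g i) (g (i + 1) y) (Icc c d) y
  cont : ContinuousOn (g (k + 1)) (Icc c d)

theorem DerivChain.continuousOn {c d : ℝ} {k : ℕ} {g : ℕ → ℝ → ℝ} (h : DerivChain c d k g)
    {i : ℕ} (hi : i ≤ k + 1) : ContinuousOn (g i) (Icc c d) := by
  rcases Nat.lt_or_ge k i with h1 | h1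
  · obtain rfl : i = k + 1 := le_antisymm hi h1
    exact h.cont
  · exact fun y hy => (h.deriv i h1 y hy).continuousWithinAt

theorem DerivChain.mono {c d c' d' : ℝ} {k : ℕ} {g : ℕ → ℝ → ℝ} (h : DerivChain c d k g)
    (hs : Icc c' d' ⊆ Icc c d) : DerivChain c' d' k g :=
  ⟨fun i hi y hy => (h.deriv i hi y (hs hy)).mono hs, h.cont.mono hs⟩

theorem DerivChain.of_le {c d : ℝ} {k l : ℕ} {g : ℕ → ℝ → ℝ} (h : DerivChain c d k g)
    (hl : l ≤ k) : DerivChain c d l g :=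
  ⟨fun i hi => h.deriv i (hi.trans hl), h.continuousOn (by omega)⟩

theorem DerivChain.shift {c d : ℝ} {k : ℕ} {g : ℕ → ℝ → ℝ} (h : DerivChain c d (k + 1) g) :
    DerivChain c d k (fun i => g (i + 1)) :=
  ⟨fun i hi => h.deriv (i + 1) (by omega), h.cont⟩

/-- By induction the derivative is approximated first, and the antiderivative agreeing with `g 0` at
`c` is taken. Each integration gains a factor `(d - c)^2` in the squared pointwise error, and only
the L² norm of the top derivative enters. -/
theorem DerivChain.exists_taylor {c d : ℝ} (hcd : c ≤ d) {k : ℕ} {g : ℕ → ℝ → ℝ}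
    (h : DerivChain c d k g) : ∃ T : ℝ[X], T.natDegree ≤ k ∧ ∀ i ≤ k, ∀ y ∈ Icc c d,
      (g i y - (derivative^[i] T).eval y) ^ 2
        ≤ (d - c) ^ (2 * (k - i) + 1) * ∫ x in c..d, g (k + 1) x ^ 2 := by
  induction k generalizing g with
  | zero =>
    refine ⟨C (g 0 c), by simp, fun i hi y hy => ?_⟩
    obtain rfl : i = 0 := by omega
    have := sq_le_of_hasDerivWithinAt (f := fun y => g 0 y - g 0 c) (f' := g 1)
      (fun y hy => (h.deriv 0 le_rfl y hy).sub_const _) h.cont (by simp) hy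
    simpa using this
  | succ k ih =>
    obtain ⟨T₁, hT₁, hb⟩ := ih h.shift
    obtain ⟨T, hT, hTc, hTd⟩ := exists_antiderivative T₁ c (g 0 c)
    refine ⟨T, by omega, fun i hi y hy => ?_⟩
    cases i with
    | zero =>
      have h0 := hb 0 (Nat.zero_le k)
      simp only [Function.iterate_zero, id_eq, zero_add, Nat.sub_zero] at h0 ⊢
      have hcont : ContinuousOn (fun x => g 1 x - T₁.eval x) (Icc c d) :=
        (h.continuousOn (by omega)).sub T₁.continuous.continuousOn
      have h1 := sq_le_of_hasDerivWithinAt (f := fun y => g 0 y - T.eval y)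
        (f' := fun y => g 1 y - T₁.eval y)
        (fun y hy => (h.deriv 0 (Nat.zero_le _) y hy).sub
          (by rw [← hT]; exact (T.hasDerivAt y).hasDerivWithinAt)) hcont (by simp [hTc]) hy
      have h2 := integral_sq_le_of_bound hcd hcont h0
      have hl : 0 ≤ d - c := sub_nonneg.2 hcd
      calc _ ≤ _ := h1
        _ ≤ (d - c) * ((d - c) * ((d - c) ^ (2 * k + 1) * ∫ x in c..d, g (k + 1 + 1) x ^ 2)) :=
            mul_le_mul_of_nonneg_left h2 hl
        _ = _ := by ring
    | succ i =>
      have := hb i (by omega) y hy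
      rw [Function.iterate_succ_apply, hT]
      rwa [show k + 1 - (i + 1) = k - i by omega]

/-- Error bounds for a weighted projection onto polynomials, perturbed by boundary terms. -/
theorem exists_projection_bound (r k : ℕ) (hk : k ≤ r) (m K : ℝ) (hm : 0 < m) :
    ∃ C : ℝ, 0 < C ∧ ∀ c d : ℝ, c < d → ∀ D : ℝ → ℝ, ContinuousOn D (Icc c d) →
      (∀ y ∈ Icc c d, m ≤ D y ∧ D y ≤ K) → ∀ g : ℕ → ℝ → ℝ, DerivChain c d k g →
      ∀ p : ℝ[X], p.natDegree ≤ r → ∀ κc κd : ℝ,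
      (∀ φ : ℝ[X], φ.natDegree ≤ r → ∫ y in c..d, D y * φ.eval y * (p.eval y - g 0 y)
        = -(D d * φ.eval d * κd - D c * φ.eval c * κc)) →
      ∀ R : ℝ, (d - c) ^ (2 * k + 2) * ∫ y in c..d, g (k + 1) y ^ 2 ≤ R →
        κc ^ 2 ≤ (d - c) * R → κd ^ 2 ≤ (d - c) * R →
      (∫ y in c..d, (p.eval y - g 0 y) ^ 2 ≤ C * R) ∧ ∀ y ∈ Icc c d,
        (d - c) * (p.eval y - g 0 y) ^ 2 ≤ C * R ∧
        (1 ≤ k → (d - c) ^ 3 * ((derivative p).eval y - g 1 y) ^ 2 ≤ C * R) ∧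
        (k = 0 → (d - c) ^ 3 * ((derivative p).eval y) ^ 2 ≤ C * R) := by
  obtain ⟨I, hI, hinv⟩ := exists_inverse_ineq r
  set C₁ : ℝ := (2 / m) * (K ^ 2 / m + 4 * I * K ^ 2 / m) with hC₁
  have hC₁0 : 0 ≤ C₁ := by positivity
  refine ⟨2 * ((1 + I) * C₁ + 1), by positivity, ?_⟩
  intro c d hcd D hD hDb g hg p hp κc κd horth R hR hκc hκd
  have hl : 0 < d - c := sub_pos.2 hcd
  obtain ⟨T, hTd, hT⟩ := hg.exists_taylor hcd.le
  set A : ℝ := ∫ y in c..d, g (k + 1) y ^ 2 with hA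
  have hA0 : 0 ≤ A := intervalIntegral.integral_nonneg hcd.le fun y _ => sq_nonneg _
  have hR0 : 0 ≤ R := le_trans (by positivity) hR
  -- The distance to the Taylor polynomial is itself an admissible test function, since `k ≤ r`. Its
  -- norm `J` is bounded in `hmain`, and inverse inequalities for `P` then give the pointwise
  -- bounds.
  set P : ℝ[X] := p - T with hP
  have hPd : P.natDegree ≤ r := (natDegree_sub_le _ _).trans (max_le hp (hTd.trans hk))
  have hPc : ContinuousOn (fun y => P.eval y) (Icc c d) := P.continuous.continuousOn
  have hwc : ContinuousOn (fun y => g 0 y - T.eval y) (Icc c d) :=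
    (hg.continuousOn (by omega)).sub T.continuous.continuousOn
  have hw : ∀ y ∈ Icc c d, (d - c) * (g 0 y - T.eval y) ^ 2 ≤ R := by
    intro y hy
    have := mul_le_mul_of_nonneg_left (hT 0 (Nat.zero_le k) y hy) hl.le
    simp only [Function.iterate_zero, id_eq, Nat.sub_zero] at this
    calc _ ≤ _ := this
      _ = (d - c) ^ (2 * k + 2) * A := by ring
      _ ≤ R := hR
  have hwI : ∫ y in c..d, (g 0 y - T.eval y) ^ 2 ≤ R := by
    have := integral_sq_le_of_bound hcd.le hwc (B := R / (d - c)) fun y hy => by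
      rw [le_div_iff₀ hl]; linarith [hw y hy]
    rwa [mul_div_cancel₀ _ hl.ne'] at this
  set J : ℝ := ∫ y in c..d, (P.eval y) ^ 2 with hJ
  have hJ0 : 0 ≤ J := intervalIntegral.integral_nonneg hcd.le fun y _ => sq_nonneg _
  have ii : ∀ {f : ℝ → ℝ}, ContinuousOn f (Icc c d) → IntervalIntegrable f volume c d := fun hf =>
    ContinuousOn.intervalIntegrable (by rwa [uIcc_of_le hcd.le])
  -- The Young weight is tuned so that the two boundary terms use up `m / 4` of the coercivity
  -- constant; the Taylor error uses another `m / 4`, and `m / 2` is left for `J`.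
  have hbd : ∀ y ∈ Icc c d, ∀ κ : ℝ, κ ^ 2 ≤ (d - c) * R →
      |D y * P.eval y * κ| ≤ m / 8 * J + 2 * I * K ^ 2 / m * R := by
    intro y hy κ hκ
    have h1 := (hinv c d hcd P hPd y hy).1
    have hD2 : (D y) ^ 2 ≤ K ^ 2 := by have := hDb y hy; nlinarith
    have e1 : (D y * κ) ^ 2 / (d - c) ≤ K ^ 2 * R := by
      rw [div_le_iff₀ hl, mul_pow]
      calc D y ^ 2 * κ ^ 2 ≤ K ^ 2 * ((d - c) * R) := by gcongr
        _ = _ := by ring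
    have e2 : |D y * P.eval y * κ| ≤ m / (8 * I) * ((d - c) * P.eval y ^ 2)
        + 2 * I / m * ((D y * κ) ^ 2 / (d - c)) := by
      have : m / (8 * I) * ((d - c) * P.eval y ^ 2) + 2 * I / m * ((D y * κ) ^ 2 / (d - c))
          - |D y * P.eval y * κ| = m / (8 * I) * (d - c) *
            (|P.eval y| - 4 * I / (m * (d - c)) * |D y * κ|) ^ 2 := by
        rw [← sq_abs (P.eval y), ← sq_abs (D y * κ),
          show D y * P.eval y * κ = P.eval y * (D y * κ) by ring, abs_mul (P.eval y) (D y * κ)]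
        generalize |P.eval y| = X
        generalize |D y * κ| = Y
        field_simp
        ring
      have h0 : 0 ≤ m / (8 * I) * (d - c) *
            (|P.eval y| - 4 * I / (m * (d - c)) * |D y * κ|) ^ 2 := by positivity
      linarith
    calc _ ≤ _ := e2
      _ ≤ m / (8 * I) * (I * J) + 2 * I / m * (K ^ 2 * R) := by gcongr
      _ = _ := by field_simp
  have hmain : m * J ≤ m / 4 * J + K ^ 2 / m * R + 2 * (m / 8 * J + 2 * I * K ^ 2 / m * R) := by
    have h1 : m * J ≤ ∫ y in c..d, D y * P.eval y * P.eval y := by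
      rw [hJ, ← intervalIntegral.integral_const_mul]
      refine intervalIntegral.integral_mono_on hcd.le (ii (continuousOn_const.mul (hPc.pow 2)))
        (ii ((hD.mul hPc).mul hPc)) fun y hy => ?_
      have := (hDb y hy).1
      nlinarith [sq_nonneg (P.eval y)]
    have h2 : ∫ y in c..d, D y * P.eval y * P.eval y
        = (∫ y in c..d, D y * P.eval y * (p.eval y - g 0 y))
          + ∫ y in c..d, D y * P.eval y * (g 0 y - T.eval y) := by
      rw [← intervalIntegral.integral_add]
      · congr 1; funext y; simp only [hP, eval_sub]; ring
      · exact ii ((hD.mul hPc).mul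
          (p.continuous.continuousOn.sub (hg.continuousOn (Nat.zero_le _))))
      · exact ii ((hD.mul hPc).mul hwc)
    have h3 : ∫ y in c..d, D y * P.eval y * (g 0 y - T.eval y)
        ≤ m / 4 * J + K ^ 2 / m * R := by
      calc _ ≤ ∫ y in c..d, (m / 4 * P.eval y ^ 2 + K ^ 2 / m * (g 0 y - T.eval y) ^ 2) := by
            refine intervalIntegral.integral_mono_on hcd.le (ii ((hD.mul hPc).mul hwc))
              (ii ((continuousOn_const.mul (hPc.pow 2)).add
                (continuousOn_const.mul (hwc.pow 2)))) fun y hy => ?_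
            have hD2 : (D y) ^ 2 ≤ K ^ 2 := by have := hDb y hy; nlinarith
            have e : m / 4 * P.eval y ^ 2 + (D y) ^ 2 / m * (g 0 y - T.eval y) ^ 2
              - D y * P.eval y * (g 0 y - T.eval y)
              = m / 4 * (P.eval y - 2 * D y / m * (g 0 y - T.eval y)) ^ 2 := by
              field_simp; ring
            have e0 : 0 ≤ m / 4 * (P.eval y - 2 * D y / m * (g 0 y - T.eval y)) ^ 2 := by
              positivity
            have e1 : (D y) ^ 2 / m * (g 0 y - T.eval y) ^ 2
              ≤ K ^ 2 / m * (g 0 y - T.eval y) ^ 2 := by gcongr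
            linarith
        _ = m / 4 * J + K ^ 2 / m * ∫ y in c..d, (g 0 y - T.eval y) ^ 2 := by
            rw [integral_sq_add_sq hcd.le hPc hwc]
        _ ≤ _ := by gcongr
    have h4 := hbd c (left_mem_Icc.2 hcd.le) κc hκc
    have h5 := hbd d (right_mem_Icc.2 hcd.le) κd hκd
    rw [h2, horth P hPd] at h1
    have := abs_le.1 h4
    have := abs_le.1 h5
    linarith
  have hJb : J ≤ C₁ * R := by
    have : m / 2 * J ≤ (K ^ 2 / m + 4 * I * K ^ 2 / m) * R := by
      have e : (K ^ 2 / m + 4 * I * K ^ 2 / m) * R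
        = K ^ 2 / m * R + 2 * (2 * I * K ^ 2 / m * R) := by ring
      rw [e]; linarith
    rw [hC₁, mul_assoc]
    calc J = 2 / m * (m / 2 * J) := by field_simp
      _ ≤ _ := by gcongr
  have hIC : 0 ≤ I * C₁ * R := by positivity
  have hCR : 0 ≤ C₁ * R := by positivity
  have hIJ : I * J ≤ I * C₁ * R := by
    rw [mul_assoc]; exact mul_le_mul_of_nonneg_left hJb hI.le
  have hexp : 2 * ((1 + I) * C₁ + 1) * R = 2 * (C₁ * R) + 2 * (I * C₁ * R) + 2 * R := by ring
  rw [hexp]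
  refine ⟨?_, fun y hy => ⟨?_, fun hk1 => ?_, fun hk0 => ?_⟩⟩
  · calc _ ≤ ∫ y in c..d, (2 * P.eval y ^ 2 + 2 * (g 0 y - T.eval y) ^ 2) := by
          refine intervalIntegral.integral_mono_on hcd.le
            (ii ((p.continuous.continuousOn.sub (hg.continuousOn (Nat.zero_le _))).pow 2))
            (ii ((continuousOn_const.mul (hPc.pow 2)).add
                (continuousOn_const.mul (hwc.pow 2)))) fun y _ => ?_
          have : p.eval y - g 0 y = P.eval y - (g 0 y - T.eval y) := by
            simp only [hP, eval_sub]; ring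
          rw [this]
          nlinarith [sq_nonneg (P.eval y + (g 0 y - T.eval y))]
      _ = 2 * J + 2 * ∫ y in c..d, (g 0 y - T.eval y) ^ 2 := by
          rw [integral_sq_add_sq hcd.le hPc hwc]
      _ ≤ _ := by linarith
  · have h1 := (hinv c d hcd P hPd y hy).1
    have h2 := hw y hy
    have : p.eval y - g 0 y = P.eval y - (g 0 y - T.eval y) := by
      simp only [hP, eval_sub]; ring
    rw [this]
    have := mul_sub_sq_le hl.le (P.eval y) (g 0 y - T.eval y)
    linarith
  · have h1 := (hinv c d hcd P hPd y hy).2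
    have h2 : (d - c) ^ 3 * (g 1 y - (derivative T).eval y) ^ 2 ≤ R := by
      have := mul_le_mul_of_nonneg_left (hT 1 hk1 y hy) (pow_pos hl 3).le
      simp only [Function.iterate_one] at this
      refine this.trans (le_trans (le_of_eq ?_) hR)
      rw [← mul_assoc, ← pow_add]
      congr 2; omega
    have : (derivative p).eval y - g 1 y
        = (derivative P).eval y - (g 1 y - (derivative T).eval y) := by
      simp only [hP, derivative_sub, eval_sub]; ring
    rw [this]
    have := mul_sub_sq_le (pow_pos hl 3).le ((derivative P).eval y)
      (g 1 y - (derivative T).eval y)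
    linarith
  · have h1 := (hinv c d hcd P hPd y hy).2
    -- For `k = 0` the Taylor polynomial is constant, so the slope of `p` itself is bounded using
    -- only the L² norm of `g 1`, without any pointwise value of `g 1`.
    have hT0 : derivative T = 0 := derivative_of_natDegree_zero (by omega)
    have : derivative P = derivative p := by simp [hP, hT0]
    rw [this] at h1
    linarith

/-! ### Differentiation in time -/

/-- A derivative within an interval inherits a Lipschitz bound. -/
theorem abs_le_of_hasDerivWithinAt_Icc_of_lipschitz {a b L f' y : ℝ} (hab : a < b) {f : ℝ → ℝ}
    (hy : y ∈ Icc a b) (hf : HasDerivWithinAt f f' (Icc a b) y)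
    (hL : ∀ x ∈ Icc a b, |f x - f y| ≤ L * |x - y|) : |f'| ≤ L := by
  rw [hasDerivWithinAt_iff_tendsto_slope] at hf
  have hne : (nhdsWithin y (Icc a b \ {y})).NeBot := by
    have := (uniqueDiffOn_Icc hab y hy)
    rw [uniqueDiffWithinAt_iff_accPt, accPt_principal_iff_nhdsWithin] at this
    exact this
  refine le_of_tendsto hf.abs ?_
  filter_upwards [self_mem_nhdsWithin] with x hx
  have hxy : 0 < |x - y| := abs_pos.2 (sub_ne_zero.2 hx.2)
  rw [slope_def_field, abs_div, div_le_iff₀ hxy]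
  exact hL x hx.1

/-- A time derivative which is jointly continuous is uniform in space. -/
theorem eventually_forall_abs_sub_le {a b T : ℝ} {w' : ℝ → ℝ → ℝ}
    (hc : ContinuousOn (fun z : ℝ × ℝ => w' z.1 z.2) (Icc 0 T ×ˢ Icc a b)) {t ε : ℝ}
    (ht : t ∈ Icc 0 T) (hε : 0 < ε) :
    ∀ᶠ r in nhdsWithin t (Icc 0 T), ∀ x ∈ uIcc t r, x ∈ Icc 0 T ∧ ∀ y ∈ Icc a b,
      |w' x y - w' t y| ≤ ε := by
  have hu := (isCompact_Icc.prod isCompact_Icc).uniformContinuousOn_of_continuous hc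
  obtain ⟨η, hη, h⟩ := Metric.uniformContinuousOn_iff.1 hu ε hε
  filter_upwards [self_mem_nhdsWithin, mem_nhdsWithin_of_mem_nhds (Metric.ball_mem_nhds t hη)]
    with r hr hrt x hx
  have hxT : x ∈ Icc 0 T := ordConnected_Icc.uIcc_subset ht hr hx
  refine ⟨hxT, fun y hy => ?_⟩
  have hd : dist ((x, y) : ℝ × ℝ) (t, y) < η := by
    rw [Prod.dist_eq, dist_self, max_eq_left dist_nonneg, Real.dist_eq]
    have := abs_sub_left_of_mem_uIcc hx
    rw [Metric.mem_ball, Real.dist_eq] at hrt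
    exact this.trans_lt hrt
  have := (h (x, y) ⟨hxT, hy⟩ (t, y) ⟨ht, hy⟩ hd).le
  rwa [Real.dist_eq] at this

/-- Mean value inequality for `w x - x * κ`, whose increment is the remainder of a first order
expansion of `w`. -/
theorem abs_sub_sub_mul_le {S : Set ℝ} {w w' : ℝ → ℝ} {ε t r : ℝ}
    (h : ∀ x ∈ uIcc t r, HasDerivWithinAt w (w' x) S x) (hS : uIcc t r ⊆ S) {κ : ℝ}
    (hb : ∀ x ∈ uIcc t r, |w' x - κ| ≤ ε) : |w r - w t - (r - t) * κ| ≤ ε * |r - t| := by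
  have := Convex.norm_image_sub_le_of_norm_hasDerivWithin_le (f := fun x => w x - x * κ)
    (f' := fun x => w' x - κ) (s := uIcc t r) (x := t) (y := r) (C := ε)
    (fun x hx => (((h x hx).mono hS).sub ((hasDerivWithinAt_id x _).mul_const κ)).congr_deriv
      (by simp))
    hb (convex_uIcc t r) left_mem_uIcc right_mem_uIcc
  simp only [Real.norm_eq_abs] at this
  rwa [show w r - r * κ - (w t - t * κ) = w r - w t - (r - t) * κ by ring] at this

/-- Lets a derivative be verified by a remainder bound that is only proportional to `ε`, with a
fixed factor such as the mass of a weight. -/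
theorem hasDerivWithinAt_of_forall_eps {S : Set ℝ} {f : ℝ → ℝ} {f' t N : ℝ} (hN : 0 ≤ N)
    (h : ∀ ε > 0, ∀ᶠ r in nhdsWithin t S, |f r - f t - (r - t) * f'| ≤ N * ε * |r - t|) :
    HasDerivWithinAt f f' S t := by
  rw [hasDerivWithinAt_iff_isLittleO, Asymptotics.isLittleO_iff]
  intro c hc
  filter_upwards [h (c / (N + 1)) (by positivity)] with r hr
  rw [Real.norm_eq_abs, Real.norm_eq_abs, smul_eq_mul]
  refine hr.trans (mul_le_mul_of_nonneg_right ?_ (abs_nonneg _))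
  rw [mul_div_assoc', div_le_iff₀ (by positivity)]
  nlinarith

/-- Differentiation under a weighted integral. -/
theorem hasDerivWithinAt_integral_mul {a b T : ℝ} {w w' : ℝ → ℝ → ℝ}
    (hw : ∀ t ∈ Icc 0 T, ∀ y ∈ Icc a b, HasDerivWithinAt (fun r => w r y) (w' t y) (Icc 0 T) t)
    (hc : ContinuousOn (fun z : ℝ × ℝ => w' z.1 z.2) (Icc 0 T ×ˢ Icc a b))
    (hwc : ∀ t ∈ Icc 0 T, ContinuousOn (w t) (Icc a b)) {c d : ℝ} (hcd : c ≤ d)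
    (hs : Icc c d ⊆ Icc a b) {ρ : ℝ → ℝ} (hρ : IntervalIntegrable ρ volume c d) {t : ℝ}
    (ht : t ∈ Icc 0 T) :
    HasDerivWithinAt (fun r => ∫ y in c..d, ρ y * w r y) (∫ y in c..d, ρ y * w' t y)
      (Icc 0 T) t := by
  have hw'c : ContinuousOn (w' t) (Icc a b) := by
    have : ContinuousOn (fun y : ℝ => (t, y)) (Icc a b) := by fun_prop
    exact hc.comp this fun y hy => ⟨ht, hy⟩
  have hi : ∀ {g : ℝ → ℝ}, ContinuousOn g (Icc a b) →
      IntervalIntegrable (fun y => ρ y * g y) volume c d := fun hg =>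
    hρ.mul_continuousOn (by rw [uIcc_of_le hcd]; exact hg.mono hs)
  refine hasDerivWithinAt_of_forall_eps (N := ∫ y in c..d, |ρ y|)
    (intervalIntegral.integral_nonneg hcd fun y _ => abs_nonneg _) fun ε hε => ?_
  filter_upwards [eventually_forall_abs_sub_le hc ht hε, self_mem_nhdsWithin] with r hr hrT
  have e : (∫ y in c..d, ρ y * w r y) - (∫ y in c..d, ρ y * w t y)
      - (r - t) * (∫ y in c..d, ρ y * w' t y)
      = ∫ y in c..d, ρ y * (w r y - w t y - (r - t) * w' t y) := by
    rw [← intervalIntegral.integral_const_mul,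
      ← intervalIntegral.integral_sub (hi (hwc r hrT)) (hi (hwc t ht)),
      ← intervalIntegral.integral_sub ((hi (hwc r hrT)).sub (hi (hwc t ht)))
        ((hi hw'c).const_mul _)]
    congr 1; funext y; ring
  rw [e]
  have := intervalIntegral.norm_integral_le_of_norm_le (μ := volume) hcd
    (f := fun y => ρ y * (w r y - w t y - (r - t) * w' t y))
    (g := fun y => |ρ y| * (ε * |r - t|)) (Filter.Eventually.of_forall fun y hy => by
      have hy' := hs (Ioc_subset_Icc_self hy)
      rw [Real.norm_eq_abs, abs_mul]
      refine mul_le_mul_of_nonneg_left ?_ (abs_nonneg _)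
      exact abs_sub_sub_mul_le (w := fun r => w r y) (w' := fun x => w' x y)
        (fun x hx => hw x (hr x hx).1 y hy') (fun x hx => (hr x hx).1)
        (fun x hx => (hr x hx).2 y hy')) (hρ.abs.mul_const _)
  rw [intervalIntegral.integral_mul_const, Real.norm_eq_abs] at this
  linarith

/-- Time and space derivatives commute. -/
theorem hasDerivWithinAt_swap {a b T : ℝ} (hab : a < b) {w w' wx wx' : ℝ → ℝ → ℝ}
    (hw : ∀ t ∈ Icc 0 T, ∀ y ∈ Icc a b, HasDerivWithinAt (fun r => w r y) (w' t y) (Icc 0 T) t)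
    (hx : ∀ t ∈ Icc 0 T, ∀ y ∈ Icc a b, HasDerivWithinAt (w t) (wx t y) (Icc a b) y)
    (hx' : ∀ t ∈ Icc 0 T, ∀ y ∈ Icc a b, HasDerivWithinAt (w' t) (wx' t y) (Icc a b) y)
    (hc : ContinuousOn (fun z : ℝ × ℝ => wx' z.1 z.2) (Icc 0 T ×ˢ Icc a b)) {t y : ℝ}
    (ht : t ∈ Icc 0 T) (hy : y ∈ Icc a b) :
    HasDerivWithinAt (fun r => wx r y) (wx' t y) (Icc 0 T) t := by
  refine hasDerivWithinAt_of_forall_eps (N := 1) zero_le_one fun ε hε => ?_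
  filter_upwards [eventually_forall_abs_sub_le hc ht hε, self_mem_nhdsWithin] with r hr hrT
  rw [one_mul]
  -- As a function of `y`, the time remainder of `w` is Lipschitz with constant `ε |r - t|`. Its
  -- spatial derivative, which is the time remainder of `wx`, inherits this bound.
  refine abs_le_of_hasDerivWithinAt_Icc_of_lipschitz hab hy
    (f := fun y => w r y - w t y - (r - t) * w' t y)
    (((hx r hrT y hy).sub (hx t ht y hy)).sub ((hx' t ht y hy).const_mul _)) fun z hz => ?_
  -- The mixed difference is estimated by the mean value inequality in space here, and in time
  -- below.
  have h1 : ∀ x ∈ uIcc t r, |w' x z - w' x y - (w' t z - w' t y)| ≤ ε * |z - y| := by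
    intro x hxu
    have hs : uIcc y z ⊆ Icc a b := ordConnected_Icc.uIcc_subset hy hz
    have := abs_sub_sub_mul_le (S := Icc a b) (w := fun y => w' x y - w' t y)
      (w' := fun y => wx' x y - wx' t y) (ε := ε) (t := y) (r := z) (κ := 0)
      (fun q hq => (hx' x (hr x hxu).1 q (hs hq)).sub (hx' t ht q (hs hq))) hs
      (fun q hq => by rw [sub_zero]; exact (hr x hxu).2 q (hs hq))
    rwa [mul_zero, sub_zero, show w' x z - w' t z - (w' x y - w' t y)
      = w' x z - w' x y - (w' t z - w' t y) by ring] at this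
  have := abs_sub_sub_mul_le (S := Icc 0 T) (w := fun r => w r z - w r y)
    (w' := fun x => w' x z - w' x y) (t := t) (r := r) (κ := w' t z - w' t y)
    (fun x hxu => (hw x (hr x hxu).1 z hz).sub (hw x (hr x hxu).1 y hy))
    (fun x hxu => (hr x hxu).1) h1
  rw [show w r z - w t z - (r - t) * w' t z - (w r y - w t y - (r - t) * w' t y)
    = w r z - w r y - (w t z - w t y) - (r - t) * (w' t z - w' t y) by ring]
  linarith

theorem integral_mul_eval_mul_eval {c d : ℝ} {ρ : ℝ → ℝ} (hρ : IntervalIntegrable ρ volume c d)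
    {N : ℕ} {p r : ℝ[X]} (hp : p.natDegree ≤ N) (hr : r.natDegree ≤ N) :
    ∫ y in c..d, ρ y * p.eval y * r.eval y
      = ∑ k ∈ Finset.range (N + 1), ∑ l ∈ Finset.range (N + 1),
        p.coeff k * r.coeff l * ∫ y in c..d, ρ y * (y ^ k * y ^ l) := by
  have h : ∀ y, ρ y * p.eval y * r.eval y = ∑ k ∈ Finset.range (N + 1),
      ∑ l ∈ Finset.range (N + 1), p.coeff k * r.coeff l * (ρ y * (y ^ k * y ^ l)) := by
    intro y
    rw [eval_eq_sum_range' (Nat.lt_succ_of_le hp), eval_eq_sum_range' (Nat.lt_succ_of_le hr),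
      mul_assoc, Finset.sum_mul_sum, Finset.mul_sum]
    refine Finset.sum_congr rfl fun k _ => ?_
    rw [Finset.mul_sum]
    exact Finset.sum_congr rfl fun l _ => by ring
  have hi : ∀ k l : ℕ, IntervalIntegrable (fun y => ρ y * (y ^ k * y ^ l)) volume c d := fun k l =>
    hρ.mul_continuousOn (by fun_prop)
  simp_rw [h]
  have hs : ∀ k, IntervalIntegrable (fun y => ∑ l ∈ Finset.range (N + 1),
      p.coeff k * r.coeff l * (ρ y * (y ^ k * y ^ l))) volume c d := fun k => by
    have := IntervalIntegrable.sum (Finset.range (N + 1)) fun l _ =>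
      (hi k l).const_mul (p.coeff k * r.coeff l)
    exact this.congr fun y _ => by simp
  rw [intervalIntegral.integral_finsetSum fun k _ => hs k]
  refine Finset.sum_congr rfl fun k _ => ?_
  rw [intervalIntegral.integral_finsetSum fun l _ => (hi k l).const_mul _]
  exact Finset.sum_congr rfl fun l _ => intervalIntegral.integral_const_mul _ _

/-- The time derivative of a weighted `L²` norm of a time dependent polynomial. -/
theorem hasDerivWithinAt_integral_sq {S : Set ℝ} {c d : ℝ} {ρ : ℝ → ℝ}
    (hρ : IntervalIntegrable ρ volume c d) {N : ℕ} {p p' : ℝ → ℝ[X]}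
    (hp : ∀ t ∈ S, (p t).natDegree ≤ N) (hp' : ∀ t ∈ S, (p' t).natDegree ≤ N) {t : ℝ} (ht : t ∈ S)
    (h : ∀ k, HasDerivWithinAt (fun r => (p r).coeff k) ((p' t).coeff k) S t) :
    HasDerivWithinAt (fun r => ∫ y in c..d, ρ y * (p r).eval y * (p r).eval y)
      (2 * ∫ y in c..d, ρ y * (p t).eval y * (p' t).eval y) S t := by
  have e : ∀ r ∈ S, ∫ y in c..d, ρ y * (p r).eval y * (p r).eval y
      = ∑ k ∈ Finset.range (N + 1), ∑ l ∈ Finset.range (N + 1),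
        (p r).coeff k * (p r).coeff l * ∫ y in c..d, ρ y * (y ^ k * y ^ l) :=
    fun r hr => integral_mul_eval_mul_eval hρ (hp r hr) (hp r hr)
  refine HasDerivWithinAt.congr ?_ e (e t ht)
  have h1 := HasDerivWithinAt.fun_sum (u := Finset.range (N + 1)) fun k _ =>
    HasDerivWithinAt.fun_sum (u := Finset.range (N + 1)) fun l _ =>
      ((h k).mul (h l)).mul_const (∫ y in c..d, ρ y * (y ^ k * y ^ l))
  refine h1.congr_deriv ?_
  have h2 : ∀ y, ρ y * (p t).eval y * (p' t).eval y = ρ y * (p' t).eval y * (p t).eval y :=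
    fun y => by ring
  rw [two_mul]
  nth_rewrite 1 [show (∫ y in c..d, ρ y * (p t).eval y * (p' t).eval y)
    = ∫ y in c..d, ρ y * (p' t).eval y * (p t).eval y by simp_rw [h2]]
  rw [integral_mul_eval_mul_eval hρ (hp t ht) (hp' t ht),
    integral_mul_eval_mul_eval hρ (hp' t ht) (hp t ht), ← Finset.sum_add_distrib]
  refine Finset.sum_congr rfl fun k _ => ?_
  rw [← Finset.sum_add_distrib]
  exact Finset.sum_congr rfl fun l _ => by ring

/-- Polynomials representing a time dependent functional depend differentiably on time. -/
theorem exists_polynomial_family {S : Set ℝ} {c d m : ℝ} (hcd : c < d) (hm : 0 < m) {ρ : ℝ → ℝ}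
    (hρ : ContinuousOn ρ (Icc c d)) (hρm : ∀ y ∈ Icc c d, m ≤ ρ y) (r : ℕ)
    (ℓ ℓ' : ℝ → ℝ[X] →ₗ[ℝ] ℝ)
    (hℓ : ∀ t ∈ S, ∀ φ, HasDerivWithinAt (fun x => ℓ x φ) (ℓ' t φ) S t) :
    ∃ P P' : ℝ → ℝ[X], (∀ t, (P t).natDegree ≤ r) ∧ (∀ t, (P' t).natDegree ≤ r) ∧
      (∀ t ∈ S, ∀ k, HasDerivWithinAt (fun x => (P x).coeff k) ((P' t).coeff k) S t) ∧
      (∀ t, ∀ φ : ℝ[X], φ.natDegree ≤ r →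
        ∫ y in c..d, ρ y * φ.eval y * (P t).eval y = ℓ t φ) ∧
      ∀ t, ∀ φ : ℝ[X], φ.natDegree ≤ r →
        ∫ y in c..d, ρ y * φ.eval y * (P' t).eval y = ℓ' t φ := by
  -- The dual basis does not depend on time, so the coefficients `ℓ t (ψ k)` can be differentiated
  -- one by one.
  obtain ⟨ψ, -, -, hψ⟩ := exists_dual_basis hcd hm hρ hρm r
  have hdeg : ∀ f : ℕ → ℝ, (∑ k ∈ Finset.range (r + 1), monomial k (f k)).natDegree ≤ r := by
    intro f
    refine natDegree_sum_le_of_forall_le _ _ fun k hk => (natDegree_monomial_le _).trans ?_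
    have := Finset.mem_range.1 hk
    omega
  refine ⟨fun t => ∑ k ∈ Finset.range (r + 1), monomial k (ℓ t (ψ k)),
    fun t => ∑ k ∈ Finset.range (r + 1), monomial k (ℓ' t (ψ k)),
    fun t => hdeg _, fun t => hdeg _, fun t ht k => ?_, fun t => hψ (ℓ t), fun t => hψ (ℓ' t)⟩
  simp only [finsetSum_coeff, coeff_monomial]
  refine HasDerivWithinAt.fun_sum fun i _ => ?_
  split_ifs
  · exact hℓ t ht (ψ i)
  · exact hasDerivWithinAt_const _ _ _

/-! ### Spatial derivatives and integration by parts -/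

section Spatial

variable {a b : ℝ}

theorem dx_zero (w : ℝ → ℝ) : dx a b 0 w = w := by
  funext y; simp [dx]

theorem dx_succ (k : ℕ) (w : ℝ → ℝ) (y : ℝ) :
    dx a b (k + 1) w y = derivWithin (dx a b k w) (Icc a b) y := by
  simp only [dx, iteratedDerivWithin_succ]
  rfl

theorem dx_one (w : ℝ → ℝ) (y : ℝ) : dx a b 1 w y = derivWithin w (Icc a b) y := by
  rw [dx_succ, dx_zero]

theorem derivChain_dx (hab : a < b) {k : ℕ} {w : ℝ → ℝ}
    (hw : ContDiffOn ℝ (k + 1 : ℕ) w (Icc a b)) : DerivChain a b k (fun i => dx a b i w) := by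
  refine ⟨fun i hi y hy => ?_, ?_⟩
  · have h : DifferentiableOn ℝ (dx a b i w) (Icc a b) :=
      hw.differentiableOn_iteratedDerivWithin (by exact_mod_cast Nat.lt_succ_of_le hi)
        (uniqueDiffOn_Icc hab)
    have := (h y hy).hasDerivWithinAt
    rwa [← dx_succ] at this
  · exact hw.continuousOn_iteratedDerivWithin le_rfl (uniqueDiffOn_Icc hab)

theorem HasDerivWithinAt.dx_one_eq (hab : a < b) {w : ℝ → ℝ} {w' y : ℝ} (hy : y ∈ Icc a b)
    (h : HasDerivWithinAt w w' (Icc a b) y) : dx a b 1 w y = w' := by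
  rw [dx_one]
  exact h.derivWithin (uniqueDiffOn_Icc hab y hy)

theorem dx_two_eq (hab : a < b) {w w₁ : ℝ → ℝ} {w₂ y : ℝ} (hy : y ∈ Icc a b)
    (h : ∀ x ∈ Icc a b, HasDerivWithinAt w (w₁ x) (Icc a b) x)
    (h' : HasDerivWithinAt w₁ w₂ (Icc a b) y) : dx a b 2 w y = w₂ := by
  rw [dx_succ]
  refine (HasDerivWithinAt.congr h' (fun x hx => ?_) ?_).derivWithin (uniqueDiffOn_Icc hab y hy)
  · exact HasDerivWithinAt.dx_one_eq hab hx (h x hx)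
  · exact HasDerivWithinAt.dx_one_eq hab hy (h y hy)

end Spatial

/-! ### Regularity of the coefficients and Green's formula -/

section Coefficients

variable {a b m K : ℝ} {μ D : ℝ → ℝ}

theorem CoeffBounds.hasDeriv (h : CoeffBounds a b m K μ D) {y : ℝ} (hy : y ∈ Icc a b) :
    HasDerivWithinAt D (dx a b 1 D y) (Icc a b) y := by
  rw [dx_one]; exact (h.D_diff y hy).hasDerivWithinAt

theorem CoeffBounds.hasDeriv₂ (h : CoeffBounds a b m K μ D) {y : ℝ} (hy : y ∈ Icc a b) :
    HasDerivWithinAt (dx a b 1 D) (dx a b 2 D y) (Icc a b) y := by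
  have e : dx a b 1 D = derivWithin D (Icc a b) := funext fun y => dx_one D y
  rw [dx_succ, e]; exact (h.Dx_diff y hy).hasDerivWithinAt

theorem CoeffBounds.continuousOn (h : CoeffBounds a b m K μ D) : ContinuousOn D (Icc a b) :=
  h.D_diff.continuousOn

theorem CoeffBounds.continuousOn₁ (h : CoeffBounds a b m K μ D) :
    ContinuousOn (dx a b 1 D) (Icc a b) := fun _ hy => (h.hasDeriv₂ hy).continuousWithinAt

theorem intervalIntegrable_of_aemeasurable_of_bound {c d B : ℝ} (hcd : c ≤ d)
    (hs : Icc c d ⊆ Icc a b) {f : ℝ → ℝ} (hm : AEMeasurable f (volume.restrict (Icc a b)))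
    (hB : ∀ y ∈ Icc a b, |f y| ≤ B) : IntervalIntegrable f volume c d := by
  rw [intervalIntegrable_iff_integrableOn_Icc_of_le hcd]
  refine IntegrableOn.mono_set ?_ hs
  refine Integrable.mono' (g := fun _ => B) (by simp) hm.aestronglyMeasurable ?_
  filter_upwards [ae_restrict_mem measurableSet_Icc] with y hy
  exact hB y hy

/-- `D_xx` is bounded but need not be continuous. It is measurable because on the open interval it
is a derivative, and the end points form a null set. -/
theorem CoeffBounds.intervalIntegrable₂ (h : CoeffBounds a b m K μ D) {c d : ℝ} (hcd : c ≤ d)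
    (hs : Icc c d ⊆ Icc a b) : IntervalIntegrable (dx a b 2 D) volume c d := by
  refine intervalIntegrable_of_aemeasurable_of_bound hcd hs ?_ h.Dxx_bound
  rw [← restrict_Ioo_eq_restrict_Icc]
  refine ⟨deriv (dx a b 1 D), measurable_deriv _, ?_⟩
  filter_upwards [ae_restrict_mem measurableSet_Ioo] with y hy
  exact ((h.hasDeriv₂ (Ioo_subset_Icc_self hy)).hasDerivAt (Icc_mem_nhds hy.1 hy.2)).deriv.symm

theorem CoeffBounds.intervalIntegrable_μ (h : CoeffBounds a b m K μ D) (hm : 0 < m) {c d : ℝ}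
    (hcd : c ≤ d) (hs : Icc c d ⊆ Icc a b) : IntervalIntegrable μ volume c d := by
  refine intervalIntegrable_of_aemeasurable_of_bound (B := K) hcd hs h.μ_meas fun y hy => ?_
  have := h.μ_bounds y hy
  rw [abs_of_nonneg (hm.le.trans this.1)]
  exact this.2

theorem moment_eq (D : ℝ → ℝ) (p : ℝ[X]) (y : ℝ) :
    moment D p y = D y * (derivative (derivative p)).eval y := rfl

theorem CoeffBounds.shear_eq (h : CoeffBounds a b m K μ D) (hab : a < b) (p : ℝ[X]) {y : ℝ}
    (hy : y ∈ Icc a b) : shear a b D p y = dx a b 1 D y * (derivative (derivative p)).eval y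
      + D y * (derivative (derivative (derivative p))).eval y := by
  rw [shear]
  exact ((h.hasDeriv hy).mul ((derivative (derivative p)).hasDerivAt y).hasDerivWithinAt).derivWithin
    (uniqueDiffOn_Icc hab y hy)

/-- The first derivative of `D z`. -/
theorem CoeffBounds.hasDeriv_mul (h : CoeffBounds a b m K μ D) {c d : ℝ}
    (hs : Icc c d ⊆ Icc a b) {z : ℕ → ℝ → ℝ} (hz : DerivChain c d 1 z) {y : ℝ} (hy : y ∈ Icc c d) :
    HasDerivWithinAt (fun x => D x * z 0 x) (dx a b 1 D y * z 0 y + D y * z 1 y) (Icc c d) y :=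
  ((h.hasDeriv (hs hy)).mono hs).mul (hz.deriv 0 zero_le_one y hy)

/-- The second derivative of `D z`. -/
theorem CoeffBounds.hasDeriv_mul₂ (h : CoeffBounds a b m K μ D) {c d : ℝ}
    (hs : Icc c d ⊆ Icc a b) {z : ℕ → ℝ → ℝ} (hz : DerivChain c d 1 z) {y : ℝ} (hy : y ∈ Icc c d) :
    HasDerivWithinAt (fun x => dx a b 1 D x * z 0 x + D x * z 1 x)
      (dx a b 2 D y * z 0 y + 2 * dx a b 1 D y * z 1 y + D y * z 2 y) (Icc c d) y := by
  have h1 := ((h.hasDeriv₂ (hs hy)).mono hs).mul (hz.deriv 0 zero_le_one y hy)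
  have h2 := ((h.hasDeriv (hs hy)).mono hs).mul (hz.deriv 1 le_rfl y hy)
  exact (h1.add h2).congr_deriv (by ring)

theorem CoeffBounds.intervalIntegrable_mul₂ (h : CoeffBounds a b m K μ D) {c d : ℝ} (hcd : c ≤ d)
    (hs : Icc c d ⊆ Icc a b) {z : ℕ → ℝ → ℝ} (hz : DerivChain c d 1 z) :
    IntervalIntegrable
      (fun y => dx a b 2 D y * z 0 y + 2 * dx a b 1 D y * z 1 y + D y * z 2 y) volume c d := by
  have h0 : ContinuousOn (z 0) (uIcc c d) := by
    rw [uIcc_of_le hcd]; exact hz.continuousOn (by omega)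
  refine (((h.intervalIntegrable₂ hcd hs).mul_continuousOn h0).add ?_).add ?_
  · exact intervalIntegrable_of_Icc hcd
      ((continuousOn_const.mul (h.continuousOn₁.mono hs)).mul (hz.continuousOn (by omega)))
  · exact intervalIntegrable_of_Icc hcd
      ((h.continuousOn.mono hs).mul (hz.continuousOn (by omega)))

/-- Green's formula for the beam operator on an element. -/
theorem CoeffBounds.green (h : CoeffBounds a b m K μ D) {c d : ℝ} (hcd : c ≤ d)
    (hs : Icc c d ⊆ Icc a b) {z w : ℕ → ℝ → ℝ} (hz : DerivChain c d 1 z)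
    (hw : DerivChain c d 1 w) :
    ∫ y in c..d, (dx a b 2 D y * z 0 y + 2 * dx a b 1 D y * z 1 y + D y * z 2 y) * w 0 y
      = ((dx a b 1 D d * z 0 d + D d * z 1 d) * w 0 d - D d * z 0 d * w 1 d)
        - ((dx a b 1 D c * z 0 c + D c * z 1 c) * w 0 c - D c * z 0 c * w 1 c)
        + ∫ y in c..d, D y * z 0 y * w 2 y := by
  have hw0 : ContinuousOn (w 0) (uIcc c d) := by
    rw [uIcc_of_le hcd]; exact hw.continuousOn (by omega)
  have i1 := (h.intervalIntegrable_mul₂ hcd hs hz).mul_continuousOn hw0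
  have i2 : IntervalIntegrable (fun y => D y * z 0 y * w 2 y) volume c d :=
    intervalIntegrable_of_Icc hcd (((h.continuousOn.mono hs).mul
      (hz.continuousOn (by omega))).mul hw.cont)
  have key := integral_eq_sub_of_hasDerivWithinAt_Icc hcd
    (f := fun y => (dx a b 1 D y * z 0 y + D y * z 1 y) * w 0 y - D y * z 0 y * w 1 y)
    (f' := fun y => (dx a b 2 D y * z 0 y + 2 * dx a b 1 D y * z 1 y + D y * z 2 y) * w 0 y
      - D y * z 0 y * w 2 y)
    (fun y hy => (((h.hasDeriv_mul₂ hs hz hy).mul (hw.deriv 0 zero_le_one y hy)).sub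
      ((h.hasDeriv_mul hs hz hy).mul (hw.deriv 1 le_rfl y hy))).congr_deriv (by ring)) (i1.sub i2)
  rw [intervalIntegral.integral_sub i1 i2] at key
  linarith

theorem derivChain_eval (c d : ℝ) (k : ℕ) (p : ℝ[X]) :
    DerivChain c d k (fun i y => (derivative^[i] p).eval y) := by
  refine ⟨fun i _ y _ => ?_, (derivative^[k + 1] p).continuous.continuousOn⟩
  rw [Function.iterate_succ_apply']
  exact ((derivative^[i] p).hasDerivAt y).hasDerivWithinAt

theorem DerivChain.sub {c d : ℝ} {k : ℕ} {g g' : ℕ → ℝ → ℝ} (h : DerivChain c d k g)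
    (h' : DerivChain c d k g') : DerivChain c d k (fun i y => g i y - g' i y) :=
  ⟨fun i hi y hy => (h.deriv i hi y hy).sub (h'.deriv i hi y hy), h.cont.sub h'.cont⟩

end Coefficients

/-! ### The numerical fluxes at a single node -/

theorem mul_le_young {ε : ℝ} (hε : 0 < ε) (x y : ℝ) : x * y ≤ ε * x ^ 2 + y ^ 2 / (4 * ε) := by
  have h : ε * x ^ 2 + y ^ 2 / (4 * ε) - x * y = ε * (x - y / (2 * ε)) ^ 2 := by
    field_simp; ring
  have : 0 ≤ ε * (x - y / (2 * ε)) ^ 2 := by positivity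
  linarith

/-- The constant in the estimate of a flux with parameter `β`. -/
noncomputable def fluxConst (L Λ β : ℝ) : ℝ := β * L + 1 + Λ / β + β

theorem fluxConst_pos {L Λ β : ℝ} (hL : 0 ≤ L) (hΛ : 0 ≤ Λ) (hβ : 0 ≤ β) :
    0 < fluxConst L Λ β := by
  unfold fluxConst; positivity

/-- `X` is a trace or jump of the difference, `H` its weight in the trace norm, and `d`, `g` are
projection errors. If only `0 ≤ β`, the product `X d` is paid by `lam H X²`, leaving `d² / (lam H)`,
of size `w / lam`. If `0 < β`, half of `β X²` absorbs each product and leaves `d² / β` and `β g²`,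
both of size `h w`. The factor `Θ` records which case applies. -/
theorem flux_young {β X d g lam H h L Λ Θ w : ℝ} (hβ : 0 ≤ β) (hlam : 0 < lam) (hH : 0 < H)
    (hh : 0 < h) (hL : h ≤ L) (hΛ : H ≤ Λ * h) (hw : 0 ≤ w) (hd : d ^ 2 ≤ H * w)
    (hg : g ^ 2 ≤ h * w) (hΘ : Θ = 1 ∨ (0 < β ∧ Θ = h)) :
    -β * X ^ 2 + X * d + β * X * g
      ≤ lam * (H * X ^ 2) + fluxConst L Λ β * (1 + 1 / lam) * (Θ * w) := by
  have hL0 : 0 < L := hh.trans_le hL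
  have hΛ0 : 0 < Λ := by
    by_contra! hcon
    have := mul_nonpos_of_nonpos_of_nonneg hcon hh.le
    linarith
  have hlam' : 0 < 1 / lam := by positivity
  rcases hΘ with rfl | ⟨hβ', rfl⟩
  · have h1 : X * d ≤ lam * (H * X ^ 2) + w * (1 / lam) := by
      have e := mul_le_young (mul_pos hlam hH) X d
      have e2 : d ^ 2 / (4 * (lam * H)) ≤ w * (1 / lam) := by
        rw [div_le_iff₀ (by positivity)]
        have : w * (1 / lam) * (4 * (lam * H)) = 4 * (H * w) := by field_simp
        rw [this]
        have := mul_nonneg hH.le hw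
        linarith
      linarith
    have h2 : β * X * g ≤ β * X ^ 2 + β * L * w := by
      have e1 : X * g ≤ X ^ 2 + g ^ 2 := by nlinarith [sq_nonneg (X - g)]
      have e2 : g ^ 2 ≤ L * w := hg.trans (mul_le_mul_of_nonneg_right hL hw)
      calc β * X * g = β * (X * g) := by ring
        _ ≤ β * (X ^ 2 + L * w) := mul_le_mul_of_nonneg_left (by linarith) hβ
        _ = _ := by ring
    have h3 : β * L * w + w * (1 / lam) ≤ fluxConst L Λ β * (1 + 1 / lam) * (1 * w) := by
      have e : fluxConst L Λ β * (1 + 1 / lam) * (1 * w) - (β * L * w + w * (1 / lam))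
        = w + (β * L) * (1 / lam) * w + (Λ / β + β) * (1 + 1 / lam) * w := by
        unfold fluxConst; ring
      have : 0 ≤ w + (β * L) * (1 / lam) * w + (Λ / β + β) * (1 + 1 / lam) * w := by positivity
      linarith
    linarith
  · have h1 : X * d ≤ β / 2 * X ^ 2 + Λ / β * (Θ * w) := by
      have e := mul_le_young (half_pos hβ') X d
      have e2 : d ^ 2 / (4 * (β / 2)) ≤ Λ / β * (Θ * w) := by
        rw [div_le_iff₀ (by positivity)]
        have : Λ / β * (Θ * w) * (4 * (β / 2)) = 2 * (Λ * Θ * w) := by field_simp; ring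
        rw [this]
        have h3 := mul_le_mul_of_nonneg_right hΛ hw
        have : 0 ≤ Λ * Θ * w := by positivity
        linarith
      linarith
    have h2 : β * X * g ≤ β / 2 * X ^ 2 + β * (Θ * w) := by
      have e1 : X * g ≤ X ^ 2 / 2 + g ^ 2 := by nlinarith [sq_nonneg (X - 2 * g), sq_nonneg (X - g)]
      calc β * X * g = β * (X * g) := by ring
        _ ≤ β * (X ^ 2 / 2 + Θ * w) := mul_le_mul_of_nonneg_left (by linarith) hβ
        _ = _ := by ring
    have h3 : Λ / β * (Θ * w) + β * (Θ * w) ≤ fluxConst L Λ β * (1 + 1 / lam) * (Θ * w) := by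
      have e : fluxConst L Λ β * (1 + 1 / lam) * (Θ * w) - (Λ / β * (Θ * w) + β * (Θ * w))
        = (β * L + 1) * (Θ * w) + fluxConst L Λ β * (1 / lam) * (Θ * w) := by
        unfold fluxConst; ring
      have : 0 ≤ (β * L + 1) * (Θ * w) + fluxConst L Λ β * (1 / lam) * (Θ * w) := by
        have := fluxConst_pos hL0.le hΛ0.le hβ
        positivity
      linarith
    have h4 : 0 ≤ lam * (H * X ^ 2) := by positivity
    linarith

/-- The contribution of one side of a node to the energy balance: `S, M, V, W` are the traces of
shear, moment, velocity and slope velocity, `Vs, Ss, Ws, Ms` the corresponding fluxes, and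
`dV, dS, dW, dM` the consistency errors of the fluxes. -/
noncomputable def bracket (S M V W Vs Ss Ws Ms dV dS dW dM : ℝ) : ℝ :=
  S * V - M * W - S * Vs + M * Ws - V * Ss + W * Ms + S * dV - M * dW + V * dS - W * dM

/-- Bounds of the errors of the traces of shear, moment, velocity and slope velocity. -/
structure TraceErr (h w s k v x : ℝ) : Prop where
  s_le : s ^ 2 ≤ h * w
  x_le : x ^ 2 ≤ h * w
  k_le : k ^ 2 ≤ h ^ 3 * w
  v_le : v ^ 2 ≤ h ^ 3 * w
  -- On a bounded interval the weaker bounds follow from the cubic ones up to a constant; keeping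
  -- them as fields lets one `w` serve all estimates.
  k_le' : k ^ 2 ≤ h * w
  v_le' : v ^ 2 ≤ h * w

theorem sq_convex_le {α x y B : ℝ} (h0 : 0 ≤ α) (h1 : α ≤ 1) (hB : 0 ≤ B) (hx : x ^ 2 ≤ B)
    (hy : y ^ 2 ≤ B) : (α * x + (1 - α) * y) ^ 2 ≤ 4 * B := by
  have e : (α * x + (1 - α) * y) ^ 2
      = α * x ^ 2 + (1 - α) * y ^ 2 - α * (1 - α) * (x - y) ^ 2 := by ring
  have h2 : 0 ≤ α * (1 - α) * (x - y) ^ 2 := by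
    have := sub_nonneg.2 h1
    positivity
  have h3 := mul_le_mul_of_nonneg_left hx h0
  have h4 := mul_le_mul_of_nonneg_left hy (sub_nonneg.2 h1)
  nlinarith

theorem sq_sub_le {x y B : ℝ} (hx : x ^ 2 ≤ B) (hy : y ^ 2 ≤ B) : (x - y) ^ 2 ≤ 4 * B := by
  nlinarith [sq_nonneg (x + y)]

/-- The fluxes of conjugate quantities (velocity and shear, slope velocity and moment) use
complementary weights, so the averages cancel in the difference of the two brackets. What remains
splits over the four jumps, each in the form treated by `flux_young`. The factor `4` comes from
combining the errors on the two sides of the node, the factor `2` from bounding a squared jump by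
squared traces. -/
theorem interior_node {α₁ α₂ β₁ β₂ τ₁ τ₂ h L Θ lam w : ℝ} (hα₁ : α₁ ∈ Icc (0 : ℝ) 1)
    (hα₂ : α₂ ∈ Icc (0 : ℝ) 1) (hβ₁ : 0 ≤ β₁) (hβ₂ : 0 ≤ β₂) (hτ₁ : 0 ≤ τ₁) (hτ₂ : 0 ≤ τ₂)
    (hh : 0 < h) (hL : h ≤ L) (hlam : 0 < lam) (hw : 0 ≤ w)
    (hΘ : Θ = 1 ∨ ((0 < β₁ ∧ 0 < β₂ ∧ 0 < τ₁ ∧ 0 < τ₂) ∧ Θ = h))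
    {Sm Sp Mm Mp Vm Vp Wm Wp sm sp km kp vm vp xm xp : ℝ}
    (hm : TraceErr h w sm km vm xm) (hp : TraceErr h w sp kp vp xp)
    {Vs Ss Ws Ms dV dS dW dM : ℝ}
    (hVs : Vs = α₁ * Vm + (1 - α₁) * Vp + β₁ * (Sm - Sp))
    (hSs : Ss = (1 - α₁) * Sm + α₁ * Sp + τ₁ * (Vm - Vp))
    (hWs : Ws = α₂ * Wm + (1 - α₂) * Wp - β₂ * (Mm - Mp))
    (hMs : Ms = (1 - α₂) * Mm + α₂ * Mp - τ₂ * (Wm - Wp))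
    (hdV : dV = α₁ * vm + (1 - α₁) * vp + β₁ * (sm - sp))
    (hdS : dS = (1 - α₁) * sm + α₁ * sp + τ₁ * (vm - vp))
    (hdW : dW = α₂ * xm + (1 - α₂) * xp - β₂ * (km - kp))
    (hdM : dM = (1 - α₂) * km + α₂ * kp - τ₂ * (xm - xp)) :
    bracket Sm Mm Vm Wm Vs Ss Ws Ms dV dS dW dM - bracket Sp Mp Vp Wp Vs Ss Ws Ms dV dS dW dM
      ≤ 2 * lam * ((h ^ 3 * Sm ^ 2 + h * Mm ^ 2 + h * Vm ^ 2 + h ^ 3 * Wm ^ 2)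
          + (h ^ 3 * Sp ^ 2 + h * Mp ^ 2 + h * Vp ^ 2 + h ^ 3 * Wp ^ 2))
        + 4 * (fluxConst L (1 + L ^ 2) β₁ + fluxConst L (1 + L ^ 2) β₂ + fluxConst L (1 + L ^ 2) τ₁
          + fluxConst L (1 + L ^ 2) τ₂) * (1 + 1 / lam) * (Θ * w) := by
  have hH : h ≤ (1 + L ^ 2) * h := by nlinarith [sq_nonneg L]
  have hH3 : h ^ 3 ≤ (1 + L ^ 2) * h := by
    have : h ^ 2 ≤ L ^ 2 := pow_le_pow_left₀ hh.le hL 2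
    nlinarith
  have hw4 : 0 ≤ 4 * w := by linarith
  have hhw : 0 ≤ h * w := by positivity
  have hhw3 : 0 ≤ h ^ 3 * w := by positivity
  have hα₁' : 1 - α₁ ∈ Icc (0 : ℝ) 1 := ⟨by linarith [hα₁.2], by linarith [hα₁.1]⟩
  have hα₂' : 1 - α₂ ∈ Icc (0 : ℝ) 1 := ⟨by linarith [hα₂.2], by linarith [hα₂.1]⟩
  have y1 := flux_young (X := Sm - Sp) (d := α₁ * vm + (1 - α₁) * vp) (g := sm - sp) hβ₁ hlam
    (pow_pos hh 3) hh hL hH3 hw4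
    (by linarith [sq_convex_le hα₁.1 hα₁.2 hhw3 hm.v_le hp.v_le])
    (by linarith [sq_sub_le hm.s_le hp.s_le]) (hΘ.imp id fun H => ⟨H.1.1, H.2⟩)
  have y2 := flux_young (X := Mm - Mp) (d := -(α₂ * xm + (1 - α₂) * xp)) (g := km - kp) hβ₂ hlam
    hh hh hL hH hw4
    (by rw [neg_sq]; linarith [sq_convex_le hα₂.1 hα₂.2 hhw hm.x_le hp.x_le])
    (by linarith [sq_sub_le hm.k_le' hp.k_le']) (hΘ.imp id fun H => ⟨H.1.2.1, H.2⟩)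
  have y3 := flux_young (X := Vm - Vp) (d := (1 - α₁) * sm + (1 - (1 - α₁)) * sp) (g := vm - vp)
    hτ₁ hlam hh hh hL hH hw4
    (by linarith [sq_convex_le hα₁'.1 hα₁'.2 hhw hm.s_le hp.s_le])
    (by linarith [sq_sub_le hm.v_le' hp.v_le']) (hΘ.imp id fun H => ⟨H.1.2.2.1, H.2⟩)
  have y4 := flux_young (X := Wm - Wp) (d := -((1 - α₂) * km + (1 - (1 - α₂)) * kp))
    (g := xm - xp) hτ₂ hlam (pow_pos hh 3) hh hL hH3 hw4
    (by rw [neg_sq]; linarith [sq_convex_le hα₂'.1 hα₂'.2 hhw3 hm.k_le hp.k_le])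
    (by linarith [sq_sub_le hm.x_le hp.x_le]) (hΘ.imp id fun H => ⟨H.1.2.2.2, H.2⟩)
  have z : ∀ {H : ℝ}, 0 ≤ H → ∀ x y : ℝ, lam * (H * (x - y) ^ 2)
      ≤ 2 * lam * (H * x ^ 2 + H * y ^ 2) := fun hH x y => by
    have := mul_le_mul_of_nonneg_left (mul_sub_sq_le hH x y) hlam.le
    linarith
  have z1 := z (pow_pos hh 3).le Sm Sp
  have z2 := z hh.le Mm Mp
  have z3 := z hh.le Vm Vp
  have z4 := z (pow_pos hh 3).le Wm Wp
  have key : bracket Sm Mm Vm Wm Vs Ss Ws Ms dV dS dW dM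
      - bracket Sp Mp Vp Wp Vs Ss Ws Ms dV dS dW dM
      = (-β₁ * (Sm - Sp) ^ 2 + (Sm - Sp) * (α₁ * vm + (1 - α₁) * vp) + β₁ * (Sm - Sp) * (sm - sp))
        + (-β₂ * (Mm - Mp) ^ 2 + (Mm - Mp) * -(α₂ * xm + (1 - α₂) * xp)
          + β₂ * (Mm - Mp) * (km - kp))
        + (-τ₁ * (Vm - Vp) ^ 2 + (Vm - Vp) * ((1 - α₁) * sm + (1 - (1 - α₁)) * sp)
          + τ₁ * (Vm - Vp) * (vm - vp))
        + (-τ₂ * (Wm - Wp) ^ 2 + (Wm - Wp) * -((1 - α₂) * km + (1 - (1 - α₂)) * kp)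
          + τ₂ * (Wm - Wp) * (xm - xp)) := by
    subst hVs hSs hWs hMs hdV hdS hdW hdM
    unfold bracket
    ring
  rw [key]
  linarith

/-- For each boundary condition only the two traces which it prescribes survive in the bracket (for
instance `V` and `M` when simply supported). The sign condition is precisely what turns their
squares into `-|η| X²`. The statement is for the left end; the right end is obtained from it by
reflection. -/
theorem boundary_node {bc : BoundaryType} {η₁ η₂ h L Θ lam w : ℝ} (hη : EtaSign bc η₁ η₂)
    (hh : 0 < h) (hL : h ≤ L) (hlam : 0 < lam) (hw : 0 ≤ w)
    (hΘ : Θ = 1 ∨ ((η₁ ≠ 0 ∧ η₂ ≠ 0) ∧ Θ = h))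
    {S M V W s k v x : ℝ} (he : TraceErr h w s k v x)
    {Vs Ss Ws Ms dV dS dW dM : ℝ}
    (hVs : Vs = V - (bc.a₂ - η₂ * bc.b₂) * (bc.a₂ * V + bc.b₂ * S))
    (hSs : Ss = S - (bc.b₂ + η₂ * bc.a₂) * (bc.a₂ * V + bc.b₂ * S))
    (hWs : Ws = W + (bc.a₁ - η₁ * bc.b₁) * (-bc.a₁ * W + bc.b₁ * M))
    (hMs : Ms = M - (bc.b₁ + η₁ * bc.a₁) * (-bc.a₁ * W + bc.b₁ * M))
    (hdV : dV = v - (bc.a₂ - η₂ * bc.b₂) * (bc.a₂ * v + bc.b₂ * s))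
    (hdS : dS = s - (bc.b₂ + η₂ * bc.a₂) * (bc.a₂ * v + bc.b₂ * s))
    (hdW : dW = x + (bc.a₁ - η₁ * bc.b₁) * (-bc.a₁ * x + bc.b₁ * k))
    (hdM : dM = k - (bc.b₁ + η₁ * bc.a₁) * (-bc.a₁ * x + bc.b₁ * k)) :
    -bracket S M V W Vs Ss Ws Ms dV dS dW dM
      ≤ 2 * lam * (h ^ 3 * S ^ 2 + h * M ^ 2 + h * V ^ 2 + h ^ 3 * W ^ 2)
        + (fluxConst L (1 + L ^ 2) |η₁| + fluxConst L (1 + L ^ 2) |η₂|)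
          * (1 + 1 / lam) * (Θ * w) := by
  have hH : h ≤ (1 + L ^ 2) * h := by nlinarith [sq_nonneg L]
  have hH3 : h ^ 3 ≤ (1 + L ^ 2) * h := by
    have : h ^ 2 ≤ L ^ 2 := pow_le_pow_left₀ hh.le hL 2
    nlinarith
  have hΘ₁ : Θ = 1 ∨ (0 < |η₁| ∧ Θ = h) := hΘ.imp id fun H => ⟨abs_pos.2 H.1.1, H.2⟩
  have hΘ₂ : Θ = 1 ∨ (0 < |η₂| ∧ Θ = h) := hΘ.imp id fun H => ⟨abs_pos.2 H.1.2, H.2⟩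
  have yV := flux_young (X := V) (d := -s) (g := v) (abs_nonneg η₂) hlam hh hh hL hH hw
    (by rw [neg_sq]; exact he.s_le) he.v_le' hΘ₂
  have yS := flux_young (X := S) (d := -v) (g := s) (abs_nonneg η₂) hlam (pow_pos hh 3) hh hL hH3 hw
    (by rw [neg_sq]; exact he.v_le) he.s_le hΘ₂
  have yW := flux_young (X := W) (d := k) (g := x) (abs_nonneg η₁) hlam (pow_pos hh 3) hh hL hH3 hw
    he.k_le he.x_le hΘ₁
  have yM := flux_young (X := M) (d := x) (g := k) (abs_nonneg η₁) hlam hh hh hL hH hw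
    he.x_le he.k_le' hΘ₁
  have p1 : 0 ≤ lam * (h ^ 3 * S ^ 2) := by positivity
  have p2 : 0 ≤ lam * (h * M ^ 2) := by positivity
  have p3 : 0 ≤ lam * (h * V ^ 2) := by positivity
  have p4 : 0 ≤ lam * (h ^ 3 * W ^ 2) := by positivity
  subst hVs hSs hWs hMs hdV hdS hdW hdM
  cases bc <;> simp only [EtaSign] at hη <;>
    simp only [bracket, BoundaryType.a₁, BoundaryType.a₂, BoundaryType.b₁, BoundaryType.b₂]
  · rw [abs_of_nonpos hη.1] at yM ⊢
    rw [abs_of_nonneg hη.2] at yV ⊢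
    linarith
  · rw [abs_of_nonpos hη.1] at yM ⊢
    rw [abs_of_nonpos hη.2] at yS ⊢
    linarith
  · rw [abs_of_nonneg hη.1] at yW ⊢
    rw [abs_of_nonneg hη.2] at yV ⊢
    linarith
  · rw [abs_of_nonneg hη.1] at yW ⊢
    rw [abs_of_nonpos hη.2] at yS ⊢
    linarith

/-! ### The energy balance on an element -/

section Element

variable {a b m K : ℝ} {μ D : ℝ → ℝ} {c d : ℝ}

/-- The second derivative of `D p` for a polynomial `p`. -/
noncomputable def momentDeriv₂ (a b : ℝ) (D : ℝ → ℝ) (p : ℝ[X]) (y : ℝ) : ℝ :=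
  dx a b 2 D y * p.eval y + 2 * dx a b 1 D y * (derivative p).eval y
    + D y * (derivative (derivative p)).eval y

theorem CoeffBounds.green_moment (h : CoeffBounds a b m K μ D) (hab : a < b) (hcd : c ≤ d)
    (hs : Icc c d ⊆ Icc a b) (φ : ℝ[X]) {w : ℕ → ℝ → ℝ} (hw : DerivChain c d 1 w) :
    ∫ y in c..d, momentDeriv₂ a b D (derivative (derivative φ)) y * w 0 y
      = (shear a b D φ d * w 0 d - moment D φ d * w 1 d)
        - (shear a b D φ c * w 0 c - moment D φ c * w 1 c)
        + ∫ y in c..d, moment D φ y * w 2 y := by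
  have := h.green hcd hs (derivChain_eval c d 1 (derivative (derivative φ))) hw
  rw [h.shear_eq hab φ (hs (right_mem_Icc.2 hcd)), h.shear_eq hab φ (hs (left_mem_Icc.2 hcd))]
  exact this

theorem CoeffBounds.intervalIntegrable_momentDeriv₂ (h : CoeffBounds a b m K μ D) (hcd : c ≤ d)
    (hs : Icc c d ⊆ Icc a b) (p : ℝ[X]) {w : ℝ → ℝ} (hw : ContinuousOn w (Icc c d)) :
    IntervalIntegrable (fun y => momentDeriv₂ a b D p y * w y) volume c d := by
  have := h.intervalIntegrable_mul₂ hcd hs (derivChain_eval c d 1 p)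
  exact IntervalIntegrable.mul_continuousOn this (by rwa [uIcc_of_le hcd])

theorem CoeffBounds.intervalIntegrable_moment (h : CoeffBounds a b m K μ D) (hcd : c ≤ d)
    (hs : Icc c d ⊆ Icc a b) (φ : ℝ[X]) {w : ℝ → ℝ} (hw : ContinuousOn w (Icc c d)) :
    IntervalIntegrable (fun y => moment D φ y * w y) volume c d :=
  intervalIntegrable_of_Icc hcd (((h.continuousOn.mono hs).mul
    (derivative (derivative φ)).continuous.continuousOn).mul hw)

/-- The error equation obtained from the first equation of the scheme. -/
theorem CoeffBounds.displacement_error (h : CoeffBounds a b m K μ D) (hab : a < b) (hcd : c ≤ d)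
    (hs : Icc c d ⊆ Icc a b) {v : ℕ → ℝ → ℝ} (hv : DerivChain c d 1 v) (φ U' ut vh : ℝ[X])
    {σc σd Vc Vd Wc Wd : ℝ}
    (hU : ∫ y in c..d, moment D φ y * (U'.eval y - v 2 y)
      = -(moment D φ d * (v 1 d - σd) - moment D φ c * (v 1 c - σc)))
    (heq : ∫ y in c..d, moment D φ y * (derivative (derivative (ut - vh))).eval y
      = (shear a b D φ d * (vh.eval d - Vd) + moment D φ d * (Wd - (derivative vh).eval d))
        - (shear a b D φ c * (vh.eval c - Vc) + moment D φ c * (Wc - (derivative vh).eval c))) :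
    ∫ y in c..d, moment D φ y * (U' - derivative (derivative ut)).eval y
      = (∫ y in c..d, momentDeriv₂ a b D (derivative (derivative φ)) y * (v 0 y - vh.eval y))
        - (shear a b D φ d * (v 0 d - Vd) - shear a b D φ c * (v 0 c - Vc))
        + (moment D φ d * (σd - Wd) - moment D φ c * (σc - Wc)) := by
  have hg := h.green_moment hab hcd hs φ (hv.sub (derivChain_eval c d 1 vh))
  simp only [Function.iterate_zero, id_eq, Function.iterate_one,
    show (derivative^[2] vh) = derivative (derivative vh) from rfl] at hg
  have i1 := h.intervalIntegrable_moment hcd hs φ (w := fun y => U'.eval y - v 2 y)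
    (U'.continuous.continuousOn.sub hv.cont)
  have i2 := h.intervalIntegrable_moment hcd hs φ
    (w := fun y => v 2 y - (derivative (derivative vh)).eval y)
    (hv.cont.sub (derivative (derivative vh)).continuous.continuousOn)
  have i3 := h.intervalIntegrable_moment hcd hs φ
    (w := fun y => (derivative (derivative (ut - vh))).eval y)
    (derivative (derivative (ut - vh))).continuous.continuousOn
  -- The difference is split at `v_xx` and at the curvature of `vh`. The first part is given by
  -- `hU`, the second by Green's formula, the third by the scheme. The traces of `v_x` from the
  -- first two parts cancel, and only the substitute slopes `σ` remain.
  have e : ∫ y in c..d, moment D φ y * (U' - derivative (derivative ut)).eval y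
      = (∫ y in c..d, moment D φ y * (U'.eval y - v 2 y))
        + (∫ y in c..d, moment D φ y * (v 2 y - (derivative (derivative vh)).eval y))
        - ∫ y in c..d, moment D φ y * (derivative (derivative (ut - vh))).eval y := by
    rw [← intervalIntegral.integral_add i1 i2, ← intervalIntegral.integral_sub (i1.add i2) i3]
    congr 1; funext y
    simp only [derivative_sub, eval_sub]; ring
  rw [e, hU, heq, hg]
  ring

/-- The error equation obtained from the second equation of the scheme. -/
theorem CoeffBounds.velocity_error (h : CoeffBounds a b m K μ D) (hm : 0 < m) (hab : a < b)
    (hcd : c ≤ d) (hs : Icc c d ⊆ Icc a b) {u : ℝ → ℝ}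
    (hu : DerivChain a b 3 (fun i => dx a b i u)) {vt f : ℝ → ℝ} (hvt : ContinuousOn vt (Icc a b))
    (hpde : ∀ y ∈ Ioo a b, μ y * vt y = -dx a b 2 (fun z => D z * dx a b 2 u z) y + f y)
    (ψ V' vht uh : ℝ[X]) {Sc Sd Mc Md : ℝ}
    (heq : ∫ y in c..d, (μ y * ψ.eval y * vht.eval y
        + D y * (derivative (derivative ψ)).eval y * (derivative (derivative uh)).eval y)
      = (∫ y in c..d, ψ.eval y * f y)
        + ((-(ψ.eval d) * Sd + (derivative ψ).eval d * Md)
          - (-(ψ.eval c) * Sc + (derivative ψ).eval c * Mc))) :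
    ∫ y in c..d, μ y * ψ.eval y * (V' - vht).eval y
      = (∫ y in c..d, μ y * ψ.eval y * (V'.eval y - vt y))
        + (∫ y in c..d, moment D ψ y * ((derivative (derivative uh)).eval y - dx a b 2 u y))
        - (ψ.eval d * (dx a b 1 (fun z => D z * dx a b 2 u z) d - Sd)
          - ψ.eval c * (dx a b 1 (fun z => D z * dx a b 2 u z) c - Sc))
        + ((derivative ψ).eval d * (D d * dx a b 2 u d - Md)
          - (derivative ψ).eval c * (D c * dx a b 2 u c - Mc)) := by
  have hz : DerivChain a b 1 (fun i => dx a b (i + 2) u) := hu.shift.shift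
  have hz' := hz.mono hs
  have hg := h.green hcd hs hz' (derivChain_eval c d 1 ψ)
  simp only [Function.iterate_zero, id_eq, Function.iterate_one, zero_add, Nat.reduceAdd,
    show (derivative^[2] ψ) = derivative (derivative ψ) from rfl] at hg
  have hd1 : ∀ y ∈ Icc a b, HasDerivWithinAt (fun z => D z * dx a b 2 u z)
      (dx a b 1 D y * dx a b 2 u y + D y * dx a b 3 u y) (Icc a b) y :=
    fun y hy => h.hasDeriv_mul subset_rfl hz hy
  have hS : ∀ y ∈ Icc a b, dx a b 1 (fun z => D z * dx a b 2 u z) y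
      = dx a b 1 D y * dx a b 2 u y + D y * dx a b 3 u y :=
    fun y hy => HasDerivWithinAt.dx_one_eq hab hy (hd1 y hy)
  have hS2 : ∀ y ∈ Icc a b, dx a b 2 (fun z => D z * dx a b 2 u z) y
      = dx a b 2 D y * dx a b 2 u y + 2 * dx a b 1 D y * dx a b 3 u y + D y * dx a b 4 u y :=
    fun y hy => dx_two_eq hab hy hd1 (h.hasDeriv_mul₂ subset_rfl hz hy)
  rw [hS d (hs (right_mem_Icc.2 hcd)), hS c (hs (left_mem_Icc.2 hcd))]
  have cu2 : ContinuousOn (dx a b 2 u) (Icc c d) := hz'.continuousOn (i := 0) (by omega)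
  have cvt := hvt.mono hs
  have iμ := h.intervalIntegrable_μ hm hcd hs
  have iμψ : IntervalIntegrable (fun y => μ y * ψ.eval y) volume c d :=
    iμ.mul_continuousOn ψ.continuous.continuousOn
  have j1 : IntervalIntegrable (fun y => μ y * ψ.eval y * vt y) volume c d :=
    iμψ.mul_continuousOn (by rwa [uIcc_of_le hcd])
  have j2 : IntervalIntegrable (fun y => (dx a b 2 D y * dx a b 2 u y
      + 2 * dx a b 1 D y * dx a b 3 u y + D y * dx a b 4 u y) * ψ.eval y) volume c d :=
    (h.intervalIntegrable_mul₂ hcd hs hz').mul_continuousOn ψ.continuous.continuousOn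
  -- The force is eliminated through the differential equation, which is available in the open
  -- interval only; the end points do not affect the integral.
  have hf : ∫ y in c..d, ψ.eval y * f y = (∫ y in c..d, μ y * ψ.eval y * vt y)
      + ∫ y in c..d, (dx a b 2 D y * dx a b 2 u y
        + 2 * dx a b 1 D y * dx a b 3 u y + D y * dx a b 4 u y) * ψ.eval y := by
    rw [← intervalIntegral.integral_add j1 j2]
    refine intervalIntegral.integral_congr_Ioo_of_le hcd fun y hy => ?_
    have hy1 : y ∈ Ioo a b := by
      have h1 := hs (left_mem_Icc.2 hcd)
      have h2 := hs (right_mem_Icc.2 hcd)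
      exact ⟨h1.1.trans_lt hy.1, hy.2.trans_le h2.2⟩
    have := hpde y hy1
    rw [hS2 y (Ioo_subset_Icc_self hy1)] at this
    linear_combination (-ψ.eval y) * this
  have k1 : IntervalIntegrable (fun y => μ y * ψ.eval y * V'.eval y) volume c d :=
    iμψ.mul_continuousOn V'.continuous.continuousOn
  have k2 : IntervalIntegrable (fun y => μ y * ψ.eval y * vht.eval y) volume c d :=
    iμψ.mul_continuousOn vht.continuous.continuousOn
  have cD := h.continuousOn.mono hs
  have k3 : IntervalIntegrable (fun y => D y * (derivative (derivative ψ)).eval y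
      * (derivative (derivative uh)).eval y) volume c d :=
    intervalIntegrable_of_Icc hcd ((cD.mul (derivative (derivative ψ)).continuous.continuousOn).mul
      (derivative (derivative uh)).continuous.continuousOn)
  have k4 : IntervalIntegrable (fun y => D y * (derivative (derivative ψ)).eval y
      * dx a b 2 u y) volume c d :=
    intervalIntegrable_of_Icc hcd ((cD.mul (derivative (derivative ψ)).continuous.continuousOn).mul
      cu2)
  rw [intervalIntegral.integral_add k2 k3, hf, hg] at heq
  have e1 : ∫ y in c..d, μ y * ψ.eval y * (V' - vht).eval y
      = (∫ y in c..d, μ y * ψ.eval y * V'.eval y) - ∫ y in c..d, μ y * ψ.eval y * vht.eval y := by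
    rw [← intervalIntegral.integral_sub k1 k2]
    congr 1; funext y; rw [eval_sub]; ring
  have e2 : ∫ y in c..d, μ y * ψ.eval y * (V'.eval y - vt y)
      = (∫ y in c..d, μ y * ψ.eval y * V'.eval y) - ∫ y in c..d, μ y * ψ.eval y * vt y := by
    rw [← intervalIntegral.integral_sub k1 j1]
    congr 1; funext y; ring
  have e3 : ∫ y in c..d, moment D ψ y * ((derivative (derivative uh)).eval y - dx a b 2 u y)
      = (∫ y in c..d, D y * (derivative (derivative ψ)).eval y
          * (derivative (derivative uh)).eval y)
        - ∫ y in c..d, D y * (derivative (derivative ψ)).eval y * dx a b 2 u y := by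
    rw [← intervalIntegral.integral_sub k3 k4]
    congr 1; funext y; simp only [moment]; ring
  have e4 : ∫ y in c..d, D y * (derivative (derivative ψ)).eval y * dx a b 2 u y
      = ∫ y in c..d, D y * dx a b 2 u y * (derivative (derivative ψ)).eval y := by
    congr 1; funext y; ring
  rw [e1, e2, e3, e4]
  linarith

/-- The lower order terms in the energy balance on an element. -/
theorem CoeffBounds.volume_error_le (h : CoeffBounds a b m K μ D) (hcd : c < d)
    (hs : Icc c d ⊆ Icc a b) {r s : ℕ} (hrs : r ≤ s + 2) {I : ℝ} (hI : 0 < I)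
    {Z V : ℝ[X]} (hZ : Z.natDegree ≤ r)
    (hinv : ∀ y ∈ Icc c d,
      (d - c) ^ 3 * ((derivative Z).eval y) ^ 2 ≤ I * ∫ y in c..d, (Z.eval y) ^ 2)
    {v : ℝ → ℝ} (hv : ContinuousOn v (Icc c d))
    (horth : ∀ ψ : ℝ[X], ψ.natDegree ≤ s → ∫ y in c..d, D y * ψ.eval y * (V.eval y - v y) = 0)
    {lam : ℝ} (hlam : 0 < lam) :
    -∫ y in c..d, momentDeriv₂ a b D Z y * (V.eval y - v y)
      ≤ lam * (1 + I) * (∫ y in c..d, (Z.eval y) ^ 2)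
        + K ^ 2 / lam * (1 + 1 / (d - c) ^ 2) * ∫ y in c..d, (V.eval y - v y) ^ 2 := by
  have hl : 0 < d - c := sub_pos.2 hcd
  have cδ : ContinuousOn (fun y => V.eval y - v y) (Icc c d) := V.continuous.continuousOn.sub hv
  have cZ : ContinuousOn (fun y => Z.eval y) (Icc c d) := Z.continuous.continuousOn
  have cZ' : ContinuousOn (fun y => (derivative Z).eval y) (Icc c d) :=
    (derivative Z).continuous.continuousOn
  have cD := h.continuousOn.mono hs
  have cD1 := h.continuousOn₁.mono hs
  have i0 : IntervalIntegrable (fun y => D y * (derivative (derivative Z)).eval y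
      * (V.eval y - v y)) volume c d :=
    intervalIntegrable_of_Icc hcd.le
      ((cD.mul (derivative (derivative Z)).continuous.continuousOn).mul cδ)
  have i1 := h.intervalIntegrable_momentDeriv₂ hcd.le hs Z cδ
  -- With `Z` a curvature of degree at most `q - 2`, this is the point where `q - 4 ≤ s` is needed:
  -- the top order part `D Z_xx` is orthogonal to the projection error.
  have hdeg : (derivative (derivative Z)).natDegree ≤ s := by
    have h1 := natDegree_derivative_le Z
    have h2 := natDegree_derivative_le (derivative Z)
    omega
  have e1 : -∫ y in c..d, momentDeriv₂ a b D Z y * (V.eval y - v y)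
      = ∫ y in c..d, -(momentDeriv₂ a b D Z y * (V.eval y - v y)
        - D y * (derivative (derivative Z)).eval y * (V.eval y - v y)) := by
    rw [intervalIntegral.integral_neg, intervalIntegral.integral_sub i1 i0, horth _ hdeg, sub_zero]
  -- The weight `(d - c)^2` on the square of `Z_x` is undone by the inverse inequality; its price is
  -- the factor `1 / (d - c)^2` on the projection error, which is of sufficiently high order.
  have e2 : ∫ y in c..d, -(momentDeriv₂ a b D Z y * (V.eval y - v y)
        - D y * (derivative (derivative Z)).eval y * (V.eval y - v y))
      ≤ ∫ y in c..d, ((lam * Z.eval y ^ 2 + lam * (d - c) ^ 2 * (derivative Z).eval y ^ 2)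
        + K ^ 2 / lam * (1 + 1 / (d - c) ^ 2) * (V.eval y - v y) ^ 2) := by
    refine intervalIntegral.integral_mono_on hcd.le (i1.sub i0).neg
      (intervalIntegrable_of_Icc hcd.le (((continuousOn_const.mul (cZ.pow 2)).add
        (continuousOn_const.mul (cZ'.pow 2))).add (continuousOn_const.mul (cδ.pow 2))))
      fun y hy => ?_
    set δ := V.eval y - v y
    set z := Z.eval y
    set z' := (derivative Z).eval y
    have hD1 : (dx a b 1 D y) ^ 2 ≤ K ^ 2 := by
      rw [← sq_abs]; exact pow_le_pow_left₀ (abs_nonneg _) (h.Dx_bound y (hs hy)) 2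
    have hD2 : (dx a b 2 D y) ^ 2 ≤ K ^ 2 := by
      rw [← sq_abs]; exact pow_le_pow_left₀ (abs_nonneg _) (h.Dxx_bound y (hs hy)) 2
    have y1 := mul_le_young hlam z (-(dx a b 2 D y * δ))
    have y2 := mul_le_young (mul_pos hlam (pow_pos hl 2)) z' (-(2 * dx a b 1 D y * δ))
    have b1 : (-(dx a b 2 D y * δ)) ^ 2 / (4 * lam) ≤ K ^ 2 / lam * δ ^ 2 := by
      rw [div_le_iff₀ (by positivity)]
      have : K ^ 2 / lam * δ ^ 2 * (4 * lam) = 4 * (K ^ 2 * δ ^ 2) := by field_simp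
      rw [this]
      nlinarith [mul_le_mul_of_nonneg_right hD2 (sq_nonneg δ), mul_nonneg (sq_nonneg K) (sq_nonneg δ)]
    have b2 : (-(2 * dx a b 1 D y * δ)) ^ 2 / (4 * (lam * (d - c) ^ 2))
        ≤ K ^ 2 / lam * (1 / (d - c) ^ 2) * δ ^ 2 := by
      rw [div_le_iff₀ (by positivity)]
      have : K ^ 2 / lam * (1 / (d - c) ^ 2) * δ ^ 2 * (4 * (lam * (d - c) ^ 2))
        = 4 * (K ^ 2 * δ ^ 2) := by field_simp
      rw [this]
      nlinarith [mul_le_mul_of_nonneg_right hD1 (sq_nonneg δ)]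
    unfold momentDeriv₂
    linarith
  have hZ' : ∫ y in c..d, (derivative Z).eval y ^ 2
      ≤ (d - c) * (I * (∫ y in c..d, (Z.eval y) ^ 2) / (d - c) ^ 3) :=
    integral_sq_le_of_bound hcd.le cZ' fun y hy => by
      rw [le_div_iff₀ (by positivity)]; linarith [hinv y hy]
  have hZ'' : lam * (d - c) ^ 2 * ∫ y in c..d, (derivative Z).eval y ^ 2
      ≤ lam * I * ∫ y in c..d, (Z.eval y) ^ 2 := by
    calc _ ≤ lam * (d - c) ^ 2 * ((d - c) * (I * (∫ y in c..d, (Z.eval y) ^ 2) / (d - c) ^ 3)) :=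
          mul_le_mul_of_nonneg_left hZ' (by positivity)
      _ = _ := by field_simp
  have j1 : IntervalIntegrable (fun y => lam * Z.eval y ^ 2
      + lam * (d - c) ^ 2 * (derivative Z).eval y ^ 2) volume c d :=
    intervalIntegrable_of_Icc hcd.le ((continuousOn_const.mul (cZ.pow 2)).add
        (continuousOn_const.mul (cZ'.pow 2)))
  have j2 : IntervalIntegrable (fun y => K ^ 2 / lam * (1 + 1 / (d - c) ^ 2)
      * (V.eval y - v y) ^ 2) volume c d :=
    intervalIntegrable_of_Icc hcd.le (continuousOn_const.mul (cδ.pow 2))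
  rw [intervalIntegral.integral_add j1 j2, integral_sq_add_sq hcd.le cZ cZ',
    intervalIntegral.integral_const_mul] at e2
  linarith

/-- The polynomial `V'` will be a projection with weight `D`, so it does not remove this term, whose
weight is `μ`. The term is responsible for the contribution of `v_t` to the final bound. -/
theorem CoeffBounds.inertia_error_le (h : CoeffBounds a b m K μ D) (hm : 0 < m) (hcd : c ≤ d)
    (hs : Icc c d ⊆ Icc a b) (V V' : ℝ[X]) {vt : ℝ → ℝ} (hvt : ContinuousOn vt (Icc c d))
    {lam : ℝ} (hlam : 0 < lam) :
    ∫ y in c..d, μ y * V.eval y * (V'.eval y - vt y)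
      ≤ lam * (∫ y in c..d, (V.eval y) ^ 2)
        + K ^ 2 / lam * ∫ y in c..d, (V'.eval y - vt y) ^ 2 := by
  have cδ : ContinuousOn (fun y => V'.eval y - vt y) (Icc c d) := V'.continuous.continuousOn.sub hvt
  have cV : ContinuousOn (fun y => V.eval y) (Icc c d) := V.continuous.continuousOn
  rw [← integral_sq_add_sq hcd cV cδ]
  refine intervalIntegral.integral_mono_on hcd
    (((h.intervalIntegrable_μ hm hcd hs).mul_continuousOn V.continuous.continuousOn).mul_continuousOn
      (by rwa [uIcc_of_le hcd]))
    (intervalIntegrable_of_Icc hcd ((continuousOn_const.mul (cV.pow 2)).add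
        (continuousOn_const.mul (cδ.pow 2)))) fun y hy => ?_
  have hμ := h.μ_bounds y (hs hy)
  have hμ2 : (μ y) ^ 2 ≤ K ^ 2 := pow_le_pow_left₀ (hm.le.trans hμ.1) hμ.2 2
  have y1 := mul_le_young hlam (V.eval y) (μ y * (V'.eval y - vt y))
  have b1 : (μ y * (V'.eval y - vt y)) ^ 2 / (4 * lam) ≤ K ^ 2 / lam * (V'.eval y - vt y) ^ 2 := by
    rw [div_le_iff₀ (by positivity)]
    have : K ^ 2 / lam * (V'.eval y - vt y) ^ 2 * (4 * lam)
      = 4 * (K ^ 2 * (V'.eval y - vt y) ^ 2) := by field_simp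
    rw [this]
    nlinarith [mul_le_mul_of_nonneg_right hμ2 (sq_nonneg (V'.eval y - vt y)),
      mul_nonneg (sq_nonneg K) (sq_nonneg (V'.eval y - vt y))]
  linarith

/-- Scaled traces of shear, moment, velocity and slope velocity are controlled by the energy. -/
theorem CoeffBounds.trace_le (h : CoeffBounds a b m K μ D) (hm : 0 < m) (hab : a < b) (hcd : c < d)
    (hs : Icc c d ⊆ Icc a b) {I σ hh L : ℝ} (hσ : hh ≤ σ * (d - c)) (hh0 : 0 < hh) (hL : hh ≤ L)
    {φ V : ℝ[X]} {y : ℝ} (hy : y ∈ Icc c d)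
    (hZ : (d - c) * ((derivative (derivative φ)).eval y) ^ 2
        ≤ I * ∫ y in c..d, ((derivative (derivative φ)).eval y) ^ 2 ∧
      (d - c) ^ 3 * ((derivative (derivative (derivative φ))).eval y) ^ 2
        ≤ I * ∫ y in c..d, ((derivative (derivative φ)).eval y) ^ 2)
    (hV : (d - c) * (V.eval y) ^ 2 ≤ I * ∫ y in c..d, (V.eval y) ^ 2 ∧
      (d - c) ^ 3 * ((derivative V).eval y) ^ 2 ≤ I * ∫ y in c..d, (V.eval y) ^ 2) :
    hh ^ 3 * shear a b D φ y ^ 2 + hh * moment D φ y ^ 2 + hh * V.eval y ^ 2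
      + hh ^ 3 * (derivative V).eval y ^ 2
      ≤ I * ((2 * L ^ 2 + 1) * K ^ 2 * σ + 2 * K ^ 2 * σ ^ 3 + σ + σ ^ 3)
        * ((∫ y in c..d, ((derivative (derivative φ)).eval y) ^ 2)
          + ∫ y in c..d, (V.eval y) ^ 2) := by
  have hl : 0 < d - c := sub_pos.2 hcd
  have hσ0 : 0 < σ := by
    by_contra! hcon
    have := mul_nonpos_of_nonpos_of_nonneg hcon hl.le
    linarith
  set z := (derivative (derivative φ)).eval y
  set z' := (derivative (derivative (derivative φ))).eval y
  set JZ := ∫ y in c..d, ((derivative (derivative φ)).eval y) ^ 2 with hJZ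
  set JV := ∫ y in c..d, (V.eval y) ^ 2 with hJV
  have hJZ0 : 0 ≤ JZ := intervalIntegral.integral_nonneg hcd.le fun y _ => sq_nonneg _
  have hJV0 : 0 ≤ JV := intervalIntegral.integral_nonneg hcd.le fun y _ => sq_nonneg _
  have t1 : ∀ {x J : ℝ}, (d - c) * x ^ 2 ≤ I * J → hh * x ^ 2 ≤ σ * (I * J) := by
    intro x J hx
    calc hh * x ^ 2 ≤ σ * (d - c) * x ^ 2 := mul_le_mul_of_nonneg_right hσ (sq_nonneg x)
      _ = σ * ((d - c) * x ^ 2) := by ring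
      _ ≤ _ := mul_le_mul_of_nonneg_left hx hσ0.le
  have t3 : ∀ {x J : ℝ}, (d - c) ^ 3 * x ^ 2 ≤ I * J → hh ^ 3 * x ^ 2 ≤ σ ^ 3 * (I * J) := by
    intro x J hx
    calc hh ^ 3 * x ^ 2 ≤ (σ * (d - c)) ^ 3 * x ^ 2 :=
          mul_le_mul_of_nonneg_right (pow_le_pow_left₀ hh0.le hσ 3) (sq_nonneg x)
      _ = σ ^ 3 * ((d - c) ^ 3 * x ^ 2) := by ring
      _ ≤ _ := mul_le_mul_of_nonneg_left hx (pow_pos hσ0 3).le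
  have z1 := t1 hZ.1
  have z3 := t3 hZ.2
  have v1 := t1 hV.1
  have v3 := t3 hV.2
  have hD := h.D_bounds y (hs hy)
  have hD2 : (D y) ^ 2 ≤ K ^ 2 := pow_le_pow_left₀ (hm.le.trans hD.1) hD.2 2
  have hD1 : (dx a b 1 D y) ^ 2 ≤ K ^ 2 := by
    rw [← sq_abs]; exact pow_le_pow_left₀ (abs_nonneg _) (h.Dx_bound y (hs hy)) 2
  have z1' : hh ^ 3 * z ^ 2 ≤ L ^ 2 * (σ * (I * JZ)) := by
    calc hh ^ 3 * z ^ 2 = hh ^ 2 * (hh * z ^ 2) := by ring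
      _ ≤ L ^ 2 * (σ * (I * JZ)) := by gcongr
  have hM : hh * moment D φ y ^ 2 ≤ K ^ 2 * (σ * (I * JZ)) := by
    rw [moment_eq]
    calc _ = D y ^ 2 * (hh * z ^ 2) := by ring
      _ ≤ _ := by gcongr
  have hS : hh ^ 3 * shear a b D φ y ^ 2
      ≤ 2 * (K ^ 2 * (L ^ 2 * (σ * (I * JZ)))) + 2 * (K ^ 2 * (σ ^ 3 * (I * JZ))) := by
    rw [h.shear_eq hab φ (hs hy)]
    have e := mul_sub_sq_le (pow_pos hh0 3).le (dx a b 1 D y * z) (-(D y * z'))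
    have e1 : hh ^ 3 * (dx a b 1 D y * z) ^ 2 ≤ K ^ 2 * (L ^ 2 * (σ * (I * JZ))) := by
      calc _ = (dx a b 1 D y) ^ 2 * (hh ^ 3 * z ^ 2) := by ring
        _ ≤ _ := by gcongr
    have e2 : hh ^ 3 * (-(D y * z')) ^ 2 ≤ K ^ 2 * (σ ^ 3 * (I * JZ)) := by
      calc _ = (D y) ^ 2 * (hh ^ 3 * z' ^ 2) := by ring
        _ ≤ _ := by gcongr
    rw [sub_neg_eq_add] at e
    linarith
  have hIZ : 0 ≤ I * JZ := le_trans (by positivity) hZ.1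
  have hIV : 0 ≤ I * JV := le_trans (by positivity) hV.1
  have n1 : 0 ≤ ((2 * L ^ 2 + 1) * K ^ 2 * σ + 2 * K ^ 2 * σ ^ 3) * (I * JV) := by positivity
  have n2 : 0 ≤ (σ + σ ^ 3) * (I * JZ) := by positivity
  linarith

end Element

/-! ### The mesh and the energy balance -/

section MeshFacts

variable {a b : ℝ} (M : Mesh a b)

theorem Mesh.x_le {i j : ℕ} (hij : i ≤ j) (hj : j ≤ M.n) : M.x i ≤ M.x j := by
  induction j, hij using Nat.le_induction with
  | base => exact le_rfl
  | succ j hij ih => exact (ih (by omega)).trans (M.x_lt j (by omega)).le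

theorem Mesh.x_mem {i : ℕ} (hi : i ≤ M.n) : M.x i ∈ Icc a b := by
  constructor
  · have := M.x_le (Nat.zero_le i) hi
    rwa [M.x_zero] at this
  · have := M.x_le hi le_rfl
    rwa [M.x_last] at this

theorem Mesh.Icc_subset {j : ℕ} (hj : j < M.n) : Icc (M.x j) (M.x (j + 1)) ⊆ Icc a b :=
  Icc_subset_Icc (M.x_mem hj.le).1 (M.x_mem hj).2

theorem Mesh.n_pos (hab : a < b) : 0 < M.n := by
  rcases Nat.eq_zero_or_pos M.n with h | h
  · have h1 := M.x_zero
    have h2 := M.x_last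
    rw [h, h1] at h2
    exact absurd h2 hab.ne
  · exact h

theorem Mesh.length_le_h {j : ℕ} (hj : j < M.n) : M.x (j + 1) - M.x j ≤ M.h :=
  le_ciSup (f := fun j : Fin M.n => M.x (j + 1) - M.x j) (Set.finite_range _).bddAbove ⟨j, hj⟩

theorem Mesh.h_pos (hab : a < b) : 0 < M.h :=
  (sub_pos.2 (M.x_lt 0 (M.n_pos hab))).trans_le (M.length_le_h (M.n_pos hab))

theorem Mesh.h_le (hab : a < b) : M.h ≤ b - a := by
  have : Nonempty (Fin M.n) := ⟨⟨0, M.n_pos hab⟩⟩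
  refine ciSup_le fun j => ?_
  have h1 := (M.x_mem j.2.le).1
  have h2 := (M.x_mem (i := j + 1) j.2).2
  linarith

theorem Mesh.sum_integral {f : ℝ → ℝ} (hf : ContinuousOn f (Icc a b)) :
    ∑ j ∈ Finset.range M.n, ∫ y in (M.x j)..(M.x (j + 1)), f y = ∫ y in a..b, f y := by
  rw [intervalIntegral.sum_integral_adjacent_intervals, M.x_zero, M.x_last]
  exact fun j hj => intervalIntegrable_of_Icc (M.x_lt j hj).le (hf.mono (M.Icc_subset hj))

/-- Passes from elements to nodes: the two contributions at an interior node must be taken together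
to see the dissipation in the jumps. -/
theorem sum_range_node (B : ℕ → ℕ → ℝ) (N : ℕ) :
    ∑ j ∈ Finset.range (N + 1), (B j (j + 1) - B j j)
      = B N (N + 1) - B 0 0 + ∑ k ∈ Finset.range N, (B k (k + 1) - B (k + 1) (k + 1)) := by
  rw [Finset.sum_sub_distrib, Finset.sum_sub_distrib, Finset.sum_range_succ,
    Finset.sum_range_succ' (fun j => B j j)]
  ring

end MeshFacts

/-! ### Linearity of the numerical fluxes -/

section FluxLinear

variable {a b m K : ℝ} {μ D : ℝ → ℝ} (M : Mesh a b) (F : FluxParams)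

theorem moment_sub (D : ℝ → ℝ) (p r : ℝ[X]) (y : ℝ) :
    moment D (p - r) y = moment D p y - moment D r y := by
  simp only [moment, derivative_sub, eval_sub]; ring

theorem CoeffBounds.shear_sub (h : CoeffBounds a b m K μ D) (hab : a < b) (p r : ℝ[X]) {y : ℝ}
    (hy : y ∈ Icc a b) : shear a b D (p - r) y = shear a b D p y - shear a b D r y := by
  simp only [h.shear_eq hab _ hy, derivative_sub, eval_sub]; ring

theorem CoeffBounds.ζ₂_sub (h : CoeffBounds a b m K μ D) (hab : a < b) (u u' v v' : ℕ → ℝ[X])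
    (i : ℕ) : ζ₂ M F D (fun j => u j - u' j) (fun j => v j - v' j) i
      = ζ₂ M F D u v i - ζ₂ M F D u' v' i := by
  simp only [ζ₂, eval_sub, h.shear_sub hab _ _ (left_mem_Icc.2 hab.le),
    h.shear_sub hab _ _ (right_mem_Icc.2 hab.le)]
  split_ifs <;> ring

theorem ζ₁_sub (u u' v v' : ℕ → ℝ[X]) (i : ℕ) :
    ζ₁ M F D (fun j => u j - u' j) (fun j => v j - v' j) i
      = ζ₁ M F D u v i - ζ₁ M F D u' v' i := by
  simp only [ζ₁, eval_sub, derivative_sub, moment_sub]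
  split_ifs <;> ring

theorem CoeffBounds.vStar_sub (h : CoeffBounds a b m K μ D) (hab : a < b) (u u' v v' : ℕ → ℝ[X])
    {i : ℕ} (hi : i ≤ M.n) : vStar M F D (fun j => u j - u' j) (fun j => v j - v' j) i
      = vStar M F D u v i - vStar M F D u' v' i := by
  simp only [vStar, eval_sub, h.ζ₂_sub M F hab, h.shear_sub hab _ _ (M.x_mem hi)]
  split_ifs <;> ring

theorem CoeffBounds.shearStar_sub (h : CoeffBounds a b m K μ D) (hab : a < b)
    (u u' v v' : ℕ → ℝ[X]) {i : ℕ} (hi : i ≤ M.n) :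
    shearStar M F D (fun j => u j - u' j) (fun j => v j - v' j) i
      = shearStar M F D u v i - shearStar M F D u' v' i := by
  simp only [shearStar, eval_sub, h.ζ₂_sub M F hab, h.shear_sub hab _ _ (M.x_mem hi),
    h.shear_sub hab _ _ (left_mem_Icc.2 hab.le), h.shear_sub hab _ _ (right_mem_Icc.2 hab.le)]
  split_ifs <;> ring

theorem vxStar_sub (u u' v v' : ℕ → ℝ[X]) (i : ℕ) :
    vxStar M F D (fun j => u j - u' j) (fun j => v j - v' j) i
      = vxStar M F D u v i - vxStar M F D u' v' i := by
  simp only [vxStar, eval_sub, derivative_sub, ζ₁_sub, moment_sub]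
  split_ifs <;> ring

theorem momentStar_sub (u u' v v' : ℕ → ℝ[X]) (i : ℕ) :
    momentStar M F D (fun j => u j - u' j) (fun j => v j - v' j) i
      = momentStar M F D u v i - momentStar M F D u' v' i := by
  simp only [momentStar, eval_sub, derivative_sub, ζ₁_sub, moment_sub]
  split_ifs <;> ring

end FluxLinear

/-! ### Summation of the node contributions -/

theorem TraceErr.mono {h w w' s k v x : ℝ} (H : TraceErr h w s k v x) (hh : 0 ≤ h) (hw : w ≤ w') :
    TraceErr h w' s k v x := by
  have h1 : h * w ≤ h * w' := mul_le_mul_of_nonneg_left hw hh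
  have h3 : h ^ 3 * w ≤ h ^ 3 * w' := mul_le_mul_of_nonneg_left hw (pow_nonneg hh 3)
  exact ⟨H.s_le.trans h1, H.x_le.trans h1, H.k_le.trans h3, H.v_le.trans h3, H.k_le'.trans h1,
    H.v_le'.trans h1⟩

/-- The constant of the node estimates. -/
noncomputable def nodeConst (F : FluxParams) (L : ℝ) : ℝ :=
  4 * (fluxConst L (1 + L ^ 2) F.β₁ + fluxConst L (1 + L ^ 2) F.β₂ + fluxConst L (1 + L ^ 2) F.τ₁
    + fluxConst L (1 + L ^ 2) F.τ₂) + (fluxConst L (1 + L ^ 2) |F.η₁|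
      + fluxConst L (1 + L ^ 2) |F.η₂|)

section Nodes

variable {a b m K : ℝ} {μ D : ℝ → ℝ} (M : Mesh a b) (F : FluxParams)

/-- The contribution of the element `j` to the energy balance at its end point `x i`: `z, w` are
the differences of the comparison functions `U, V` and the discrete solution, `σ` are the slope
velocities, `S, Mo, v` are the shear, moment and velocity of the exact solution. -/
noncomputable def nodeTerm (D : ℝ → ℝ) (z w U V : ℕ → ℝ[X]) (S Mo v : ℝ → ℝ) (σ : ℕ → ℝ)
    (j i : ℕ) : ℝ :=
  bracket (shear a b D (z j) (M.x i)) (moment D (z j) (M.x i)) ((w j).eval (M.x i))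
    ((derivative (w j)).eval (M.x i)) (vStar M F D z w i) (shearStar M F D z w i)
    (vxStar M F D z w i) (momentStar M F D z w i) (vStar M F D U V i - v (M.x i))
    (shearStar M F D U V i - S (M.x i)) (vxStar M F D U V i - σ i)
    (momentStar M F D U V i - Mo (M.x i))

/-- The scaled traces of the element `j` at its end point `x i`. -/
noncomputable def nodeSize (D : ℝ → ℝ) (z w : ℕ → ℝ[X]) (j i : ℕ) : ℝ :=
  M.h ^ 3 * shear a b D (z j) (M.x i) ^ 2 + M.h * moment D (z j) (M.x i) ^ 2
    + M.h * (w j).eval (M.x i) ^ 2 + M.h ^ 3 * (derivative (w j)).eval (M.x i) ^ 2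

/-- Consistency is used here: at an interior node the averages preserve single-valued traces and the
jumps of the exact values vanish, and at an end the boundary condition makes the exact `ζ₁`, `ζ₂`
vanish. Hence a consistency error of a flux is the same flux applied to trace errors, as
`interior_node` and `boundary_node` require. -/
theorem sum_nodeTerm_le (hab : a < b) (hF : F.Admissible) {Θ : ℝ}
    (hΘ : Θ = 1 ∨ (F.Dissipative ∧ Θ = M.h)) {lam : ℝ} (hlam : 0 < lam)
    (z w U V : ℕ → ℝ[X]) (S Mo v : ℝ → ℝ) (σ : ℕ → ℝ)
    (ha₁ : -F.bc.a₁ * σ 0 + F.bc.b₁ * Mo a = 0) (ha₂ : F.bc.a₂ * v a + F.bc.b₂ * S a = 0)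
    (hb₁ : F.bc.a₁ * σ M.n + F.bc.b₁ * Mo b = 0) (hb₂ : F.bc.a₂ * v b - F.bc.b₂ * S b = 0)
    {e E : ℕ → ℝ} (he0 : ∀ j, 0 ≤ e j) (hE0 : ∀ j, 0 ≤ E j)
    (he : ∀ j < M.n, ∀ i, i = j ∨ i = j + 1 → TraceErr M.h (e j)
      (shear a b D (U j) (M.x i) - S (M.x i)) (moment D (U j) (M.x i) - Mo (M.x i))
      ((V j).eval (M.x i) - v (M.x i)) ((derivative (V j)).eval (M.x i) - σ i))
    (hE : ∀ j < M.n, ∀ i, i = j ∨ i = j + 1 → nodeSize M D z w j i ≤ E j) :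
    ∑ j ∈ Finset.range M.n, (nodeTerm M F D z w U V S Mo v σ j (j + 1)
        - nodeTerm M F D z w U V S Mo v σ j j)
      ≤ 8 * lam * (∑ j ∈ Finset.range M.n, E j)
        + 4 * nodeConst F (b - a) * (1 + 1 / lam) * (Θ * ∑ j ∈ Finset.range M.n, e j) := by
  have hh := M.h_pos hab
  have hL := M.h_le hab
  set L := b - a with hLdef
  have hL0 : 0 < L := sub_pos.2 hab
  have hΘ0 : 0 < Θ := by
    rcases hΘ with rfl | ⟨-, rfl⟩
    · exact one_pos
    · exact hh
  have hΛ0 : 0 ≤ 1 + L ^ 2 := by positivity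
  have p1 := fluxConst_pos hL0.le hΛ0 hF.β₁_nonneg
  have p2 := fluxConst_pos hL0.le hΛ0 hF.β₂_nonneg
  have p3 := fluxConst_pos hL0.le hΛ0 hF.τ₁_nonneg
  have p4 := fluxConst_pos hL0.le hΛ0 hF.τ₂_nonneg
  have p5 := fluxConst_pos hL0.le hΛ0 (abs_nonneg F.η₁)
  have p6 := fluxConst_pos hL0.le hΛ0 (abs_nonneg F.η₂)
  set c := nodeConst F L with hc
  have hc1 : 4 * (fluxConst L (1 + L ^ 2) F.β₁ + fluxConst L (1 + L ^ 2) F.β₂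
      + fluxConst L (1 + L ^ 2) F.τ₁ + fluxConst L (1 + L ^ 2) F.τ₂) ≤ c := by
    rw [hc, nodeConst]; linarith
  have hc2 : fluxConst L (1 + L ^ 2) |F.η₁| + fluxConst L (1 + L ^ 2) |F.η₂| ≤ c := by
    rw [hc, nodeConst]; linarith
  have hc0 : 0 < c := by linarith
  obtain ⟨N, hN⟩ : ∃ N, M.n = N + 1 := ⟨M.n - 1, by have := M.n_pos hab; omega⟩
  have hxN : M.x (N + 1) = b := by rw [← hN]; exact M.x_last
  have hN0 : N + 1 ≠ 0 := by omega
  have hlam' : 0 < 1 + 1 / lam := by positivity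
  have up : ∀ {c' w' : ℝ}, c' ≤ c → 0 ≤ w' → c' * (1 + 1 / lam) * (Θ * w')
      ≤ c * (1 + 1 / lam) * (Θ * w') := fun h1 h2 => by gcongr
  have hleft : -nodeTerm M F D z w U V S Mo v σ 0 0
      ≤ 2 * lam * E 0 + c * (1 + 1 / lam) * (Θ * e 0) := by
    have hT := he 0 (M.n_pos hab) 0 (Or.inl rfl)
    have hQ := hE 0 (M.n_pos hab) 0 (Or.inl rfl)
    rw [nodeSize, M.x_zero] at hQ
    rw [M.x_zero] at hT
    rw [nodeTerm, M.x_zero]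
    refine (boundary_node hF.eta_sign hh hL hlam (he0 0)
      (hΘ.imp id fun H => ⟨⟨left_ne_zero_of_mul H.1.eta_ne, right_ne_zero_of_mul H.1.eta_ne⟩,
        H.2⟩) hT ?_ ?_ ?_ ?_ ?_ ?_ ?_ ?_).trans
      (add_le_add (mul_le_mul_of_nonneg_left hQ (by positivity)) (up hc2 (he0 0)))
    · simp [vStar, ζ₂]
    · simp [shearStar, ζ₂]
    · simp [vxStar, ζ₁]
    · simp [momentStar, ζ₁]
    -- The exact boundary quantity is zero, so it may be subtracted inside `ζ₂`.
    · simp only [vStar, ζ₂, if_true]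
      linear_combination (-(F.bc.a₂ - F.η₂ * F.bc.b₂)) * ha₂
    · simp only [shearStar, ζ₂, if_true]
      linear_combination (-(F.bc.b₂ + F.η₂ * F.bc.a₂)) * ha₂
    · simp only [vxStar, ζ₁, if_true]
      linear_combination (F.bc.a₁ - F.η₁ * F.bc.b₁) * ha₁
    · simp only [momentStar, ζ₁, if_true]
      linear_combination (-(F.bc.b₁ + F.η₁ * F.bc.a₁)) * ha₁
  have hright : nodeTerm M F D z w U V S Mo v σ N (N + 1)
      ≤ 2 * lam * E N + c * (1 + 1 / lam) * (Θ * e N) := by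
    have hT := he N (by omega) (N + 1) (Or.inr rfl)
    have hQ := hE N (by omega) (N + 1) (Or.inr rfl)
    rw [hN] at hb₁
    rw [nodeSize, hxN] at hQ
    rw [hxN] at hT
    rw [nodeTerm, hxN]
    have hT' : TraceErr M.h (e N) (-(shear a b D (U N) b - S b)) (moment D (U N) b - Mo b)
        ((V N).eval b - v b) (-((derivative (V N)).eval b - σ (N + 1))) :=
      ⟨by rw [neg_sq]; exact hT.s_le, by rw [neg_sq]; exact hT.x_le, hT.k_le, hT.v_le, hT.k_le',
        hT.v_le'⟩
    -- Reflection of the interval: shear and slope velocity change sign, moment and velocity do not,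
    -- and the bracket is odd under this. The right end becomes a left end.
    have hbr : ∀ S M V W Vs Ss Ws Ms dV dS dW dM : ℝ, bracket S M V W Vs Ss Ws Ms dV dS dW dM
        = -bracket (-S) M V (-W) Vs (-Ss) (-Ws) Ms dV (-dS) (-dW) dM := by
      intros; unfold bracket; ring
    rw [hbr]
    have hQ' : M.h ^ 3 * (-shear a b D (z N) b) ^ 2 + M.h * moment D (z N) b ^ 2
      + M.h * (w N).eval b ^ 2 + M.h ^ 3 * (-(derivative (w N)).eval b) ^ 2 ≤ E N := by
      rw [neg_sq, neg_sq]; exact hQ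
    refine (boundary_node hF.eta_sign hh hL hlam (he0 N)
      (hΘ.imp id fun H => ⟨⟨left_ne_zero_of_mul H.1.eta_ne, right_ne_zero_of_mul H.1.eta_ne⟩,
        H.2⟩) hT' ?_ ?_ ?_ ?_ ?_ ?_ ?_ ?_).trans
      (add_le_add (mul_le_mul_of_nonneg_left hQ' (by positivity)) (up hc2 (he0 N)))
    · simp only [vStar, ζ₂, hN, hN0, if_false, if_true, Nat.add_sub_cancel]; ring
    · simp only [shearStar, ζ₂, hN, hN0, if_false, if_true, Nat.add_sub_cancel]; ring
    · simp only [vxStar, ζ₁, hN, hN0, if_false, if_true, Nat.add_sub_cancel]; ring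
    · simp only [momentStar, ζ₁, hN, hN0, if_false, if_true, Nat.add_sub_cancel]; ring
    · simp only [vStar, ζ₂, hN, hN0, if_false, if_true, Nat.add_sub_cancel]
      linear_combination (-(F.bc.a₂ - F.η₂ * F.bc.b₂)) * hb₂
    · simp only [shearStar, ζ₂, hN, hN0, if_false, if_true, Nat.add_sub_cancel]
      linear_combination (-(F.bc.b₂ + F.η₂ * F.bc.a₂)) * hb₂
    · simp only [vxStar, ζ₁, hN, hN0, if_false, if_true, Nat.add_sub_cancel]
      linear_combination (F.bc.a₁ - F.η₁ * F.bc.b₁) * hb₁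
    · simp only [momentStar, ζ₁, hN, hN0, if_false, if_true, Nat.add_sub_cancel]
      linear_combination (-(F.bc.b₁ + F.η₁ * F.bc.a₁)) * hb₁
  have hint : ∀ k ∈ Finset.range N, nodeTerm M F D z w U V S Mo v σ k (k + 1)
      - nodeTerm M F D z w U V S Mo v σ (k + 1) (k + 1)
      ≤ 2 * lam * (E k + E (k + 1)) + c * (1 + 1 / lam) * (Θ * (e k + e (k + 1))) := by
    intro k hk
    have hkN := Finset.mem_range.1 hk
    have h0 : k + 1 ≠ 0 := by omega
    have hn : k + 1 ≠ M.n := by omega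
    have hTm := (he k (by omega) (k + 1) (Or.inr rfl)).mono hh.le
      (le_add_of_nonneg_right (he0 (k + 1)))
    have hTp := (he (k + 1) (by omega) (k + 1) (Or.inl rfl)).mono hh.le
      (le_add_of_nonneg_left (he0 k))
    have hQm := hE k (by omega) (k + 1) (Or.inr rfl)
    have hQp := hE (k + 1) (by omega) (k + 1) (Or.inl rfl)
    have hsum : 0 ≤ e k + e (k + 1) := add_nonneg (he0 _) (he0 _)
    rw [nodeTerm, nodeTerm]
    refine (interior_node hF.α₁_mem hF.α₂_mem hF.β₁_nonneg hF.β₂_nonneg hF.τ₁_nonneg hF.τ₂_nonneg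
      hh hL hlam hsum
      (hΘ.imp id fun H => ⟨⟨H.1.β₁_pos, H.1.β₂_pos, H.1.τ₁_pos, H.1.τ₂_pos⟩, H.2⟩) hTm hTp
      ?_ ?_ ?_ ?_ ?_ ?_ ?_ ?_).trans
      (add_le_add (mul_le_mul_of_nonneg_left (add_le_add hQm hQp) (by positivity)) (up hc1 hsum))
    · simp only [vStar, h0, hn, if_false, Nat.add_sub_cancel]
    · simp only [shearStar, h0, hn, if_false, Nat.add_sub_cancel]
    · simp only [vxStar, h0, hn, if_false, Nat.add_sub_cancel]
    · simp only [momentStar, h0, hn, if_false, Nat.add_sub_cancel]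
    · simp only [vStar, h0, hn, if_false, Nat.add_sub_cancel]; ring
    · simp only [shearStar, h0, hn, if_false, Nat.add_sub_cancel]; ring
    · simp only [vxStar, h0, hn, if_false, Nat.add_sub_cancel]; ring
    · simp only [momentStar, h0, hn, if_false, Nat.add_sub_cancel]; ring
  have hsumint := Finset.sum_le_sum hint
  rw [Finset.sum_add_distrib, ← Finset.mul_sum, ← Finset.mul_sum, ← Finset.mul_sum,
    Finset.sum_add_distrib, Finset.sum_add_distrib] at hsumint
  rw [hN, sum_range_node]
  -- Every element is met at exactly two nodes.
  have pair : ∀ g : ℕ → ℝ, g N + g 0 + (∑ k ∈ Finset.range N, g k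
      + ∑ k ∈ Finset.range N, g (k + 1)) = 2 * ∑ j ∈ Finset.range (N + 1), g j := by
    intro g
    have h1 := Finset.sum_range_succ g N
    have h2 := Finset.sum_range_succ' g N
    linarith
  have hEp := pair E
  have hep := pair e
  have hSE : 0 ≤ ∑ j ∈ Finset.range (N + 1), E j := Finset.sum_nonneg fun j _ => hE0 j
  have hSe : 0 ≤ ∑ j ∈ Finset.range (N + 1), e j := Finset.sum_nonneg fun j _ => he0 j
  have t1 : 2 * lam * E N + 2 * lam * E 0 + 2 * lam * (∑ k ∈ Finset.range N, E k
      + ∑ k ∈ Finset.range N, E (k + 1)) = 4 * lam * ∑ j ∈ Finset.range (N + 1), E j := by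
    linear_combination 2 * lam * hEp
  have t2 : c * (1 + 1 / lam) * (Θ * e N) + c * (1 + 1 / lam) * (Θ * e 0)
      + c * (1 + 1 / lam) * (Θ * (∑ k ∈ Finset.range N, e k + ∑ k ∈ Finset.range N, e (k + 1)))
      = 2 * c * (1 + 1 / lam) * (Θ * ∑ j ∈ Finset.range (N + 1), e j) := by
    linear_combination c * (1 + 1 / lam) * Θ * hep
  have t3 : 0 ≤ lam * ∑ j ∈ Finset.range (N + 1), E j := by positivity
  have t4 : 0 ≤ c * (1 + 1 / lam) * (Θ * ∑ j ∈ Finset.range (N + 1), e j) := by positivity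
  linarith

end Nodes

/-! ### The rate of change of the energy of the error -/

section Rate

variable {a b m K : ℝ} {μ D : ℝ → ℝ} (M : Mesh a b) (F : FluxParams)

/-- The equations of the scheme on the element `j` at a fixed time. -/
structure SchemeAt (μ D f : ℝ → ℝ) (q s : ℕ) (u v ut vt : ℕ → ℝ[X]) (j : ℕ) : Prop where
  disp : ∀ φ : ℝ[X], φ.natDegree ≤ q →
        ∫ y in (M.x j)..(M.x (j + 1)),
            moment D φ y * (derivative (derivative (ut j - v j))).eval y
          = (shear a b D φ (M.x (j + 1))
                * ((v j).eval (M.x (j + 1)) - vStar M F D u v (j + 1))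
              + moment D φ (M.x (j + 1))
                * (vxStar M F D u v (j + 1) - (derivative (v j)).eval (M.x (j + 1))))
            - (shear a b D φ (M.x j) * ((v j).eval (M.x j) - vStar M F D u v j)
              + moment D φ (M.x j)
                * (vxStar M F D u v j - (derivative (v j)).eval (M.x j)))
  vel : ∀ ψ : ℝ[X], ψ.natDegree ≤ s →
        ∫ y in (M.x j)..(M.x (j + 1)),
            (μ y * ψ.eval y * (vt j).eval y
              + D y * (derivative (derivative ψ)).eval y * (derivative (derivative (u j))).eval y)
          = (∫ y in (M.x j)..(M.x (j + 1)), ψ.eval y * f y)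
            + ((-(ψ.eval (M.x (j + 1))) * shearStar M F D u v (j + 1)
                + (derivative ψ).eval (M.x (j + 1)) * momentStar M F D u v (j + 1))
              - (-(ψ.eval (M.x j)) * shearStar M F D u v j
                + (derivative ψ).eval (M.x j) * momentStar M F D u v j))

/-- The polynomials `U, V` approximate `(u, v)` on the element `j`, with slope velocities `σ` at the
nodes and time derivatives `U'` of `U_xx` and `V'` of `V`. -/
structure ComparisonAt (D : ℝ → ℝ) (q s : ℕ) (u v : ℝ → ℝ) (U U' V V' : ℕ → ℝ[X]) (σ : ℕ → ℝ)
    (j : ℕ) : Prop where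
  U_deg : (U j).natDegree ≤ q
  V_deg : (V j).natDegree ≤ s
  U'_eq : ∀ φ : ℝ[X], φ.natDegree ≤ q →
    ∫ y in (M.x j)..(M.x (j + 1)), moment D φ y * ((U' j).eval y - dx a b 2 v y)
      = -(moment D φ (M.x (j + 1)) * (dx a b 1 v (M.x (j + 1)) - σ (j + 1))
        - moment D φ (M.x j) * (dx a b 1 v (M.x j) - σ j))
  U_orth : ∀ ψ : ℝ[X], ψ.natDegree ≤ s → ∫ y in (M.x j)..(M.x (j + 1)),
    moment D ψ y * ((derivative (derivative (U j))).eval y - dx a b 2 u y) = 0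
  V_orth : ∀ ψ : ℝ[X], ψ.natDegree ≤ s → ∫ y in (M.x j)..(M.x (j + 1)),
    D y * ψ.eval y * ((V j).eval y - v y) = 0

variable {M F}

/-- The two error equations are tested with the difference itself and added. By linearity of the
fluxes all end point terms assemble into `nodeTerm`, and of the volume terms only those containing
the projection errors of `v` and `v_t` are left. -/
theorem element_rate (h : CoeffBounds a b m K μ D) (hm : 0 < m) (hab : a < b) {q s : ℕ}
    {u v vt f : ℝ → ℝ} (hu : DerivChain a b 3 (fun i => dx a b i u))
    (hv : DerivChain a b 1 (fun i => dx a b i v)) (hvt : ContinuousOn vt (Icc a b))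
    (hpde : ∀ y ∈ Ioo a b, μ y * vt y = -dx a b 2 (fun z => D z * dx a b 2 u z) y + f y)
    {uh vh ut vht U U' V V' : ℕ → ℝ[X]} {σ : ℕ → ℝ} {j : ℕ} (hj : j < M.n)
    (huh : (uh j).natDegree ≤ q) (hvh : (vh j).natDegree ≤ s)
    (hS : SchemeAt M F μ D f q s uh vh ut vht j)
    (hC : ComparisonAt M D q s u v U U' V V' σ j) :
    (∫ y in (M.x j)..(M.x (j + 1)), moment D (U j - uh j) y
        * (U' j - derivative (derivative (ut j))).eval y)
      + ∫ y in (M.x j)..(M.x (j + 1)), μ y * (V j - vh j).eval y * (V' j - vht j).eval y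
      = -(∫ y in (M.x j)..(M.x (j + 1)),
          momentDeriv₂ a b D (derivative (derivative (U j - uh j))) y * ((V j).eval y - v y))
        + (∫ y in (M.x j)..(M.x (j + 1)), μ y * (V j - vh j).eval y * ((V' j).eval y - vt y))
        + (nodeTerm M F D (fun j => U j - uh j) (fun j => V j - vh j) U V
            (dx a b 1 (fun z => D z * dx a b 2 u z)) (fun z => D z * dx a b 2 u z) v σ j (j + 1)
          - nodeTerm M F D (fun j => U j - uh j) (fun j => V j - vh j) U V
            (dx a b 1 (fun z => D z * dx a b 2 u z)) (fun z => D z * dx a b 2 u z) v σ j j) := by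
  have hcd := (M.x_lt j hj).le
  have hs := M.Icc_subset hj
  set φ := U j - uh j with hφ
  set w := V j - vh j with hw
  have hφd : φ.natDegree ≤ q := (natDegree_sub_le _ _).trans (max_le hC.U_deg huh)
  have hwd : w.natDegree ≤ s := (natDegree_sub_le _ _).trans (max_le hC.V_deg hvh)
  have hv' := hv.mono hs
  have e1 := h.displacement_error hab hcd hs hv' φ (U' j) (ut j) (vh j) (hC.U'_eq φ hφd)
    (hS.disp φ hφd)
  have e2 := h.velocity_error hm hab hcd hs hu hvt hpde w (V' j) (vht j) (uh j) (hS.vel w hwd)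
  have e3 := h.green_moment hab hcd hs φ (derivChain_eval (M.x j) (M.x (j + 1)) 1 w)
  simp only [Function.iterate_zero, id_eq, Function.iterate_one,
    show (derivative^[2] w) = derivative (derivative w) from rfl] at e3
  have cv : ContinuousOn v (Icc (M.x j) (M.x (j + 1))) := by
    have := hv'.continuousOn (i := 0) (by omega)
    simpa only [dx_zero] using this
  have cu : ContinuousOn (dx a b 2 u) (Icc (M.x j) (M.x (j + 1))) :=
    (hu.mono hs).continuousOn (i := 2) (by omega)
  simp only [dx_zero] at e1
  have e4 : ∫ y in (M.x j)..(M.x (j + 1)), momentDeriv₂ a b D (derivative (derivative φ)) y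
        * (v y - (vh j).eval y)
      = (∫ y in (M.x j)..(M.x (j + 1)), momentDeriv₂ a b D (derivative (derivative φ)) y
          * w.eval y)
        - ∫ y in (M.x j)..(M.x (j + 1)), momentDeriv₂ a b D (derivative (derivative φ)) y
          * ((V j).eval y - v y) := by
    rw [← intervalIntegral.integral_sub
      (h.intervalIntegrable_momentDeriv₂ hcd hs _ w.continuous.continuousOn)
      (h.intervalIntegrable_momentDeriv₂ hcd hs _ (w := fun y => (V j).eval y - v y)
        ((V j).continuous.continuousOn.sub cv))]
    congr 1; funext y; rw [hw, eval_sub]; ring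
  -- Orthogonality of `U_xx - u_xx` turns the coupling `∫ D z_xx w_xx` of the first equation into
  -- the negative of the curvature term of the second, so that they cancel.
  have e5 : (∫ y in (M.x j)..(M.x (j + 1)), moment D φ y * (derivative (derivative w)).eval y)
      = -∫ y in (M.x j)..(M.x (j + 1)),
        moment D w y * ((derivative (derivative (uh j))).eval y - dx a b 2 u y) := by
    have e6 : ∫ y in (M.x j)..(M.x (j + 1)), moment D φ y * (derivative (derivative w)).eval y
      = (∫ y in (M.x j)..(M.x (j + 1)),
          moment D w y * ((derivative (derivative (U j))).eval y - dx a b 2 u y))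
        - ∫ y in (M.x j)..(M.x (j + 1)),
          moment D w y * ((derivative (derivative (uh j))).eval y - dx a b 2 u y) := by
      rw [← intervalIntegral.integral_sub
        (h.intervalIntegrable_moment hcd hs _
          (w := fun y => (derivative (derivative (U j))).eval y - dx a b 2 u y)
          ((derivative (derivative (U j))).continuous.continuousOn.sub cu))
        (h.intervalIntegrable_moment hcd hs _
          (w := fun y => (derivative (derivative (uh j))).eval y - dx a b 2 u y)
          ((derivative (derivative (uh j))).continuous.continuousOn.sub cu))]
      congr 1; funext y
      simp only [moment, hφ, derivative_sub, eval_sub]; ring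
    rw [e6, hC.U_orth w hwd]; ring
  have s1 := fun i hi => h.vStar_sub M F hab U uh V vh (i := i) hi
  have s2 := fun i hi => h.shearStar_sub M F hab U uh V vh (i := i) hi
  have s3 := vxStar_sub M F (D := D) U uh V vh
  have s4 := momentStar_sub M F (D := D) U uh V vh
  rw [e4, e3, e5] at e1
  rw [e1, e2]
  simp only [nodeTerm, bracket, s1 _ hj.le, s1 _ (Nat.succ_le_of_lt hj), s2 _ hj.le,
    s2 _ (Nat.succ_le_of_lt hj), s3, s4, ← hφ, ← hw]
  ring

/-- Collects the volume, inertia and node estimates over the mesh. The parameter `lam` stays free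
because it will be matched to the length of the time interval. -/
theorem exists_energy_rate_bound (q s : ℕ) (hs : s ≤ q) (hqs : q ≤ s + 4) (a b : ℝ) (hab : a < b)
    (σ m K : ℝ) (hm : 0 < m) (F : FluxParams) (hF : F.Admissible) :
    ∃ C : ℝ, 0 < C ∧ ∀ (μ D : ℝ → ℝ), CoeffBounds a b m K μ D → ∀ M : Mesh a b, M.Regular σ →
      ∀ Θ : ℝ, (Θ = 1 ∨ (F.Dissipative ∧ Θ = M.h)) → ∀ lam : ℝ, 0 < lam →
      ∀ u v vt f : ℝ → ℝ, DerivChain a b 3 (fun i => dx a b i u) →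
      DerivChain a b 1 (fun i => dx a b i v) → ContinuousOn vt (Icc a b) →
      (∀ y ∈ Ioo a b, μ y * vt y = -dx a b 2 (fun z => D z * dx a b 2 u z) y + f y) →
      ∀ (uh vh ut vht U U' V V' : ℕ → ℝ[X]) (sl : ℕ → ℝ),
      (∀ j < M.n, (uh j).natDegree ≤ q) → (∀ j < M.n, (vh j).natDegree ≤ s) →
      (∀ j < M.n, SchemeAt M F μ D f q s uh vh ut vht j) →
      (∀ j < M.n, ComparisonAt M D q s u v U U' V V' sl j) →
      -F.bc.a₁ * sl 0 + F.bc.b₁ * (D a * dx a b 2 u a) = 0 →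
      F.bc.a₂ * v a + F.bc.b₂ * dx a b 1 (fun z => D z * dx a b 2 u z) a = 0 →
      F.bc.a₁ * sl M.n + F.bc.b₁ * (D b * dx a b 2 u b) = 0 →
      F.bc.a₂ * v b - F.bc.b₂ * dx a b 1 (fun z => D z * dx a b 2 u z) b = 0 →
      ∀ e e' : ℕ → ℝ, (∀ j, 0 ≤ e j) →
      (∀ j < M.n, ∀ i, i = j ∨ i = j + 1 → TraceErr M.h (e j)
        (shear a b D (U j) (M.x i) - dx a b 1 (fun z => D z * dx a b 2 u z) (M.x i))
        (moment D (U j) (M.x i) - D (M.x i) * dx a b 2 u (M.x i))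
        ((V j).eval (M.x i) - v (M.x i)) ((derivative (V j)).eval (M.x i) - sl i)) →
      (∀ j < M.n, ∫ y in (M.x j)..(M.x (j + 1)), ((V j).eval y - v y) ^ 2 ≤ M.h ^ 4 * e j) →
      (∀ j < M.n, ∫ y in (M.x j)..(M.x (j + 1)), ((V' j).eval y - vt y) ^ 2 ≤ e' j) →
      ∑ j ∈ Finset.range M.n, ((∫ y in (M.x j)..(M.x (j + 1)), moment D (U j - uh j) y
          * (U' j - derivative (derivative (ut j))).eval y)
        + ∫ y in (M.x j)..(M.x (j + 1)), μ y * (V j - vh j).eval y * (V' j - vht j).eval y)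
      ≤ C * lam * (∑ j ∈ Finset.range M.n, ((∫ y in (M.x j)..(M.x (j + 1)),
            ((derivative (derivative (U j - uh j))).eval y) ^ 2)
          + ∫ y in (M.x j)..(M.x (j + 1)), ((V j - vh j).eval y) ^ 2))
        + C * (1 + 1 / lam) * (Θ * (∑ j ∈ Finset.range M.n, e j)
          + ∑ j ∈ Finset.range M.n, e' j) := by
  obtain ⟨I, hI, hinv⟩ := exists_inverse_ineq q
  set L := b - a with hLdef
  have hL0 : 0 < L := sub_pos.2 hab
  set Ct : ℝ := I * ((2 * L ^ 2 + 1) * K ^ 2 * |σ| + 2 * K ^ 2 * |σ| ^ 3 + |σ| + |σ| ^ 3) with hCt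
  have hCt0 : 0 ≤ Ct := by positivity
  set Cn := nodeConst F L with hCn
  have hCn0 : 0 < Cn := by
    have hΛ0 : 0 ≤ 1 + L ^ 2 := by positivity
    have p1 := fluxConst_pos hL0.le hΛ0 hF.β₁_nonneg
    have p2 := fluxConst_pos hL0.le hΛ0 hF.β₂_nonneg
    have p3 := fluxConst_pos hL0.le hΛ0 hF.τ₁_nonneg
    have p4 := fluxConst_pos hL0.le hΛ0 hF.τ₂_nonneg
    have p5 := fluxConst_pos hL0.le hΛ0 (abs_nonneg F.η₁)
    have p6 := fluxConst_pos hL0.le hΛ0 (abs_nonneg F.η₂)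
    rw [hCn, nodeConst]; positivity
  set Cv : ℝ := K ^ 2 * ((L ^ 2 + L) * (L ^ 2 + |σ| ^ 2)) with hCv
  have hCv0 : 0 ≤ Cv := by positivity
  refine ⟨1 + I + 8 * Ct + 4 * Cn + Cv + K ^ 2, by positivity, ?_⟩
  intro μ D h M hM Θ hΘ lam hlam u v vt f hu hv hvt hpde uh vh ut vht U U' V V' sl huh hvh hS hC
    ha₁ ha₂ hb₁ hb₂ e e' he0 he hδ hδ'
  have hh := M.h_pos hab
  have hhL := M.h_le hab
  have hΘ0 : 0 < Θ := by
    rcases hΘ with rfl | ⟨-, rfl⟩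
    · exact one_pos
    · exact hh
  -- The two summands serve the two values of `Θ`: `h² ≤ L²` and `h² ≤ L h`.
  have hh2 : M.h ^ 2 ≤ (L ^ 2 + L) * Θ := by
    rcases hΘ with rfl | ⟨-, rfl⟩
    · have := pow_le_pow_left₀ hh.le hhL 2
      linarith
    · have := mul_le_mul_of_nonneg_right hhL hh.le
      have := mul_pos (pow_pos hL0 2) hh
      nlinarith
  have hreg : ∀ j < M.n, M.h ≤ |σ| * (M.x (j + 1) - M.x j) := fun j hj =>
    (hM j hj).le.trans (mul_le_mul_of_nonneg_right (le_abs_self σ) (sub_pos.2 (M.x_lt j hj)).le)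
  set JZ : ℕ → ℝ := fun j => ∫ y in (M.x j)..(M.x (j + 1)),
    ((derivative (derivative (U j - uh j))).eval y) ^ 2 with hJZ
  set JV : ℕ → ℝ := fun j => ∫ y in (M.x j)..(M.x (j + 1)), ((V j - vh j).eval y) ^ 2 with hJV
  have hφd : ∀ j < M.n, (U j - uh j).natDegree ≤ q := fun j hj =>
    (natDegree_sub_le _ _).trans (max_le (hC j hj).U_deg (huh j hj))
  have hZd : ∀ j < M.n, (derivative (derivative (U j - uh j))).natDegree ≤ q - 2 := fun j hj => by
    have h1 := natDegree_derivative_le (U j - uh j)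
    have h2 := natDegree_derivative_le (derivative (U j - uh j))
    have := hφd j hj
    omega
  have hwd : ∀ j < M.n, (V j - vh j).natDegree ≤ s := fun j hj =>
    (natDegree_sub_le _ _).trans (max_le (hC j hj).V_deg (hvh j hj))
  have hJ0 : ∀ j < M.n, 0 ≤ JZ j ∧ 0 ≤ JV j := fun j hj =>
    ⟨intervalIntegral.integral_nonneg (M.x_lt j hj).le fun y _ => sq_nonneg _,
      intervalIntegral.integral_nonneg (M.x_lt j hj).le fun y _ => sq_nonneg _⟩
  -- The absolute values in `E` only ensure nonnegativity at indices outside the mesh; they are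
  -- removed for `j < M.n`.
  have hnode := sum_nodeTerm_le M F hab hF hΘ hlam (fun j => U j - uh j) (fun j => V j - vh j) U V
    (dx a b 1 (fun z => D z * dx a b 2 u z)) (fun z => D z * dx a b 2 u z) v sl ha₁ ha₂ hb₁ hb₂
    (e := e) (E := fun j => Ct * (|JZ j| + |JV j|)) he0
    (fun j => by positivity) he (fun j hj i hi => by
      have hcd := M.x_lt j hj
      have hy : M.x i ∈ Icc (M.x j) (M.x (j + 1)) := by
        rcases hi with rfl | rfl
        · exact left_mem_Icc.2 hcd.le
        · exact right_mem_Icc.2 hcd.le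
      rw [abs_of_nonneg (hJ0 j hj).1, abs_of_nonneg (hJ0 j hj).2]
      exact h.trace_le hm hab hcd (M.Icc_subset hj) (hreg j hj) hh hhL hy
        (hinv _ _ hcd _ ((hZd j hj).trans (Nat.sub_le _ _)) _ hy)
        (hinv _ _ hcd _ ((hwd j hj).trans hs) _ hy))
  have hterm : ∀ j ∈ Finset.range M.n,
      (∫ y in (M.x j)..(M.x (j + 1)), moment D (U j - uh j) y
          * (U' j - derivative (derivative (ut j))).eval y)
        + ∫ y in (M.x j)..(M.x (j + 1)), μ y * (V j - vh j).eval y * (V' j - vht j).eval y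
      ≤ lam * (1 + I) * (JZ j + JV j) + (Cv * (1 / lam) * (Θ * e j) + K ^ 2 * (1 / lam) * e' j)
        + (nodeTerm M F D (fun j => U j - uh j) (fun j => V j - vh j) U V
            (dx a b 1 (fun z => D z * dx a b 2 u z)) (fun z => D z * dx a b 2 u z) v sl j (j + 1)
          - nodeTerm M F D (fun j => U j - uh j) (fun j => V j - vh j) U V
            (dx a b 1 (fun z => D z * dx a b 2 u z)) (fun z => D z * dx a b 2 u z) v sl j j) := by
    intro j hj
    have hj := Finset.mem_range.1 hj
    have hcd := M.x_lt j hj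
    have hsub := M.Icc_subset hj
    have cv : ContinuousOn v (Icc (M.x j) (M.x (j + 1))) := by
      have := (hv.mono hsub).continuousOn (i := 0) (by omega)
      simpa only [dx_zero] using this
    rw [element_rate h hm hab hu hv hvt hpde hj (huh j hj) (hvh j hj) (hS j hj) (hC j hj)]
    have b1 := h.volume_error_le hcd hsub (r := q - 2) (by omega) hI (hZd j hj)
      (fun y hy => (hinv _ _ hcd _ ((hZd j hj).trans (Nat.sub_le _ _)) y hy).2) cv
      (hC j hj).V_orth hlam
    have b2 := h.inertia_error_le hm hcd.le hsub (V j - vh j) (V' j) (hvt.mono hsub) hlam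
    have hl : 0 < M.x (j + 1) - M.x j := sub_pos.2 hcd
    -- Of the available `h⁴`, one factor `h²` compensates the inverse square of the element length
    -- by mesh regularity, and the other is bounded by a multiple of `Θ`.
    have b3 : K ^ 2 / lam * (1 + 1 / (M.x (j + 1) - M.x j) ^ 2)
        * (∫ y in (M.x j)..(M.x (j + 1)), ((V j).eval y - v y) ^ 2)
        ≤ Cv * (1 / lam) * (Θ * e j) := by
      have i1 : M.h ^ 2 * (1 / (M.x (j + 1) - M.x j) ^ 2) ≤ |σ| ^ 2 := by
        rw [mul_one_div, div_le_iff₀ (by positivity), ← mul_pow]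
        exact pow_le_pow_left₀ hh.le (hreg j hj) 2
      have i2 : (1 + 1 / (M.x (j + 1) - M.x j) ^ 2) * M.h ^ 4
          ≤ (L ^ 2 + L) * (L ^ 2 + |σ| ^ 2) * Θ := by
        have i3 := pow_le_pow_left₀ hh.le hhL 2
        calc (1 + 1 / (M.x (j + 1) - M.x j) ^ 2) * M.h ^ 4
            = M.h ^ 2 * (M.h ^ 2 + M.h ^ 2 * (1 / (M.x (j + 1) - M.x j) ^ 2)) := by ring
          _ ≤ ((L ^ 2 + L) * Θ) * (L ^ 2 + |σ| ^ 2) := by gcongr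
          _ = _ := by ring
      calc _ ≤ K ^ 2 / lam * (1 + 1 / (M.x (j + 1) - M.x j) ^ 2) * (M.h ^ 4 * e j) :=
            mul_le_mul_of_nonneg_left (hδ j hj) (by positivity)
        _ = K ^ 2 / lam * e j * ((1 + 1 / (M.x (j + 1) - M.x j) ^ 2) * M.h ^ 4) := by ring
        _ ≤ K ^ 2 / lam * e j * ((L ^ 2 + L) * (L ^ 2 + |σ| ^ 2) * Θ) :=
            mul_le_mul_of_nonneg_left i2 (mul_nonneg (by positivity) (he0 j))
        _ = _ := by rw [hCv]; ring
    have b4 : K ^ 2 / lam * (∫ y in (M.x j)..(M.x (j + 1)), ((V' j).eval y - vt y) ^ 2)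
        ≤ K ^ 2 * (1 / lam) * e' j := by
      rw [div_eq_mul_one_div]
      exact mul_le_mul_of_nonneg_left (hδ' j hj) (by positivity)
    have p1 : 0 ≤ lam * I * JV j := mul_nonneg (by positivity) (hJ0 j hj).2
    have b1' : -(∫ y in (M.x j)..(M.x (j + 1)),
          momentDeriv₂ a b D (derivative (derivative (U j - uh j))) y * ((V j).eval y - v y))
        ≤ lam * (1 + I) * JZ j + K ^ 2 / lam * (1 + 1 / (M.x (j + 1) - M.x j) ^ 2)
        * (∫ y in (M.x j)..(M.x (j + 1)), ((V j).eval y - v y) ^ 2) := b1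
    have b2' : (∫ y in (M.x j)..(M.x (j + 1)), μ y * (V j - vh j).eval y * ((V' j).eval y - vt y))
        ≤ lam * JV j + K ^ 2 / lam * (∫ y in (M.x j)..(M.x (j + 1)), ((V' j).eval y - vt y) ^ 2) :=
      b2
    linarith
  have hsum := (Finset.sum_le_sum hterm).trans_eq (Finset.sum_add_distrib.trans
    (congrArg (· + _) Finset.sum_add_distrib))
  have hsplit : ∑ j ∈ Finset.range M.n, (Cv * (1 / lam) * (Θ * e j) + K ^ 2 * (1 / lam) * e' j)
      = Cv * (1 / lam) * (Θ * ∑ j ∈ Finset.range M.n, e j)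
        + K ^ 2 * (1 / lam) * ∑ j ∈ Finset.range M.n, e' j := by
    rw [Finset.sum_add_distrib, Finset.mul_sum, Finset.mul_sum, Finset.mul_sum]
  rw [hsplit, ← Finset.mul_sum] at hsum
  have hEeq : ∑ j ∈ Finset.range M.n, Ct * (|JZ j| + |JV j|)
      = Ct * ∑ j ∈ Finset.range M.n, (JZ j + JV j) := by
    rw [Finset.mul_sum]
    refine Finset.sum_congr rfl fun j hj => ?_
    have hj := Finset.mem_range.1 hj
    rw [abs_of_nonneg (hJ0 j hj).1, abs_of_nonneg (hJ0 j hj).2]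
  rw [hEeq] at hnode
  set SJ := ∑ j ∈ Finset.range M.n, (JZ j + JV j) with hSJ
  set Se := ∑ j ∈ Finset.range M.n, e j with hSe
  set Se' := ∑ j ∈ Finset.range M.n, e' j with hSe'
  have q1 : 0 ≤ SJ := Finset.sum_nonneg fun j hj =>
    add_nonneg (hJ0 j (Finset.mem_range.1 hj)).1 (hJ0 j (Finset.mem_range.1 hj)).2
  have q2 : 0 ≤ Se := Finset.sum_nonneg fun j _ => he0 j
  have q3 : 0 ≤ Se' := Finset.sum_nonneg fun j hj =>
    (intervalIntegral.integral_nonneg (M.x_lt j (Finset.mem_range.1 hj)).le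
      fun y _ => sq_nonneg _).trans (hδ' j (Finset.mem_range.1 hj))
  have hΘe : 0 ≤ Θ * Se := by positivity
  have hil : 0 < 1 / lam := by positivity
  have f1 : lam * (1 + I) * SJ + 8 * lam * (Ct * SJ)
      ≤ (1 + I + 8 * Ct + 4 * Cn + Cv + K ^ 2) * lam * SJ := by
    have : 0 ≤ (4 * Cn + Cv + K ^ 2) * lam * SJ := by positivity
    linarith
  have f2 : Cv * (1 / lam) * (Θ * Se) + K ^ 2 * (1 / lam) * Se'
      + 4 * Cn * (1 + 1 / lam) * (Θ * Se)
      ≤ (1 + I + 8 * Ct + 4 * Cn + Cv + K ^ 2) * (1 + 1 / lam) * (Θ * Se + Se') := by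
    have r1 : 0 ≤ (1 + I + 8 * Ct) * (1 + 1 / lam) * (Θ * Se + Se') := by positivity
    have r2 : 0 ≤ Cv * (Θ * Se) + Cv * (1 + 1 / lam) * Se' := by positivity
    have r3 : 0 ≤ K ^ 2 * Se' + K ^ 2 * (1 + 1 / lam) * (Θ * Se) := by positivity
    have r4 : 0 ≤ 4 * Cn * (1 + 1 / lam) * Se' := by positivity
    linarith
  linarith

end Rate

/-! ### Comparison functions -/

section Smooth

variable {a b T : ℝ}

theorem SpatiallySmooth.chain (hab : a < b) {k : ℕ} {w : ℝ → ℝ → ℝ}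
    (h : SpatiallySmooth a b T (k + 1) w) {t : ℝ} (ht : t ∈ Icc 0 T) :
    DerivChain a b k (fun i => dx a b i (w t)) :=
  derivChain_dx hab (h.1 t ht)

theorem SpatiallySmooth.continuousOn {k : ℕ} {w : ℝ → ℝ → ℝ} (h : SpatiallySmooth a b T k w)
    {i : ℕ} (hi : i ≤ k) {t : ℝ} (ht : t ∈ Icc 0 T) : ContinuousOn (dx a b i (w t)) (Icc a b) := by
  have : ContinuousOn (fun y : ℝ => (t, y)) (Icc a b) := by fun_prop
  exact (h.2 i hi).comp this fun y hy => ⟨ht, hy⟩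

/-- The spatial derivatives of a function with smooth time derivative. -/
theorem SpatiallySmooth.hasDerivWithinAt_dx (hab : a < b) {k : ℕ} {w w' : ℝ → ℝ → ℝ}
    (h : SpatiallySmooth a b T (k + 1) w) (h' : SpatiallySmooth a b T (k + 1) w')
    (hw : ∀ t ∈ Icc 0 T, ∀ y ∈ Icc a b, HasDerivWithinAt (fun r => w r y) (w' t y) (Icc 0 T) t)
    {i : ℕ} (hi : i ≤ k + 1) :
    ∀ t ∈ Icc 0 T, ∀ y ∈ Icc a b,
      HasDerivWithinAt (fun r => dx a b i (w r) y) (dx a b i (w' t) y) (Icc 0 T) t := by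
  induction i with
  | zero => simpa only [dx_zero] using hw
  | succ i ih =>
    exact fun t ht y hy => hasDerivWithinAt_swap hab (ih (by omega))
      (fun t ht => (h.chain hab ht).deriv i (by omega))
      (fun t ht => (h'.chain hab ht).deriv i (by omega)) (h'.2 (i + 1) hi) ht hy

theorem SpatiallySmooth.of_le {k l : ℕ} {w : ℝ → ℝ → ℝ} (h : SpatiallySmooth a b T k w)
    (hl : l ≤ k) : SpatiallySmooth a b T l w :=
  ⟨fun t ht => (h.1 t ht).of_le (by exact_mod_cast hl), fun i hi => h.2 i (hi.trans hl)⟩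

end Smooth

/-! ### Projections of time dependent functions and slopes at the nodes -/

open Classical in
/-- The functional `p ↦ ∫ ρ p`, or zero if `ρ` is not integrable. -/
noncomputable def weightFun (ρ : ℝ → ℝ) (c d : ℝ) : ℝ[X] →ₗ[ℝ] ℝ :=
  if h : IntervalIntegrable ρ volume c d then weightInt ρ c d h else 0

theorem weightFun_apply {ρ : ℝ → ℝ} {c d : ℝ} (h : IntervalIntegrable ρ volume c d) (p : ℝ[X]) :
    weightFun ρ c d p = ∫ y in c..d, ρ y * p.eval y := by
  rw [weightFun, dif_pos h, weightInt_apply]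

/-- Weighted projections, perturbed by boundary terms, of a time dependent function. -/
theorem CoeffBounds.exists_projection_family {a b m K T : ℝ} {μ D : ℝ → ℝ}
    (h : CoeffBounds a b m K μ D) (hm : 0 < m) {c d : ℝ} (hcd : c < d) (hs : Icc c d ⊆ Icc a b)
    (r : ℕ) {w w' : ℝ → ℝ → ℝ}
    (hw : ∀ t ∈ Icc 0 T, ∀ y ∈ Icc a b, HasDerivWithinAt (fun r => w r y) (w' t y) (Icc 0 T) t)
    (hc : ContinuousOn (fun z : ℝ × ℝ => w' z.1 z.2) (Icc 0 T ×ˢ Icc a b))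
    (hwc : ∀ t ∈ Icc 0 T, ContinuousOn (w t) (Icc a b)) {κc κc' κd κd' : ℝ → ℝ}
    (hκc : ∀ t ∈ Icc 0 T, HasDerivWithinAt κc (κc' t) (Icc 0 T) t)
    (hκd : ∀ t ∈ Icc 0 T, HasDerivWithinAt κd (κd' t) (Icc 0 T) t) :
    ∃ P P' : ℝ → ℝ[X], (∀ t, (P t).natDegree ≤ r) ∧ (∀ t, (P' t).natDegree ≤ r) ∧
      (∀ t ∈ Icc 0 T, ∀ k,
        HasDerivWithinAt (fun x => (P x).coeff k) ((P' t).coeff k) (Icc 0 T) t) ∧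
      (∀ t ∈ Icc 0 T, ∀ φ : ℝ[X], φ.natDegree ≤ r →
        ∫ y in c..d, D y * φ.eval y * ((P t).eval y - w t y)
          = -(D d * φ.eval d * κd t - D c * φ.eval c * κc t)) ∧
      ∀ t ∈ Icc 0 T, ∀ φ : ℝ[X], φ.natDegree ≤ r →
        ∫ y in c..d, D y * φ.eval y * ((P' t).eval y - w' t y)
          = -(D d * φ.eval d * κd' t - D c * φ.eval c * κc' t) := by
  have hw'c : ∀ t ∈ Icc 0 T, ContinuousOn (w' t) (Icc a b) := fun t ht => by
    have : ContinuousOn (fun y : ℝ => (t, y)) (Icc a b) := by fun_prop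
    exact hc.comp this fun y hy => ⟨ht, hy⟩
  have cD := h.continuousOn.mono hs
  have hDw : ∀ {g : ℝ → ℝ}, ContinuousOn g (Icc a b) →
      IntervalIntegrable (fun y => D y * g y) volume c d := fun hg =>
    intervalIntegrable_of_Icc hcd.le (cD.mul (hg.mono hs))
  -- The boundary perturbation is put into the functional, so a perturbed projection is again a
  -- representer and `exists_polynomial_family` applies.
  let ℓ : (ℝ → ℝ) → ℝ → ℝ → ℝ[X] →ₗ[ℝ] ℝ := fun g x y =>
    weightFun (fun z => D z * g z) c d - (D d * y) • leval d + (D c * x) • leval c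
  have hℓ : ∀ {g : ℝ → ℝ}, ContinuousOn g (Icc a b) → ∀ x y φ, ℓ g x y φ
      = (∫ z in c..d, D z * φ.eval z * g z) - D d * φ.eval d * y + D c * φ.eval c * x := by
    intro g hg x y φ
    simp only [ℓ, LinearMap.add_apply, LinearMap.sub_apply, LinearMap.smul_apply, smul_eq_mul,
      leval_apply, weightFun_apply (hDw hg)]
    rw [show (fun z => D z * g z * φ.eval z) = fun z => D z * φ.eval z * g z by funext z; ring]
    ring
  have hdiff : ∀ {g : ℝ → ℝ}, ContinuousOn g (Icc a b) → ∀ (p φ : ℝ[X]) (x y : ℝ),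
      ∫ z in c..d, D z * φ.eval z * p.eval z = ℓ g x y φ →
      ∫ z in c..d, D z * φ.eval z * (p.eval z - g z)
        = -(D d * φ.eval d * y - D c * φ.eval c * x) := by
    intro g hg p φ x y hp
    rw [hℓ hg] at hp
    have e : ∫ z in c..d, D z * φ.eval z * (p.eval z - g z)
      = (∫ z in c..d, D z * φ.eval z * p.eval z) - ∫ z in c..d, D z * φ.eval z * g z := by
      rw [← intervalIntegral.integral_sub
        (intervalIntegrable_of_Icc hcd.le (f := fun z => D z * φ.eval z * p.eval z)
          ((cD.mul φ.continuous.continuousOn).mul p.continuous.continuousOn))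
        (intervalIntegrable_of_Icc hcd.le (f := fun z => D z * φ.eval z * g z)
          ((cD.mul φ.continuous.continuousOn).mul (hg.mono hs)))]
      congr 1; funext z; ring
    rw [e, hp]; ring
  obtain ⟨P, P', h1, h2, h3, h4, h5⟩ := exists_polynomial_family (S := Icc 0 T) hcd hm cD
    (fun y hy => (h.D_bounds y (hs hy)).1) r (fun t => ℓ (w t) (κc t) (κd t))
    (fun t => ℓ (w' t) (κc' t) (κd' t)) (by
      intro t ht φ
      have hρ : IntervalIntegrable (fun z => D z * φ.eval z) volume c d :=
        intervalIntegrable_of_Icc hcd.le (cD.mul φ.continuous.continuousOn)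
      have := ((hasDerivWithinAt_integral_mul hw hc hwc hcd.le hs hρ ht).sub
        ((hκd t ht).const_mul (D d * φ.eval d))).add ((hκc t ht).const_mul (D c * φ.eval c))
      rw [hℓ (hw'c t ht)]
      exact this.congr (fun x hx => hℓ (hwc x hx) _ _ φ) (hℓ (hwc t ht) _ _ φ))
  exact ⟨P, P', h1, h2, h3, fun t ht φ hφ => hdiff (hwc t ht) _ _ _ _ (h4 t φ hφ),
    fun t ht φ hφ => hdiff (hw'c t ht) _ _ _ _ (h5 t φ hφ)⟩

/-- The part of the `H^{k}` seminorm of `w` on the element `j`. -/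
noncomputable def elementData {a b : ℝ} (M : Mesh a b) (k : ℕ) (w : ℝ → ℝ) (j : ℕ) : ℝ :=
  |∫ y in (M.x j)..(M.x (j + 1)), dx a b k w y ^ 2|

theorem elementData_nonneg {a b : ℝ} (M : Mesh a b) (k : ℕ) (w : ℝ → ℝ) (j : ℕ) :
    0 ≤ elementData M k w j := abs_nonneg _

theorem elementData_eq {a b : ℝ} (M : Mesh a b) (k : ℕ) (w : ℝ → ℝ) {j : ℕ} (hj : j < M.n) :
    elementData M k w j = ∫ y in (M.x j)..(M.x (j + 1)), dx a b k w y ^ 2 :=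
  abs_of_nonneg (intervalIntegral.integral_nonneg (M.x_lt j hj).le fun _ _ => sq_nonneg _)

/-- Differentiable slopes at a node, which agree with the exact ones for smooth velocities and where
the slope is prescribed, and which are stable otherwise. -/
theorem exists_slope_bound (q s : ℕ) (hq : 3 ≤ q) (a b σ m K : ℝ) (hab : a < b) (hm : 0 < m) :
    ∃ C : ℝ, 0 < C ∧ ∀ (μ D : ℝ → ℝ), CoeffBounds a b m K μ D →
      ∀ (T : ℝ) (f u v vt : ℝ → ℝ → ℝ) (bc : BoundaryType),
      IsSmoothSolution a b T μ D f bc q s u v vt →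
      ∀ M : Mesh a b, M.Regular σ → ∀ i ≤ M.n, ∀ j < M.n, (i = j ∨ i = j + 1) →
      ∃ sl sl' : ℝ → ℝ, (∀ t ∈ Icc 0 T, HasDerivWithinAt sl (sl' t) (Icc 0 T) t) ∧
        (1 ≤ s → ∀ t ∈ Icc 0 T, sl t = dx a b 1 (u t) (M.x i) ∧ sl' t = dx a b 1 (v t) (M.x i)) ∧
        (i = 0 → ∀ t ∈ Icc 0 T, -bc.a₁ * sl' t + bc.b₁ * (D a * dx a b 2 (u t) a) = 0) ∧
        (i = M.n → ∀ t ∈ Icc 0 T, bc.a₁ * sl' t + bc.b₁ * (D b * dx a b 2 (u t) b) = 0) ∧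
        (∀ t ∈ Icc 0 T, M.h ^ 3 * (dx a b 1 (u t) (M.x i) - sl t) ^ 2
          ≤ C * (M.h ^ (2 * q + 2) * elementData M (q + 1) (u t) j)) ∧
        (s = 0 → ∀ t ∈ Icc 0 T, M.h ^ 3 * sl' t ^ 2
          ≤ C * (M.h ^ 2 * elementData M (s + 1) (v t) j)) := by
  obtain ⟨C₁, hC₁, hb₁⟩ := exists_projection_bound q q le_rfl m K hm
  obtain ⟨C₂, hC₂, hb₂⟩ := exists_projection_bound q 0 (Nat.zero_le _) m K hm
  refine ⟨(|σ| ^ 3 + 1) * (C₁ + C₂), by positivity, ?_⟩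
  intro μ D h T f u v vt bc sol M hM i hi j hj hij
  have hcd := M.x_lt j hj
  have hsub := M.Icc_subset hj
  have hl : 0 < M.x (j + 1) - M.x j := sub_pos.2 hcd
  have hh := M.h_pos hab
  have hlh := M.length_le_h hj
  have hhl : M.h ≤ |σ| * (M.x (j + 1) - M.x j) :=
    (hM j hj).le.trans (mul_le_mul_of_nonneg_right (le_abs_self σ) hl.le)
  have hy : M.x i ∈ Icc (M.x j) (M.x (j + 1)) := by
    rcases hij with rfl | rfl
    · exact left_mem_Icc.2 hcd.le
    · exact right_mem_Icc.2 hcd.le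
  have scale : ∀ {c x A : ℝ} {k : ℕ}, 0 ≤ c → 0 ≤ A → c ≤ C₁ + C₂ →
      (M.x (j + 1) - M.x j) ^ 3 * x ^ 2 ≤ c * ((M.x (j + 1) - M.x j) ^ k * A) →
      M.h ^ 3 * x ^ 2 ≤ (|σ| ^ 3 + 1) * (C₁ + C₂) * (M.h ^ k * A) := by
    intro c x A k hc0 hA hc hx
    calc M.h ^ 3 * x ^ 2 ≤ (|σ| * (M.x (j + 1) - M.x j)) ^ 3 * x ^ 2 :=
          mul_le_mul_of_nonneg_right (pow_le_pow_left₀ hh.le hhl 3) (sq_nonneg x)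
      _ = |σ| ^ 3 * ((M.x (j + 1) - M.x j) ^ 3 * x ^ 2) := by ring
      _ ≤ |σ| ^ 3 * (c * ((M.x (j + 1) - M.x j) ^ k * A)) := by gcongr
      _ ≤ (|σ| ^ 3 + 1) * ((C₁ + C₂) * (M.h ^ k * A)) := by
          gcongr
          linarith
      _ = _ := by ring
  have su := sol.u_smooth
  have sv : SpatiallySmooth a b T (1 + 1) v := sol.v_smooth.of_le (le_max_right _ _)
  have hux := SpatiallySmooth.hasDerivWithinAt_dx (i := 1) hab (k := 1) (su.of_le (by omega)) sv
    sol.u_t (by omega)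
  have hxab := M.x_mem hi
  have rhs0 : ∀ {k l : ℕ} (w : ℝ → ℝ), 0 ≤ (|σ| ^ 3 + 1) * (C₁ + C₂)
      * (M.h ^ k * elementData M l w j) := fun w =>
    mul_nonneg (by positivity) (mul_nonneg (pow_nonneg hh.le _) (elementData_nonneg M _ w j))
  -- The exact slope is kept whenever possible. Otherwise `s = 0`, and the last bound has only
  -- `|v|_{H¹}` on its right-hand side, which does not control a trace of `v_x`.
  by_cases hex : 1 ≤ s ∨ (bc.a₁ = 1 ∧ (i = 0 ∨ i = M.n))
  · refine ⟨fun t => dx a b 1 (u t) (M.x i), fun t => dx a b 1 (v t) (M.x i),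
      fun t ht => hux t ht _ hxab, fun _ t _ => ⟨rfl, rfl⟩, ?_, ?_, ?_, ?_⟩
    · rintro rfl t ht
      rw [M.x_zero]; exact sol.bc_left₁ t ht
    · rintro rfl t ht
      rw [M.x_last]; exact sol.bc_right₁ t ht
    · intro t _
      rw [sub_self]
      simpa using rhs0 (k := 2 * q + 2) (l := q + 1) (u t)
    · intro hs0 t ht
      -- Where the boundary condition prescribes the slope it prescribes zero, so the stability
      -- bound is trivial.
      have hz : dx a b 1 (v t) (M.x i) = 0 := by
        rcases hex with h1 | ⟨ha, hi0⟩
        · omega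
        · have hbc : bc.b₁ = 0 := by
            cases bc <;> simp [BoundaryType.a₁] at ha <;> rfl
          have l1 := sol.bc_left₁ t ht
          have r1 := sol.bc_right₁ t ht
          rw [ha, hbc] at l1 r1
          rcases hi0 with rfl | rfl
          · rw [M.x_zero]; linarith
          · rw [M.x_last]; linarith
      beta_reduce
      rw [hz]
      simpa using rhs0 (k := 2) (l := s + 1) (v t)
  · push Not at hex
    have hs0 : s = 0 := by omega
    have cu : ∀ t ∈ Icc 0 T, ContinuousOn (u t) (Icc a b) := fun t ht => by
      have := su.continuousOn (Nat.zero_le _) ht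
      rwa [dx_zero] at this
    have cv : ContinuousOn (fun z : ℝ × ℝ => v z.1 z.2) (Icc 0 T ×ˢ Icc a b) := by
      have := sv.2 0 (Nat.zero_le _)
      simpa only [dx_zero] using this
    -- The slope is taken from the degree `q` projection of `u`. It approximates `u_x` to full
    -- order, and its time derivative is the slope of the projection of `v`.
    obtain ⟨P, P', hP, hP', hPt, hPo, hPo'⟩ := h.exists_projection_family hm hcd hsub q sol.u_t cv cu
      (κc := fun _ => 0) (κd := fun _ => 0) (κc' := fun _ => 0) (κd' := fun _ => 0)
      (fun t _ => hasDerivWithinAt_const _ _ _) (fun t _ => hasDerivWithinAt_const _ _ _)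
    have hev : ∀ p : ℝ[X], p.natDegree ≤ q → (derivative p).eval (M.x i)
        = ∑ k ∈ Finset.range (q + 1), p.coeff k * (k * M.x i ^ (k - 1)) := by
      intro p hp
      rw [derivative_eval, sum_over_range' p (fun n => by simp) (q + 1) (Nat.lt_succ_of_le hp)]
      exact Finset.sum_congr rfl fun k _ => mul_assoc _ _ _
    refine ⟨fun t => (derivative (P t)).eval (M.x i), fun t => (derivative (P' t)).eval (M.x i),
      fun t ht => ?_, fun h1 => absurd h1 (by omega), ?_, ?_, ?_, ?_⟩
    · simp only [hev _ (hP _), hev _ (hP' _)]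
      exact HasDerivWithinAt.fun_sum fun k _ => (hPt t ht k).mul_const _
    · intro hi0 t ht
      have ha : bc.a₁ = 0 := by
        have := fun ha => hex.2 ha
        cases bc <;> simp [BoundaryType.a₁, hi0] at this ⊢
      have := sol.bc_left₁ t ht
      rw [ha] at this ⊢
      linarith
    · intro hin t ht
      have ha : bc.a₁ = 0 := by
        have := fun ha => hex.2 ha
        cases bc <;> simp [BoundaryType.a₁, hin] at this ⊢
      have := sol.bc_right₁ t ht
      rw [ha] at this ⊢
      linarith
    · intro t ht
      have hb := ((hb₁ _ _ hcd D (h.continuousOn.mono hsub) (fun y hy => h.D_bounds y (hsub hy))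
        (fun i => dx a b i (u t)) ((su.chain hab ht).mono hsub) (P t) (hP t) 0 0
        (fun φ hφ => by rw [dx_zero]; exact hPo t ht φ hφ) _ le_rfl
        (by simpa using mul_nonneg hl.le (mul_nonneg (pow_nonneg hl.le _)
          (intervalIntegral.integral_nonneg hcd.le fun y _ => sq_nonneg _)))
        (by simpa using mul_nonneg hl.le (mul_nonneg (pow_nonneg hl.le _)
          (intervalIntegral.integral_nonneg hcd.le fun y _ => sq_nonneg _)))).2 _ hy).2.1 (by omega)
      rw [← elementData_eq M _ _ hj] at hb
      rw [← neg_sq, neg_sub]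
      exact scale hC₁.le (elementData_nonneg M _ _ j) (by linarith) hb
    -- Stability of the slope is the projection bound of Taylor order `0`, in which the slope of the
    -- polynomial itself is estimated.
    · intro _ t ht
      have sv0 : SpatiallySmooth a b T (0 + 1) v := sv.of_le (by omega)
      have hb := ((hb₂ _ _ hcd D (h.continuousOn.mono hsub) (fun y hy => h.D_bounds y (hsub hy))
        (fun i => dx a b i (v t)) ((sv0.chain hab ht).mono hsub) (P' t) (hP' t) 0 0
        (fun φ hφ => by rw [dx_zero]; exact hPo' t ht φ hφ) _ le_rfl
        (by simpa using mul_nonneg hl.le (mul_nonneg (pow_nonneg hl.le _)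
          (intervalIntegral.integral_nonneg hcd.le fun y _ => sq_nonneg _)))
        (by simpa using mul_nonneg hl.le (mul_nonneg (pow_nonneg hl.le _)
          (intervalIntegral.integral_nonneg hcd.le fun y _ => sq_nonneg _)))).2 _ hy).2.2 rfl
      rw [← elementData_eq M _ _ hj] at hb
      subst hs0
      exact scale hC₂.le (elementData_nonneg M _ _ j) (by linarith) hb

/-! ### Error bounds for the comparison functions -/

/-- The projection estimate on the elements of a regular mesh. -/
theorem exists_mesh_projection_bound (r k : ℕ) (hk : k ≤ r) (a b σ m K : ℝ) (hab : a < b)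
    (hm : 0 < m) :
    ∃ C : ℝ, 0 < C ∧ ∀ (μ D : ℝ → ℝ), CoeffBounds a b m K μ D → ∀ M : Mesh a b, M.Regular σ →
      ∀ j < M.n, ∀ g : ℕ → ℝ → ℝ, DerivChain a b k g → ∀ p : ℝ[X], p.natDegree ≤ r →
      ∀ κc κd : ℝ,
      (∀ φ : ℝ[X], φ.natDegree ≤ r →
        ∫ y in (M.x j)..(M.x (j + 1)), D y * φ.eval y * (p.eval y - g 0 y)
          = -(D (M.x (j + 1)) * φ.eval (M.x (j + 1)) * κd - D (M.x j) * φ.eval (M.x j) * κc)) →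
      ∀ R : ℝ, M.h ^ (2 * k + 2) * ∫ y in (M.x j)..(M.x (j + 1)), g (k + 1) y ^ 2 ≤ R →
        κc ^ 2 ≤ M.h * R → κd ^ 2 ≤ M.h * R →
      (∫ y in (M.x j)..(M.x (j + 1)), (p.eval y - g 0 y) ^ 2 ≤ C * R) ∧
        ∀ y ∈ Icc (M.x j) (M.x (j + 1)),
        M.h * (p.eval y - g 0 y) ^ 2 ≤ C * R ∧
        (1 ≤ k → M.h ^ 3 * ((derivative p).eval y - g 1 y) ^ 2 ≤ C * R) := by
  obtain ⟨C₀, hC₀, hb⟩ := exists_projection_bound r k hk m K hm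
  set S : ℝ := 1 + |σ| with hS
  have hS1 : 1 ≤ S := le_add_of_nonneg_right (abs_nonneg σ)
  have hS0 : 0 ≤ S := by linarith
  refine ⟨C₀ * S * S ^ 3, by positivity, ?_⟩
  intro μ D h M hM j hj g hg p hp κc κd horth R hR hκc hκd
  have hcd := M.x_lt j hj
  have hsub := M.Icc_subset hj
  have hl : 0 < M.x (j + 1) - M.x j := sub_pos.2 hcd
  have hh := M.h_pos hab
  have hlh := M.length_le_h hj
  have hhl : M.h ≤ S * (M.x (j + 1) - M.x j) :=
    (hM j hj).le.trans (mul_le_mul_of_nonneg_right ((le_abs_self σ).trans (by linarith)) hl.le)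
  have hA0 : 0 ≤ ∫ y in (M.x j)..(M.x (j + 1)), g (k + 1) y ^ 2 :=
    intervalIntegral.integral_nonneg hcd.le fun _ _ => sq_nonneg _
  have hR0 : 0 ≤ R := le_trans (by positivity) hR
  have hRS : R ≤ S * R := le_mul_of_one_le_left hR0 hS1
  have hκ : M.h * R ≤ (M.x (j + 1) - M.x j) * (S * R) := by
    calc _ ≤ (S * (M.x (j + 1) - M.x j)) * R := mul_le_mul_of_nonneg_right hhl hR0
      _ = _ := by ring
  obtain ⟨h1, h2⟩ := hb _ _ hcd D (h.continuousOn.mono hsub) (fun y hy => h.D_bounds y (hsub hy)) g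
    (hg.mono hsub) p hp κc κd horth (S * R)
    ((mul_le_mul_of_nonneg_right (pow_le_pow_left₀ hl.le hlh _) hA0).trans (hR.trans hRS))
    (hκc.trans hκ) (hκd.trans hκ)
  have hS3 : 1 ≤ S ^ 3 := one_le_pow₀ hS1
  refine ⟨h1.trans ?_, fun y hy => ⟨?_, fun hk1 => ?_⟩⟩
  · calc C₀ * (S * R) = C₀ * S * 1 * R := by ring
      _ ≤ C₀ * S * S ^ 3 * R := by gcongr
  · calc M.h * (p.eval y - g 0 y) ^ 2
        ≤ (S * (M.x (j + 1) - M.x j)) * (p.eval y - g 0 y) ^ 2 :=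
          mul_le_mul_of_nonneg_right hhl (sq_nonneg _)
      _ = S * ((M.x (j + 1) - M.x j) * (p.eval y - g 0 y) ^ 2) := by ring
      _ ≤ S ^ 3 * (C₀ * (S * R)) := by
          have := (h2 y hy).1
          have hSS : S ≤ S ^ 3 := le_self_pow₀ hS1 (by omega)
          gcongr
      _ = _ := by ring
  · calc M.h ^ 3 * ((derivative p).eval y - g 1 y) ^ 2
        ≤ (S * (M.x (j + 1) - M.x j)) ^ 3 * ((derivative p).eval y - g 1 y) ^ 2 :=
          mul_le_mul_of_nonneg_right (pow_le_pow_left₀ hh.le hhl 3) (sq_nonneg _)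
      _ = S ^ 3 * ((M.x (j + 1) - M.x j) ^ 3 * ((derivative p).eval y - g 1 y) ^ 2) := by ring
      _ ≤ S ^ 3 * (C₀ * (S * R)) := by
          have := (h2 y hy).2.1 hk1
          gcongr
      _ = _ := by ring

theorem natDegree_derivative_two_le {q : ℕ} {φ : ℝ[X]} (h : φ.natDegree ≤ q) :
    (derivative (derivative φ)).natDegree ≤ q - 2 := by
  have h1 := natDegree_derivative_le φ
  have h2 := natDegree_derivative_le (derivative φ)
  omega

theorem CoeffBounds.nonneg {a b m K : ℝ} {μ D : ℝ → ℝ} (h : CoeffBounds a b m K μ D) (hab : a < b) :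
    0 ≤ K := (abs_nonneg _).trans (h.Dx_bound a (left_mem_Icc.2 hab.le))

/-- The spatial derivative of the bending moment. -/
theorem CoeffBounds.dx_one_moment {a b m K : ℝ} {μ D : ℝ → ℝ} (h : CoeffBounds a b m K μ D)
    (hab : a < b) {u : ℝ → ℝ} (hu : DerivChain a b 3 (fun i => dx a b i u)) {y : ℝ}
    (hy : y ∈ Icc a b) : dx a b 1 (fun z => D z * dx a b 2 u z) y
      = dx a b 1 D y * dx a b 2 u y + D y * dx a b 3 u y :=
  HasDerivWithinAt.dx_one_eq hab hy
    ((h.hasDeriv hy).mul (hu.deriv 2 (by omega) y hy))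

/-- The errors of moment and shear force of a perturbed projection. -/
theorem exists_moment_error_bound (q : ℕ) (hq : 3 ≤ q) (a b σ m K : ℝ) (hab : a < b) (hm : 0 < m) :
    ∃ C : ℝ, 0 < C ∧ ∀ (μ D : ℝ → ℝ), CoeffBounds a b m K μ D → ∀ M : Mesh a b, M.Regular σ →
      ∀ j < M.n, ∀ u : ℝ → ℝ, DerivChain a b q (fun i => dx a b i u) → ∀ p : ℝ[X],
      p.natDegree ≤ q → ∀ κc κd : ℝ,
      (∀ φ : ℝ[X], φ.natDegree ≤ q - 2 →
        ∫ y in (M.x j)..(M.x (j + 1)),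
          D y * φ.eval y * ((derivative (derivative p)).eval y - dx a b 2 u y)
          = -(D (M.x (j + 1)) * φ.eval (M.x (j + 1)) * κd - D (M.x j) * φ.eval (M.x j) * κc)) →
      ∀ E : ℝ, M.h ^ (2 * q - 2) * elementData M (q + 1) u j ≤ M.h ^ 4 * E →
        κc ^ 2 ≤ M.h ^ 5 * E → κd ^ 2 ≤ M.h ^ 5 * E →
      (∫ y in (M.x j)..(M.x (j + 1)), ((derivative (derivative p)).eval y - dx a b 2 u y) ^ 2
        ≤ M.h ^ 4 * (C * E)) ∧
        ∀ y ∈ Icc (M.x j) (M.x (j + 1)),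
        (shear a b D p y - dx a b 1 (fun z => D z * dx a b 2 u z) y) ^ 2 ≤ M.h * (C * E) ∧
        (moment D p y - D y * dx a b 2 u y) ^ 2 ≤ M.h ^ 3 * (C * E) := by
  obtain ⟨C₀, hC₀, hb⟩ := exists_mesh_projection_bound (q - 2) (q - 2) le_rfl a b σ m K hab hm
  set L := b - a with hL
  refine ⟨C₀ + 2 * K ^ 2 * C₀ * (L ^ 2 + 1) + K ^ 2 * C₀, by positivity, ?_⟩
  intro μ D h M hM j hj u hu p hp κc κd horth E hE hκc hκd
  have hK := h.nonneg hab
  have hh := M.h_pos hab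
  have hhL : M.h ≤ L := M.h_le hab
  have hA0 := elementData_nonneg M (q + 1) u j
  have hE0 : 0 ≤ E := by
    have : 0 ≤ M.h ^ 4 * E := le_trans (by positivity) hE
    exact nonneg_of_mul_nonneg_right this (by positivity)
  have hu3 : DerivChain a b 3 (fun i => dx a b i u) := hu.of_le hq
  have hu2 : DerivChain a b (q - 2) (fun i => dx a b (i + 2) u) :=
    (hu.of_le (l := q - 2 + 1 + 1) (by omega)).shift.shift
  -- In the normalisation `R = h⁴ E`, a squared trace loses one power of `h` and a further
  -- derivative two more: `h³ E` for the moment and `h E` for the shear.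
  obtain ⟨h1, h2⟩ := hb μ D h M hM j hj _ hu2 (derivative (derivative p))
    (natDegree_derivative_two_le hp) κc κd horth (M.h ^ 4 * E) (by
      rw [elementData_eq M _ _ hj] at hE
      convert hE using 3
      · omega
      · rw [show q - 2 + 1 + 2 = q + 1 by omega])
    (hκc.trans_eq (by ring)) (hκd.trans_eq (by ring))
  have fit : ∀ {c : ℝ} {k : ℕ}, c ≤ C₀ + 2 * K ^ 2 * C₀ * (L ^ 2 + 1) + K ^ 2 * C₀ →
      M.h ^ k * (c * E) ≤ M.h ^ k * ((C₀ + 2 * K ^ 2 * C₀ * (L ^ 2 + 1) + K ^ 2 * C₀) * E) :=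
    fun hc => mul_le_mul_of_nonneg_left (mul_le_mul_of_nonneg_right hc hE0) (by positivity)
  have n1 : 0 ≤ 2 * K ^ 2 * C₀ * (L ^ 2 + 1) := by positivity
  have n2 : 0 ≤ K ^ 2 * C₀ := by positivity
  refine ⟨h1.trans ((by ring : C₀ * (M.h ^ 4 * E) = M.h ^ 4 * (C₀ * E)).trans_le
    (fit (by linarith))), fun y hy => ?_⟩
  have hyab := M.Icc_subset hj hy
  have e1 : ((derivative (derivative p)).eval y - dx a b 2 u y) ^ 2 ≤ M.h ^ 3 * (C₀ * E) := by
    refine le_of_mul_le_mul_left ((h2 y hy).1.trans_eq ?_) hh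
    ring
  have e2 : ((derivative (derivative (derivative p))).eval y - dx a b 3 u y) ^ 2
      ≤ M.h * (C₀ * E) := by
    refine le_of_mul_le_mul_left (((h2 y hy).2 (by omega)).trans_eq ?_) (pow_pos hh 3)
    ring
  have bD : D y ^ 2 ≤ K ^ 2 := by
    have := h.D_bounds y hyab
    exact pow_le_pow_left₀ (hm.le.trans this.1) this.2 2
  have bD1 : dx a b 1 D y ^ 2 ≤ K ^ 2 := sq_le_sq' (abs_le.1 (h.Dx_bound y hyab)).1
    (abs_le.1 (h.Dx_bound y hyab)).2
  constructor
  · rw [h.shear_eq hab p hyab, h.dx_one_moment hab hu3 hyab]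
    set z := (derivative (derivative p)).eval y - dx a b 2 u y with hz
    set z' := (derivative (derivative (derivative p))).eval y - dx a b 3 u y with hz'
    calc (dx a b 1 D y * (derivative (derivative p)).eval y
          + D y * (derivative (derivative (derivative p))).eval y
          - (dx a b 1 D y * dx a b 2 u y + D y * dx a b 3 u y)) ^ 2
        = (dx a b 1 D y * z + D y * z') ^ 2 := by rw [hz, hz']; ring
      _ ≤ 2 * (dx a b 1 D y ^ 2 * z ^ 2 + D y ^ 2 * z' ^ 2) := by
          linarith [sq_nonneg (dx a b 1 D y * z - D y * z')]
      _ ≤ 2 * (K ^ 2 * (M.h ^ 3 * (C₀ * E)) + K ^ 2 * (M.h * (C₀ * E))) := by gcongr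
      _ ≤ 2 * (K ^ 2 * (M.h * L ^ 2 * (C₀ * E)) + K ^ 2 * (M.h * (C₀ * E))) := by
          have : M.h ^ 3 ≤ M.h * L ^ 2 := by
            calc M.h ^ 3 = M.h * M.h ^ 2 := by ring
              _ ≤ _ := by gcongr
          gcongr
      _ = M.h ^ 1 * ((2 * K ^ 2 * C₀ * (L ^ 2 + 1)) * E) := by ring
      _ ≤ M.h ^ 1 * ((C₀ + 2 * K ^ 2 * C₀ * (L ^ 2 + 1) + K ^ 2 * C₀) * E) := fit (by linarith)
      _ = _ := by ring
  · rw [moment_eq]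
    calc (D y * (derivative (derivative p)).eval y - D y * dx a b 2 u y) ^ 2
        = D y ^ 2 * ((derivative (derivative p)).eval y - dx a b 2 u y) ^ 2 := by ring
      _ ≤ K ^ 2 * (M.h ^ 3 * (C₀ * E)) := by gcongr
      _ = M.h ^ 3 * ((K ^ 2 * C₀) * E) := by ring
      _ ≤ _ := fit (by linarith)

/-- The errors of the weighted projection of the velocity. -/
theorem exists_velocity_error_bound (s : ℕ) (a b σ m K : ℝ) (hab : a < b) (hm : 0 < m) :
    ∃ C : ℝ, 0 < C ∧ ∀ (μ D : ℝ → ℝ), CoeffBounds a b m K μ D → ∀ M : Mesh a b, M.Regular σ →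
      ∀ j < M.n, ∀ v : ℝ → ℝ, DerivChain a b s (fun i => dx a b i v) → ∀ p : ℝ[X],
      p.natDegree ≤ s →
      (∀ φ : ℝ[X], φ.natDegree ≤ s →
        ∫ y in (M.x j)..(M.x (j + 1)), D y * φ.eval y * (p.eval y - v y) = 0) →
      ∀ R : ℝ, M.h ^ (2 * s + 2) * elementData M (s + 1) v j ≤ R →
      (∫ y in (M.x j)..(M.x (j + 1)), (p.eval y - v y) ^ 2 ≤ C * R) ∧
        ∀ y ∈ Icc (M.x j) (M.x (j + 1)),
        M.h * (p.eval y - v y) ^ 2 ≤ C * R ∧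
        (1 ≤ s → M.h ^ 3 * ((derivative p).eval y - dx a b 1 v y) ^ 2 ≤ C * R) := by
  obtain ⟨C, hC, hb⟩ := exists_mesh_projection_bound s s le_rfl a b σ m K hab hm
  refine ⟨C, hC, fun μ D h M hM j hj v hv p hp horth R hR => ?_⟩
  have hh := M.h_pos hab
  have hR0 : 0 ≤ R := le_trans (mul_nonneg (by positivity) (elementData_nonneg M _ _ j)) hR
  have h0 : (0 : ℝ) ^ 2 ≤ M.h * R := by
    have := mul_nonneg hh.le hR0
    simpa using this
  rw [elementData_eq M _ _ hj] at hR
  have := hb μ D h M hM j hj _ hv p hp 0 0 (fun φ hφ => by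
    rw [dx_zero, horth φ hφ]; ring) R hR h0 h0
  simpa only [dx_zero] using this

/-! ### Construction of the comparison functions -/

section Family

variable {a b : ℝ}

/-- The part of the squared Sobolev seminorms of `(u, v)` on the element `j`. -/
noncomputable def localData (M : Mesh a b) (q s : ℕ) (u v : ℝ → ℝ) (j : ℕ) : ℝ :=
  elementData M (q + 1) u j + elementData M (s + 1) v j

/-- The part of the squared Sobolev seminorms of `(u, v)` on the elements `j` and `j + 1`. -/
noncomputable def patchData (M : Mesh a b) (q s : ℕ) (u v : ℝ → ℝ) (j : ℕ) : ℝ :=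
  localData M q s u v j + localData M q s u v (min (j + 1) (M.n - 1))

theorem localData_nonneg (M : Mesh a b) (q s : ℕ) (u v : ℝ → ℝ) (j : ℕ) :
    0 ≤ localData M q s u v j := add_nonneg (elementData_nonneg _ _ _ _) (elementData_nonneg _ _ _ _)

theorem patchData_nonneg (M : Mesh a b) (q s : ℕ) (u v : ℝ → ℝ) (j : ℕ) :
    0 ≤ patchData M q s u v j := add_nonneg (localData_nonneg _ _ _ _ _ _) (localData_nonneg _ _ _ _ _ _)

/-- The slope at node `i` is computed on element `min i (M.n - 1)`, the one to its right except at
`b`. The nodes of element `j` therefore involve only the element and its right neighbour. -/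
theorem localData_le_patchData (M : Mesh a b) (q s : ℕ) (u v : ℝ → ℝ) {i j : ℕ} (hj : j < M.n)
    (hij : i = j ∨ i = j + 1) :
    localData M q s u v (min i (M.n - 1)) ≤ patchData M q s u v j := by
  rcases hij with rfl | rfl
  · rw [min_eq_left (by omega)]
    exact le_add_of_nonneg_right (localData_nonneg _ _ _ _ _ _)
  · exact le_add_of_nonneg_left (localData_nonneg _ _ _ _ _ _)

/-- Shifting by one repeats the last element, so the shifted sum is at most twice the full one;
together with the unshifted sum this gives `3`. -/
theorem sum_patchData_le (M : Mesh a b) (q s : ℕ) (u v : ℝ → ℝ) :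
    ∑ j ∈ Finset.range M.n, patchData M q s u v j
      ≤ 3 * ∑ j ∈ Finset.range M.n, localData M q s u v j := by
  have h0 := localData_nonneg M q s u v
  have key : ∑ j ∈ Finset.range M.n, localData M q s u v (min (j + 1) (M.n - 1))
      ≤ 2 * ∑ j ∈ Finset.range M.n, localData M q s u v j := by
    rcases Nat.eq_zero_or_pos M.n with hn | hn
    · simp [hn]
    · obtain ⟨N, hN⟩ := Nat.exists_eq_add_of_lt hn
      rw [zero_add] at hN
      rw [hN, Finset.sum_range_succ]
      have e : ∑ j ∈ Finset.range N, localData M q s u v (min (j + 1) (N + 1 - 1))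
          = ∑ j ∈ Finset.range N, localData M q s u v (j + 1) :=
        Finset.sum_congr rfl fun j hj => by
          have := Finset.mem_range.1 hj
          rw [min_eq_left (by omega)]
      have e' := Finset.sum_range_succ' (localData M q s u v) N
      have e'' : localData M q s u v N ≤ ∑ j ∈ Finset.range (N + 1), localData M q s u v j :=
        Finset.single_le_sum (fun i _ => h0 i) (Finset.self_mem_range_succ N)
      rw [e, show min (N + 1) (N + 1 - 1) = N by omega]
      have := h0 0
      linarith
  simp only [patchData, Finset.sum_add_distrib]
  linarith

/-- Piecewise polynomials which approximate the solution, with their time derivatives. -/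
structure IsComparisonFamily (M : Mesh a b) (D : ℝ → ℝ) (T : ℝ) (bc : BoundaryType) (q s : ℕ)
    (u v vt : ℝ → ℝ → ℝ) (C : ℝ) (U U' V V' : ℝ → ℕ → ℝ[X]) (sl : ℝ → ℕ → ℝ) : Prop where
  U'_deg : ∀ t, ∀ j < M.n, (U' t j).natDegree ≤ q - 2
  V'_deg : ∀ t, ∀ j < M.n, (V' t j).natDegree ≤ s
  U_deriv : ∀ t ∈ Icc 0 T, ∀ j < M.n, ∀ k : ℕ, HasDerivWithinAt
    (fun r => (derivative (derivative (U r j))).coeff k) ((U' t j).coeff k) (Icc 0 T) t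
  V_deriv : ∀ t ∈ Icc 0 T, ∀ j < M.n, ∀ k : ℕ, HasDerivWithinAt
    (fun r => (V r j).coeff k) ((V' t j).coeff k) (Icc 0 T) t
  comparison : ∀ t ∈ Icc 0 T, ∀ j < M.n,
    ComparisonAt M D q s (u t) (v t) (U t) (U' t) (V t) (V' t) (sl t) j
  bc_left : ∀ t ∈ Icc 0 T, -bc.a₁ * sl t 0 + bc.b₁ * (D a * dx a b 2 (u t) a) = 0
  bc_right : ∀ t ∈ Icc 0 T, bc.a₁ * sl t M.n + bc.b₁ * (D b * dx a b 2 (u t) b) = 0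
  -- `om` stands for a multiple of `h^(2 min(q-3, s-1))`: it dominates both the curvature error and
  -- the velocity error after division by `h⁴`.
  trace : ∀ om : ℝ, M.h ^ (2 * q - 2) ≤ om * M.h ^ 4 → M.h ^ (2 * s + 2) ≤ om * M.h ^ 4 →
    ∀ t ∈ Icc 0 T, ∀ j < M.n, ∀ i, i = j ∨ i = j + 1 →
    TraceErr M.h (C * (om * patchData M q s (u t) (v t) j))
        (shear a b D (U t j) (M.x i) - dx a b 1 (fun z => D z * dx a b 2 (u t) z) (M.x i))
        (moment D (U t j) (M.x i) - D (M.x i) * dx a b 2 (u t) (M.x i))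
        ((V t j).eval (M.x i) - v t (M.x i)) ((derivative (V t j)).eval (M.x i) - sl t i)
  U_err : ∀ om : ℝ, M.h ^ (2 * q - 2) ≤ om * M.h ^ 4 → M.h ^ (2 * s + 2) ≤ om * M.h ^ 4 →
    ∀ t ∈ Icc 0 T, ∀ j < M.n, ∫ y in (M.x j)..(M.x (j + 1)),
      ((derivative (derivative (U t j))).eval y - dx a b 2 (u t) y) ^ 2
        ≤ M.h ^ 4 * (C * (om * patchData M q s (u t) (v t) j))
  V_err : ∀ om : ℝ, M.h ^ (2 * q - 2) ≤ om * M.h ^ 4 → M.h ^ (2 * s + 2) ≤ om * M.h ^ 4 →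
    ∀ t ∈ Icc 0 T, ∀ j < M.n, ∫ y in (M.x j)..(M.x (j + 1)), ((V t j).eval y - v t y) ^ 2
        ≤ M.h ^ 4 * (C * (om * patchData M q s (u t) (v t) j))
  V'_err : ∀ t ∈ Icc 0 T, ∀ j < M.n, ∫ y in (M.x j)..(M.x (j + 1)), ((V' t j).eval y - vt t y) ^ 2
        ≤ C * (M.h ^ (2 * s + 2) * elementData M (s + 1) (vt t) j)

/-- `U` is any second antiderivative of a projection of `u_xx` perturbed by `u_x - sl` at the nodes;
the constants of integration are irrelevant, as only `U_xx` is used. Differentiating the defining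
relation in time produces the perturbation `v_x - sl'`, which is what `ComparisonAt` asks for. -/
theorem exists_comparison (q s : ℕ) (hq : 3 ≤ q) (hs : s ≤ q) (a b σ m K : ℝ) (hab : a < b) (hm : 0 < m) :
    ∃ C : ℝ, 0 < C ∧ ∀ (μ D : ℝ → ℝ), CoeffBounds a b m K μ D →
      ∀ (T : ℝ) (f u v vt : ℝ → ℝ → ℝ) (bc : BoundaryType),
      IsSmoothSolution a b T μ D f bc q s u v vt →
      ∀ M : Mesh a b, M.Regular σ →
      ∃ (U U' V V' : ℝ → ℕ → ℝ[X]) (sl : ℝ → ℕ → ℝ),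
        IsComparisonFamily M D T bc q s u v vt C U U' V V' sl := by
  obtain ⟨Cs, hCs, hslope⟩ := exists_slope_bound q s hq a b σ m K hab hm
  obtain ⟨Cm, hCm, hmom⟩ := exists_moment_error_bound q hq a b σ m K hab hm
  obtain ⟨Cv, hCv, hvel⟩ := exists_velocity_error_bound s a b σ m K hab hm
  obtain ⟨Anti, hAnti⟩ := exists_antiderivative_two
  set L := b - a with hL
  set C₀ : ℝ := Cm * (1 + Cs) + Cv + Cs with hC₀
  have hC₀0 : 0 < C₀ := by positivity
  refine ⟨(1 + L ^ 2) * C₀, by positivity, ?_⟩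
  intro μ D h T f u v vt bc sol M hM
  have hn := M.n_pos hab
  have hh := M.h_pos hab
  have hhL : M.h ≤ L := M.h_le hab
  have su := sol.u_smooth
  have sv := sol.v_smooth
  have svt := sol.vt_smooth
  have su2 : SpatiallySmooth a b T (1 + 1) u := su.of_le (by omega)
  have sv2 : SpatiallySmooth a b T (1 + 1) v := sv.of_le (le_max_right _ _)
  have svs : SpatiallySmooth a b T (s + 1) v := sv.of_le (le_max_left _ _)
  have hd : ∀ i ≤ 2, ∀ t ∈ Icc 0 T, ∀ y ∈ Icc a b,
      HasDerivWithinAt (fun r => dx a b i (u r) y) (dx a b i (v t) y) (Icc 0 T) t := fun i hi =>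
    SpatiallySmooth.hasDerivWithinAt_dx (k := 1) hab su2 sv2 sol.u_t hi
  have hsl := fun (i : ℕ) (hi : i ≤ M.n) => hslope μ D h T f u v vt bc sol M hM i hi
    (min i (M.n - 1)) (by omega) (by omega)
  choose! sl sl' sl_deriv sl_exact sl_left sl_right sl_err sl'_err using hsl
  have hUfam : ∀ j < M.n, ∃ P P' : ℝ → ℝ[X], (∀ t, (P t).natDegree ≤ q - 2) ∧
      (∀ t, (P' t).natDegree ≤ q - 2) ∧
      (∀ t ∈ Icc 0 T, ∀ k,
        HasDerivWithinAt (fun x => (P x).coeff k) ((P' t).coeff k) (Icc 0 T) t) ∧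
      (∀ t ∈ Icc 0 T, ∀ φ : ℝ[X], φ.natDegree ≤ q - 2 →
        ∫ y in (M.x j)..(M.x (j + 1)), D y * φ.eval y * ((P t).eval y - dx a b 2 (u t) y)
          = -(D (M.x (j + 1)) * φ.eval (M.x (j + 1))
              * (dx a b 1 (u t) (M.x (j + 1)) - sl (j + 1) t)
            - D (M.x j) * φ.eval (M.x j) * (dx a b 1 (u t) (M.x j) - sl j t))) ∧
      ∀ t ∈ Icc 0 T, ∀ φ : ℝ[X], φ.natDegree ≤ q - 2 →
        ∫ y in (M.x j)..(M.x (j + 1)), D y * φ.eval y * ((P' t).eval y - dx a b 2 (v t) y)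
          = -(D (M.x (j + 1)) * φ.eval (M.x (j + 1))
              * (dx a b 1 (v t) (M.x (j + 1)) - sl' (j + 1) t)
            - D (M.x j) * φ.eval (M.x j) * (dx a b 1 (v t) (M.x j) - sl' j t)) :=
    fun j hj => h.exists_projection_family hm (M.x_lt j hj) (M.Icc_subset hj) (q - 2) (hd 2 le_rfl)
      (sv2.2 2 le_rfl) (fun t ht => su2.continuousOn le_rfl ht)
      (fun t ht => (hd 1 (by omega) t ht _ (M.x_mem hj.le)).sub (sl_deriv j hj.le t ht))
      (fun t ht => (hd 1 (by omega) t ht _ (M.x_mem hj)).sub (sl_deriv (j + 1) hj t ht))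
  choose! P P' P_deg P'_deg P_deriv P_orth P'_orth using hUfam
  have cv : ∀ t ∈ Icc 0 T, ContinuousOn (v t) (Icc a b) := fun t ht => by
    simpa only [dx_zero] using sv2.continuousOn (Nat.zero_le _) ht
  have cvt : ContinuousOn (fun z : ℝ × ℝ => vt z.1 z.2) (Icc 0 T ×ˢ Icc a b) := by
    simpa only [dx_zero] using svt.2 0 (Nat.zero_le _)
  have hVfam : ∀ j < M.n, ∃ P P' : ℝ → ℝ[X], (∀ t, (P t).natDegree ≤ s) ∧
      (∀ t, (P' t).natDegree ≤ s) ∧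
      (∀ t ∈ Icc 0 T, ∀ k,
        HasDerivWithinAt (fun x => (P x).coeff k) ((P' t).coeff k) (Icc 0 T) t) ∧
      (∀ t ∈ Icc 0 T, ∀ φ : ℝ[X], φ.natDegree ≤ s →
        ∫ y in (M.x j)..(M.x (j + 1)), D y * φ.eval y * ((P t).eval y - v t y) = 0) ∧
      ∀ t ∈ Icc 0 T, ∀ φ : ℝ[X], φ.natDegree ≤ s →
        ∫ y in (M.x j)..(M.x (j + 1)), D y * φ.eval y * ((P' t).eval y - vt t y) = 0 := by
    intro j hj
    obtain ⟨Q, Q', h1, h2, h3, h4, h5⟩ := h.exists_projection_family hm (M.x_lt j hj)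
      (M.Icc_subset hj) s sol.v_t cvt cv (κc := fun _ => 0) (κd := fun _ => 0) (κc' := fun _ => 0)
      (κd' := fun _ => 0) (fun t _ => hasDerivWithinAt_const _ _ _)
      (fun t _ => hasDerivWithinAt_const _ _ _)
    exact ⟨Q, Q', h1, h2, h3, fun t ht φ hφ => (h4 t ht φ hφ).trans (by ring),
      fun t ht φ hφ => (h5 t ht φ hφ).trans (by ring)⟩
  choose! V V' V_deg V'_deg V_deriv V_orth V'_orth using hVfam
  have A2 : ∀ p, derivative (derivative (Anti p)) = p := fun p => (hAnti p).1
  have Adeg : ∀ j < M.n, ∀ t, (Anti (P j t)).natDegree ≤ q := fun j hj t => by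
    have := (hAnti (P j t)).2
    have := P_deg j hj t
    omega
  have vchain : ∀ t ∈ Icc 0 T, DerivChain a b s (fun i => dx a b i (v t)) :=
    fun t ht => svs.chain hab ht
  -- the node data are controlled by the data of the neighbouring elements
  have hnode : ∀ t j i, j < M.n → (i = j ∨ i = j + 1) →
      elementData M (q + 1) (u t) (min i (M.n - 1)) ≤ patchData M q s (u t) (v t) j ∧
      elementData M (s + 1) (v t) (min i (M.n - 1)) ≤ patchData M q s (u t) (v t) j := by
    intro t j i hj hij
    have h1 := localData_le_patchData M q s (u t) (v t) hj hij
    have h2 := elementData_nonneg M (q + 1) (u t) (min i (M.n - 1))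
    have h3 := elementData_nonneg M (s + 1) (v t) (min i (M.n - 1))
    rw [localData] at h1
    constructor <;> linarith
  have hloc : ∀ t j, j < M.n →
      elementData M (q + 1) (u t) j ≤ patchData M q s (u t) (v t) j ∧
      elementData M (s + 1) (v t) j ≤ patchData M q s (u t) (v t) j := by
    intro t j hj
    have := hnode t j j hj (Or.inl rfl)
    rwa [min_eq_left (by omega)] at this
  have om0 : ∀ {om : ℝ}, M.h ^ (2 * q - 2) ≤ om * M.h ^ 4 → 0 ≤ om := fun ho =>
    nonneg_of_mul_nonneg_left (le_trans (by positivity) ho) (by positivity)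
  -- The slope of a degree `q` projection is accurate enough for the perturbation to be of the same
  -- order as the projection error of `u_xx`, because `2 q + 2 = (2 q - 2) + 4`.
  have hκ : ∀ om : ℝ, M.h ^ (2 * q - 2) ≤ om * M.h ^ 4 → ∀ t ∈ Icc 0 T, ∀ j < M.n, ∀ i,
      (i = j ∨ i = j + 1) → (dx a b 1 (u t) (M.x i) - sl i t) ^ 2
        ≤ M.h ^ 5 * ((1 + Cs) * (om * patchData M q s (u t) (v t) j)) := by
    intro om ho t ht j hj i hij
    have hi : i ≤ M.n := by omega
    have hA := (hnode t j i hj hij).1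
    have hA0 := elementData_nonneg M (q + 1) (u t) (min i (M.n - 1))
    refine le_of_mul_le_mul_left ?_ (pow_pos hh 3)
    calc M.h ^ 3 * (dx a b 1 (u t) (M.x i) - sl i t) ^ 2
        ≤ Cs * (M.h ^ (2 * q + 2) * elementData M (q + 1) (u t) (min i (M.n - 1))) :=
          sl_err i hi t ht
      _ = Cs * (M.h ^ (2 * q - 2) * M.h ^ 4
            * elementData M (q + 1) (u t) (min i (M.n - 1))) := by
          rw [show 2 * q + 2 = 2 * q - 2 + 4 by omega, pow_add]
      _ ≤ (1 + Cs) * (om * M.h ^ 4 * M.h ^ 4 * patchData M q s (u t) (v t) j) := by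
          have := om0 ho
          gcongr
          linarith
      _ = _ := by ring
  have hmomE : ∀ om : ℝ, M.h ^ (2 * q - 2) ≤ om * M.h ^ 4 → ∀ t ∈ Icc 0 T, ∀ j (hj : j < M.n), _ :=
    fun om ho t ht j hj => hmom μ D h M hM j hj (u t) (su.chain hab ht) (Anti (P j t)) (Adeg j hj t)
      _ _ (fun φ hφ => by rw [A2]; exact P_orth j hj t ht φ hφ)
      ((1 + Cs) * (om * patchData M q s (u t) (v t) j)) (by
        have h1 := (hloc t j hj).1
        have h2 := patchData_nonneg M q s (u t) (v t) j
        have h3 := om0 ho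
        calc _ ≤ (om * M.h ^ 4) * patchData M q s (u t) (v t) j :=
              mul_le_mul ho h1 (elementData_nonneg _ _ _ _) (by positivity)
          _ = M.h ^ 4 * (1 * (om * patchData M q s (u t) (v t) j)) := by ring
          _ ≤ _ := mul_le_mul_of_nonneg_left (mul_le_mul_of_nonneg_right (by linarith)
              (mul_nonneg h3 h2)) (by positivity))
      (hκ om ho t ht j hj j (Or.inl rfl)) (hκ om ho t ht j hj (j + 1) (Or.inr rfl))
  have hvelR : ∀ om : ℝ, M.h ^ (2 * q - 2) ≤ om * M.h ^ 4 → M.h ^ (2 * s + 2) ≤ om * M.h ^ 4 →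
      ∀ t ∈ Icc 0 T, ∀ j (hj : j < M.n), _ :=
    fun om ho ho' t ht j hj => hvel μ D h M hM j hj (v t) (vchain t ht) (V j t) (V_deg j hj t)
      (V_orth j hj t ht) (om * M.h ^ 4 * patchData M q s (u t) (v t) j) (by
        have h1 := (hloc t j hj).2
        have h2 := patchData_nonneg M q s (u t) (v t) j
        have h3 := om0 ho
        exact mul_le_mul ho' h1 (elementData_nonneg _ _ _ _) (by positivity))
  have fit : ∀ {c X B : ℝ}, c ≤ (1 + L ^ 2) * C₀ → 0 ≤ X → 0 ≤ B →
      B * (c * X) ≤ B * ((1 + L ^ 2) * C₀ * X) := fun hc hX hB => by gcongr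
  have hC₀L : C₀ ≤ (1 + L ^ 2) * C₀ :=
    le_mul_of_one_le_left hC₀0.le (le_add_of_nonneg_right (sq_nonneg L))
  have p1 : 0 < Cm * (1 + Cs) := by positivity
  have hCm' : Cm * (1 + Cs) ≤ C₀ := by linarith
  have hCv' : Cv ≤ C₀ := by linarith
  have hCs' : Cs ≤ C₀ := by linarith
  have omX : ∀ {om : ℝ}, M.h ^ (2 * q - 2) ≤ om * M.h ^ 4 → ∀ t j,
      0 ≤ om * patchData M q s (u t) (v t) j := fun ho t j =>
    mul_nonneg (om0 ho) (patchData_nonneg _ _ _ _ _ _)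
  refine ⟨fun t j => Anti (P j t), fun t j => P' j t, fun t j => V j t, fun t j => V' j t,
    fun t i => sl' i t, fun t j hj => P'_deg j hj t, fun t j hj => V'_deg j hj t,
    fun t ht j hj k => ?_, fun t ht j hj k => V_deriv j hj t ht k, fun t ht j hj => ?_,
    fun t ht => sl_left 0 (Nat.zero_le _) rfl t ht, fun t ht => sl_right M.n le_rfl rfl t ht,
    fun om ho ho' t ht j hj i hij => ?_, fun om ho ho' t ht j hj => ?_,
    fun om ho ho' t ht j hj => ?_, fun t ht j hj => ?_⟩
  · simp only [A2]
    exact P_deriv j hj t ht k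
  · refine ⟨Adeg j hj t, V_deg j hj t, fun φ hφ => ?_, fun ψ hψ => ?_, V_orth j hj t ht⟩
    · exact P'_orth j hj t ht _ (natDegree_derivative_two_le hφ)
    -- For `s = 0` the orthogonality is empty since `ψ_xx = 0`; for `s ≥ 1` the slopes are exact and
    -- the projection is unperturbed. The perturbation thus never conflicts with orthogonality.
    · rcases Nat.eq_zero_or_pos s with hs0 | hs1
      · have : derivative (derivative ψ) = 0 := by
          have : derivative ψ = 0 := derivative_of_natDegree_zero (by omega)
          rw [this, derivative_zero]
        simp [moment_eq, this]
      · have key := P_orth j hj t ht _ (natDegree_derivative_two_le (hψ.trans hs))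
        rw [(sl_exact j hj.le hs1 t ht).1, (sl_exact (j + 1) hj hs1 t ht).1, sub_self, sub_self,
          mul_zero, mul_zero, sub_self, neg_zero] at key
        simp only [A2]
        exact key
  · have hi : M.x i ∈ Icc (M.x j) (M.x (j + 1)) := by
      rcases hij with rfl | rfl
      · exact left_mem_Icc.2 (M.x_lt _ hj).le
      · exact right_mem_Icc.2 (M.x_lt _ hj).le
    obtain ⟨hS, hMo⟩ := (hmomE om ho t ht j hj).2 _ hi
    obtain ⟨hv, hvx⟩ := (hvelR om ho ho' t ht j hj).2 _ hi
    set X := om * patchData M q s (u t) (v t) j with hX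
    have hX0 : 0 ≤ X := omX ho t j
    have k3 : (moment D (Anti (P j t)) (M.x i) - D (M.x i) * dx a b 2 (u t) (M.x i)) ^ 2
        ≤ M.h ^ 3 * (C₀ * X) := hMo.trans <| by
      calc M.h ^ 3 * (Cm * ((1 + Cs) * X)) = M.h ^ 3 * (Cm * (1 + Cs) * X) := by ring
        _ ≤ _ := by gcongr
    have v3 : ((V j t).eval (M.x i) - v t (M.x i)) ^ 2 ≤ M.h ^ 3 * (C₀ * X) := by
      refine le_of_mul_le_mul_left (hv.trans ?_) hh
      calc Cv * (om * M.h ^ 4 * patchData M q s (u t) (v t) j) = M.h * (M.h ^ 3 * (Cv * X)) := by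
            rw [hX]; ring
        _ ≤ _ := by gcongr
    have up : M.h ^ 3 * (C₀ * X) ≤ M.h * ((1 + L ^ 2) * C₀ * X) := by
      calc M.h ^ 3 * (C₀ * X) = M.h * (M.h ^ 2 * (C₀ * X)) := by ring
        _ ≤ M.h * ((1 + L ^ 2) * (C₀ * X)) := by
          have : M.h ^ 2 ≤ 1 + L ^ 2 := by
            have := pow_le_pow_left₀ hh.le hhL 2
            linarith
          gcongr
        _ = _ := by ring
    have up3 : M.h ^ 3 * (C₀ * X) ≤ M.h ^ 3 * ((1 + L ^ 2) * C₀ * X) :=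
      fit hC₀L hX0 (by positivity)
    refine ⟨hS.trans ?_, ?_, k3.trans up3, v3.trans up3, k3.trans up, v3.trans up⟩
    · calc M.h * (Cm * ((1 + Cs) * X)) = M.h * (Cm * (1 + Cs) * X) := by ring
        _ ≤ _ := fit (hCm'.trans hC₀L) hX0 hh.le
    · refine le_of_mul_le_mul_left ?_ (pow_pos hh 3)
      -- For `s = 0` the slope of `V` is zero and the error is the substitute slope itself, bounded
      -- by its stability rather than by approximation.
      rcases Nat.eq_zero_or_pos s with hs0 | hs1
      · have e0 : derivative (V j t) = 0 :=
          derivative_of_natDegree_zero (by have := V_deg j hj t; omega)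
        have hA := (hnode t j i hj hij).2
        rw [e0, eval_zero, zero_sub, neg_sq]
        refine (sl'_err i (by omega) hs0 t ht).trans ?_
        calc Cs * (M.h ^ 2 * elementData M (s + 1) (v t) (min i (M.n - 1)))
            ≤ Cs * (om * M.h ^ 4 * patchData M q s (u t) (v t) j) := by
              rw [hs0, mul_zero, zero_add] at ho'
              exact mul_le_mul_of_nonneg_left (mul_le_mul ho' hA (elementData_nonneg _ _ _ _)
                (mul_nonneg (om0 ho) (by positivity))) hCs.le
          _ = M.h ^ 3 * (M.h * (Cs * X)) := by rw [hX]; ring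
          _ ≤ _ := mul_le_mul_of_nonneg_left (fit (hCs'.trans hC₀L) hX0 hh.le) (by positivity)
      · rw [(sl_exact i (by omega) hs1 t ht).2]
        refine (hvx hs1).trans ?_
        calc Cv * (om * M.h ^ 4 * patchData M q s (u t) (v t) j) = M.h ^ 3 * (M.h * (Cv * X)) := by
              rw [hX]; ring
          _ ≤ _ := mul_le_mul_of_nonneg_left (fit (hCv'.trans hC₀L) hX0 hh.le) (by positivity)
  · refine (hmomE om ho t ht j hj).1.trans ?_
    calc M.h ^ 4 * (Cm * ((1 + Cs) * (om * patchData M q s (u t) (v t) j)))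
        = M.h ^ 4 * (Cm * (1 + Cs) * (om * patchData M q s (u t) (v t) j)) := by ring
      _ ≤ _ := fit (hCm'.trans hC₀L) (omX ho t j) (by positivity)
  · refine (hvelR om ho ho' t ht j hj).1.trans ?_
    calc Cv * (om * M.h ^ 4 * patchData M q s (u t) (v t) j)
        = M.h ^ 4 * (Cv * (om * patchData M q s (u t) (v t) j)) := by ring
      _ ≤ _ := fit (hCv'.trans hC₀L) (omX ho t j) (by positivity)
  · have := (hvel μ D h M hM j hj (vt t) (svt.chain hab ht) (V' j t) (V'_deg j hj t)
      (V'_orth j hj t ht) _ le_rfl).1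
    exact this.trans (mul_le_mul_of_nonneg_right (hCv'.trans hC₀L)
      (mul_nonneg (by positivity) (elementData_nonneg _ _ _ _)))

end Family

/-! ### The energy of the error -/

/-- A linear Gronwall inequality on a bounded interval. -/
theorem le_exp_mul_of_deriv_le {T c B : ℝ} (hT : 0 < T) (hc : 0 ≤ c) (hB : 0 ≤ B) {E E' : ℝ → ℝ}
    (hE : ∀ t ∈ Icc 0 T, HasDerivWithinAt E (E' t) (Icc 0 T) t)
    (hE' : ∀ t ∈ Icc 0 T, E' t ≤ c / T * E t + B) (hE0 : 0 ≤ E 0) {t : ℝ} (ht : t ∈ Icc 0 T) :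
    E t ≤ Real.exp c * (E 0 + T * B) := by
  set l := c / T with hl
  have hl0 : 0 ≤ l := div_nonneg hc hT.le
  have hG : ∀ r ∈ Icc 0 T, HasDerivWithinAt (fun r => E r * Real.exp (-(l * r)) - B * r)
      (E' r * Real.exp (-(l * r)) + E r * (Real.exp (-(l * r)) * (-l)) - B) (Icc 0 T) r := by
    intro r hr
    have h1 : HasDerivAt (fun r : ℝ => Real.exp (-(l * r))) (Real.exp (-(l * r)) * (-l)) r := by
      have := ((hasDerivAt_id r).const_mul l).neg.exp
      simpa using this
    have h2 : HasDerivAt (fun r : ℝ => B * r) B r := by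
      simpa using (hasDerivAt_id r).const_mul B
    exact ((hE r hr).mul h1.hasDerivWithinAt).sub h2.hasDerivWithinAt
  -- The integrating factor is at most `1`, so subtracting `B r` compensates the source. Over a time
  -- `T`, the rate `c / T` accumulates to at most `c`.
  have anti : AntitoneOn (fun r => E r * Real.exp (-(l * r)) - B * r) (Icc 0 T) := by
    refine antitoneOn_of_deriv_nonpos (convex_Icc 0 T)
      (fun r hr => (hG r hr).continuousWithinAt)
      (fun r hr => ((hG r (interior_subset hr)).mono interior_subset).differentiableWithinAt)
      fun r hr => ?_
    have hr' := interior_subset hr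
    rw [interior_Icc] at hr
    rw [((hG r hr').hasDerivAt (Icc_mem_nhds hr.1 hr.2)).deriv]
    have h1 := Real.exp_pos (-(l * r))
    have h2 : Real.exp (-(l * r)) ≤ 1 := Real.exp_le_one_iff.2 (by
      have := mul_nonneg hl0 hr'.1
      linarith)
    have h3 := mul_le_mul_of_nonneg_right (hE' r hr') h1.le
    have h4 := mul_le_mul_of_nonneg_left h2 hB
    linarith
  have h0 := anti (left_mem_Icc.2 hT.le) ht ht.1
  simp only [mul_zero, neg_zero, Real.exp_zero, mul_one, sub_zero] at h0
  have h1 : E t * Real.exp (-(l * t)) ≤ E 0 + T * B := by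
    have := mul_le_mul_of_nonneg_left ht.2 hB
    linarith
  have h2 : l * t ≤ c := by
    calc l * t ≤ l * T := mul_le_mul_of_nonneg_left ht.2 hl0
      _ = c := by rw [hl]; field_simp
  have h3 : 0 ≤ E 0 + T * B := by positivity
  calc E t = Real.exp (l * t) * (E t * Real.exp (-(l * t))) := by
        rw [mul_left_comm, ← Real.exp_add, add_neg_cancel, Real.exp_zero, mul_one]
    _ ≤ Real.exp (l * t) * (E 0 + T * B) := mul_le_mul_of_nonneg_left h1 (Real.exp_pos _).le
    _ ≤ _ := mul_le_mul_of_nonneg_right (Real.exp_le_exp.2 h2) h3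

theorem hasDerivWithinAt_coeff_derivative {S : Set ℝ} {t : ℝ} {p p' : ℝ → ℝ[X]}
    (h : ∀ k, HasDerivWithinAt (fun r => (p r).coeff k) ((p' t).coeff k) S t) (k : ℕ) :
    HasDerivWithinAt (fun r => (derivative (p r)).coeff k) ((derivative (p' t)).coeff k) S t := by
  simp only [coeff_derivative]
  exact (h (k + 1)).mul_const _

/-- The distance of two polynomials with the same weighted projection property. -/
theorem integral_sq_sub_le_of_orthogonal {c d m : ℝ} (hcd : c ≤ d) (hm : 0 < m) {D g : ℝ → ℝ}
    (hD : ContinuousOn D (Icc c d)) (hDm : ∀ y ∈ Icc c d, m ≤ D y) (hg : ContinuousOn g (Icc c d))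
    (p r : ℝ[X])
    (h : ∫ y in c..d, D y * (p - r).eval y * (r.eval y - g y) = 0) :
    ∫ y in c..d, D y * (p - r).eval y * (p - r).eval y
      ≤ ∫ y in c..d, D y * (p.eval y - g y) ^ 2 := by
  have cp : ContinuousOn (fun y => (p - r).eval y) (Icc c d) := (p - r).continuous.continuousOn
  have cr : ContinuousOn (fun y => r.eval y - g y) (Icc c d) := r.continuous.continuousOn.sub hg
  have i1 : IntervalIntegrable (fun y => D y * (p - r).eval y * (p - r).eval y) volume c d :=
    intervalIntegrable_of_Icc hcd ((hD.mul cp).mul cp)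
  have i2 : IntervalIntegrable (fun y => D y * (p - r).eval y * (r.eval y - g y)) volume c d :=
    intervalIntegrable_of_Icc hcd ((hD.mul cp).mul cr)
  have i3 : IntervalIntegrable (fun y => D y * (r.eval y - g y) ^ 2) volume c d :=
    intervalIntegrable_of_Icc hcd (hD.mul (cr.pow 2))
  have e : ∫ y in c..d, D y * (p.eval y - g y) ^ 2
      = (∫ y in c..d, D y * (p - r).eval y * (p - r).eval y)
        + 2 * (∫ y in c..d, D y * (p - r).eval y * (r.eval y - g y))
        + ∫ y in c..d, D y * (r.eval y - g y) ^ 2 := by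
    rw [← intervalIntegral.integral_const_mul, ← intervalIntegral.integral_add i1 (i2.const_mul 2),
      ← intervalIntegral.integral_add (i1.add (i2.const_mul 2)) i3]
    congr 1; funext y
    simp only [eval_sub]
    ring
  have := intervalIntegral.integral_nonneg (μ := volume) hcd
    (f := fun y => D y * (r.eval y - g y) ^ 2)
    fun y hy => mul_nonneg (hm.le.trans (hDm y hy)) (sq_nonneg _)
  rw [e, h]
  linarith

/-- Two-sided bounds of a weighted norm. -/
theorem integral_weight_bounds {c d m K : ℝ} (hcd : c ≤ d) {ρ : ℝ → ℝ}
    (hρ : IntervalIntegrable ρ volume c d) (hb : ∀ y ∈ Icc c d, m ≤ ρ y ∧ ρ y ≤ K) {g : ℝ → ℝ}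
    (hg : ContinuousOn g (Icc c d)) :
    m * (∫ y in c..d, g y ^ 2) ≤ (∫ y in c..d, ρ y * g y * g y) ∧
      (∫ y in c..d, ρ y * g y * g y) ≤ K * ∫ y in c..d, g y ^ 2 := by
  have hgu : ContinuousOn g (uIcc c d) := by rwa [uIcc_of_le hcd]
  have i1 := (hρ.mul_continuousOn hgu).mul_continuousOn hgu
  have i2 : IntervalIntegrable (fun y => g y ^ 2) volume c d :=
    intervalIntegrable_of_Icc hcd (hg.pow 2)
  rw [← intervalIntegral.integral_const_mul, ← intervalIntegral.integral_const_mul]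
  constructor
  · refine intervalIntegral.integral_mono_on hcd (i2.const_mul m) i1 fun y hy => ?_
    have := mul_le_mul_of_nonneg_right (hb y hy).1 (sq_nonneg (g y))
    linarith
  · refine intervalIntegral.integral_mono_on hcd i1 (i2.const_mul K) fun y hy => ?_
    have := mul_le_mul_of_nonneg_right (hb y hy).2 (sq_nonneg (g y))
    linarith

/-- Needed for the maximum over time to be attained. Clamping the space variable with `projIcc`
gives a continuous integrand on the whole line without changing it on `[a,b]`. -/
theorem continuousOn_sobolevSeminormSq {a b T : ℝ} (hab : a < b) {k : ℕ} {w : ℝ → ℝ → ℝ}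
    (h : SpatiallySmooth a b T k w) :
    ContinuousOn (fun t => sobolevSeminormSq a b k (w t)) (Icc 0 T) := by
  rw [continuousOn_iff_continuous_domRestrict]
  have hc : Continuous (fun z : Icc (0 : ℝ) T × ℝ =>
      dx a b k (w z.1) (projIcc a b hab.le z.2) ^ 2) := by
    refine Continuous.pow ?_ 2
    have : Continuous (fun z : Icc (0 : ℝ) T × ℝ => ((z.1 : ℝ), (projIcc a b hab.le z.2 : ℝ))) :=
      (continuous_subtype_val.comp continuous_fst).prodMk
        (continuous_subtype_val.comp (continuous_projIcc.comp continuous_snd))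
    exact (h.2 k le_rfl).comp_continuous this fun z => ⟨z.1.2, (projIcc a b hab.le z.2).2⟩
  have := intervalIntegral.continuous_parametric_intervalIntegral_of_continuous' (μ := volume)
    (f := fun (t : Icc (0 : ℝ) T) (y : ℝ) => dx a b k (w t) (projIcc a b hab.le y) ^ 2) hc a b
  refine this.congr fun t => ?_
  simp only [domRestrict_apply, sobolevSeminormSq]
  refine intervalIntegral.integral_congr fun y hy => ?_
  rw [uIcc_of_le hab.le] at hy
  simp only [projIcc_of_mem hab.le hy]

theorem sum_elementData {a b T : ℝ} {M : Mesh a b} {k : ℕ} {w : ℝ → ℝ → ℝ}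
    (h : SpatiallySmooth a b T k w) {t : ℝ} (ht : t ∈ Icc 0 T) :
    ∑ j ∈ Finset.range M.n, elementData M k (w t) j = sobolevSeminormSq a b k (w t) := by
  have hc : ContinuousOn (fun y => dx a b k (w t) y ^ 2) (Icc a b) :=
    (h.continuousOn le_rfl ht).pow 2
  rw [sobolevSeminormSq, ← M.sum_integral hc]
  exact Finset.sum_congr rfl fun j hj => elementData_eq M k _ (Finset.mem_range.1 hj)

theorem sobolevSeminormSq_nonneg {a b : ℝ} (hab : a < b) (k : ℕ) (w : ℝ → ℝ) :
    0 ≤ sobolevSeminormSq a b k w :=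
  intervalIntegral.integral_nonneg hab.le fun _ _ => sq_nonneg _

/-- Comparison of powers of the mesh size with a smaller exponent. -/
theorem pow_le_rpow_mul_pow {h L e : ℝ} (hh : 0 < h) (hL : h ≤ L) {k l : ℕ}
    (he : e ≤ (k : ℝ) - l) : h ^ k ≤ L ^ ((k : ℝ) - l - e) * h ^ e * h ^ l := by
  have h1 : h ^ ((k : ℝ) - l - e) ≤ L ^ ((k : ℝ) - l - e) :=
    Real.rpow_le_rpow hh.le hL (by linarith)
  calc h ^ k = h ^ ((k : ℝ) - l - e) * h ^ e * h ^ l := by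
        rw [← Real.rpow_natCast, ← Real.rpow_natCast, ← Real.rpow_add hh, ← Real.rpow_add hh]
        congr 1; ring
    _ ≤ _ := by gcongr

section Energy

variable {a b m K : ℝ} {μ D : ℝ → ℝ}

/-- The energy of a pair of piecewise polynomials, the first one being a curvature. -/
noncomputable def energy (M : Mesh a b) (μ D : ℝ → ℝ) (z w : ℕ → ℝ[X]) : ℝ :=
  ∑ j ∈ Finset.range M.n, ((∫ y in (M.x j)..(M.x (j + 1)), D y * (z j).eval y * (z j).eval y)
    + ∫ y in (M.x j)..(M.x (j + 1)), μ y * (w j).eval y * (w j).eval y)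

theorem CoeffBounds.intervalIntegrable_D (h : CoeffBounds a b m K μ D) {c d : ℝ} (hcd : c ≤ d)
    (hs : Icc c d ⊆ Icc a b) : IntervalIntegrable D volume c d :=
  intervalIntegrable_of_Icc hcd (h.continuousOn.mono hs)

theorem CoeffBounds.mul_le_energy (h : CoeffBounds a b m K μ D) (hm : 0 < m) (M : Mesh a b)
    (z w : ℕ → ℝ[X]) :
    m * ∑ j ∈ Finset.range M.n, ((∫ y in (M.x j)..(M.x (j + 1)), (z j).eval y ^ 2)
      + ∫ y in (M.x j)..(M.x (j + 1)), (w j).eval y ^ 2) ≤ energy M μ D z w := by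
  rw [energy, Finset.mul_sum]
  refine Finset.sum_le_sum fun j hj => ?_
  have hj := Finset.mem_range.1 hj
  have hcd := (M.x_lt j hj).le
  have hs := M.Icc_subset hj
  have h1 := (integral_weight_bounds hcd (h.intervalIntegrable_D hcd hs)
    (fun y hy => h.D_bounds y (hs hy)) (z j).continuous.continuousOn).1
  have h2 := (integral_weight_bounds hcd (h.intervalIntegrable_μ hm hcd hs)
    (fun y hy => h.μ_bounds y (hs hy)) (w j).continuous.continuousOn).1
  linarith

/-- The rate of change of the energy. -/
theorem CoeffBounds.hasDerivWithinAt_energy (h : CoeffBounds a b m K μ D) (hm : 0 < m)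
    (M : Mesh a b) {S : Set ℝ} {N : ℕ} {z z' w w' : ℝ → ℕ → ℝ[X]}
    (hz : ∀ t ∈ S, ∀ j < M.n, (z t j).natDegree ≤ N)
    (hz' : ∀ t ∈ S, ∀ j < M.n, (z' t j).natDegree ≤ N)
    (hw : ∀ t ∈ S, ∀ j < M.n, (w t j).natDegree ≤ N)
    (hw' : ∀ t ∈ S, ∀ j < M.n, (w' t j).natDegree ≤ N) {t : ℝ} (ht : t ∈ S)
    (dz : ∀ j < M.n, ∀ k, HasDerivWithinAt (fun r => (z r j).coeff k) ((z' t j).coeff k) S t)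
    (dw : ∀ j < M.n, ∀ k, HasDerivWithinAt (fun r => (w r j).coeff k) ((w' t j).coeff k) S t) :
    HasDerivWithinAt (fun r => energy M μ D (z r) (w r))
      (2 * ∑ j ∈ Finset.range M.n,
        ((∫ y in (M.x j)..(M.x (j + 1)), D y * (z t j).eval y * (z' t j).eval y)
        + ∫ y in (M.x j)..(M.x (j + 1)), μ y * (w t j).eval y * (w' t j).eval y)) S t := by
  simp only [energy, Finset.mul_sum, mul_add]
  refine HasDerivWithinAt.fun_sum fun j hj => ?_
  have hj := Finset.mem_range.1 hj
  have hcd := (M.x_lt j hj).le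
  have hs := M.Icc_subset hj
  exact (hasDerivWithinAt_integral_sq (h.intervalIntegrable_D hcd hs) (fun t ht => hz t ht j hj)
    (p' := fun t => z' t j) (fun t ht => hz' t ht j hj) ht (dz j hj)).add
    (hasDerivWithinAt_integral_sq (h.intervalIntegrable_μ hm hcd hs) (fun t ht => hw t ht j hj)
    (p' := fun t => w' t j) (fun t ht => hw' t ht j hj) ht (dw j hj))

/-- The initial energy of the difference between comparison functions and numerical solution. -/
theorem CoeffBounds.energy_initial_le (h : CoeffBounds a b m K μ D) (hm : 0 < m) (hab : a < b)
    (M : Mesh a b) {u2 v : ℝ → ℝ} (hu : ContinuousOn u2 (Icc a b)) (hv : ContinuousOn v (Icc a b))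
    (p r V vh : ℕ → ℝ[X])
    (hp : ∀ j < M.n, ∫ y in (M.x j)..(M.x (j + 1)),
      D y * (p j - r j).eval y * ((r j).eval y - u2 y) = 0)
    (hV : ∀ j < M.n, ∫ y in (M.x j)..(M.x (j + 1)),
      D y * (V j - vh j).eval y * ((vh j).eval y - v y) = 0) :
    energy M μ D (fun j => p j - r j) (fun j => V j - vh j)
      ≤ (K + K ^ 2 / m) * ((∑ j ∈ Finset.range M.n,
          ∫ y in (M.x j)..(M.x (j + 1)), ((p j).eval y - u2 y) ^ 2)
        + ∑ j ∈ Finset.range M.n, ∫ y in (M.x j)..(M.x (j + 1)), ((V j).eval y - v y) ^ 2) := by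
  have hK := h.nonneg hab
  rw [energy, ← Finset.sum_add_distrib, Finset.mul_sum]
  refine Finset.sum_le_sum fun j hj => ?_
  have hj := Finset.mem_range.1 hj
  have hcd := (M.x_lt j hj).le
  have hs := M.Icc_subset hj
  have cD := h.continuousOn.mono hs
  have hDm : ∀ y ∈ Icc (M.x j) (M.x (j + 1)), m ≤ D y := fun y hy => (h.D_bounds y (hs hy)).1
  have iD := h.intervalIntegrable_D hcd hs
  have up : ∀ {g : ℝ → ℝ}, ContinuousOn g (Icc a b) → ∀ p : ℝ[X],
      ∫ y in (M.x j)..(M.x (j + 1)), D y * (p.eval y - g y) ^ 2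
        ≤ K * ∫ y in (M.x j)..(M.x (j + 1)), (p.eval y - g y) ^ 2 := by
    intro g hg p
    refine le_trans (le_of_eq ?_) (integral_weight_bounds hcd iD
      (fun y hy => h.D_bounds y (hs hy)) (p.continuous.continuousOn.sub (hg.mono hs))).2
    congr 1; funext y; simp only [Pi.sub_apply]; ring
  have h1 := (integral_sq_sub_le_of_orthogonal hcd hm cD hDm (hu.mono hs) (p j) (r j)
    (hp j hj)).trans (up hu (p j))
  have h2 := (integral_sq_sub_le_of_orthogonal hcd hm cD hDm (hv.mono hs) (V j) (vh j)
    (hV j hj)).trans (up hv (V j))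
  have cV : ContinuousOn (fun y => (V j - vh j).eval y) (Icc (M.x j) (M.x (j + 1))) :=
    (V j - vh j).continuous.continuousOn
  have h3 := (integral_weight_bounds hcd iD (fun y hy => h.D_bounds y (hs hy)) cV).1
  have h4 := (integral_weight_bounds hcd (h.intervalIntegrable_μ hm hcd hs)
    (fun y hy => h.μ_bounds y (hs hy)) cV).2
  have n1 : 0 ≤ ∫ y in (M.x j)..(M.x (j + 1)), ((p j).eval y - u2 y) ^ 2 :=
    intervalIntegral.integral_nonneg hcd fun _ _ => sq_nonneg _
  have n2 : 0 ≤ ∫ y in (M.x j)..(M.x (j + 1)), ((V j).eval y - v y) ^ 2 :=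
    intervalIntegral.integral_nonneg hcd fun _ _ => sq_nonneg _
  set A := ∫ y in (M.x j)..(M.x (j + 1)), ((p j).eval y - u2 y) ^ 2
  set B := ∫ y in (M.x j)..(M.x (j + 1)), ((V j).eval y - v y) ^ 2
  set W := ∫ y in (M.x j)..(M.x (j + 1)), (V j - vh j).eval y ^ 2
  -- The initial projection is orthogonal with weight `D`, while the energy has weight `μ`;
  -- exchanging the weights costs the ratio `K / m`.
  have h5 : K * W ≤ K ^ 2 / m * B := by
    have : W ≤ K * B / m := by
      rw [le_div_iff₀ hm]; linarith
    calc K * W ≤ K * (K * B / m) := mul_le_mul_of_nonneg_left this hK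
      _ = _ := by ring
  have n3 : 0 ≤ K * B := mul_nonneg hK n2
  have n4 : 0 ≤ K ^ 2 / m * A := by positivity
  linarith

/-- The triangle inequality for the energy norm. -/
theorem CoeffBounds.energyErrorSq_le (h : CoeffBounds a b m K μ D) (hm : 0 < m)
    (M : Mesh a b) {u v : ℝ → ℝ} (hu : ContinuousOn (dx a b 2 u) (Icc a b))
    (hv : ContinuousOn v (Icc a b)) (U V uh vh : ℕ → ℝ[X]) :
    energyErrorSq M D u v uh vh
      ≤ (2 + 2 * K ^ 2) * ((∑ j ∈ Finset.range M.n, ∫ y in (M.x j)..(M.x (j + 1)),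
            ((derivative (derivative (U j))).eval y - dx a b 2 u y) ^ 2)
        + (∑ j ∈ Finset.range M.n, ∫ y in (M.x j)..(M.x (j + 1)), ((V j).eval y - v y) ^ 2)
        + ∑ j ∈ Finset.range M.n, ((∫ y in (M.x j)..(M.x (j + 1)),
            (derivative (derivative (U j - uh j))).eval y ^ 2)
          + ∫ y in (M.x j)..(M.x (j + 1)), (V j - vh j).eval y ^ 2)) := by
  rw [energyErrorSq, ← Finset.sum_add_distrib, ← Finset.sum_add_distrib, ← Finset.sum_add_distrib,
    Finset.mul_sum]
  refine Finset.sum_le_sum fun j hj => ?_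
  have hj := Finset.mem_range.1 hj
  have hcd := (M.x_lt j hj).le
  have hs := M.Icc_subset hj
  have key : ∀ {g E : ℝ → ℝ} {B : ℝ} (p r : ℝ[X]), ContinuousOn g (Icc a b) →
      ContinuousOn E (Icc a b) → (∀ y ∈ Icc a b, E y ^ 2 ≤ B) →
      ∫ y in (M.x j)..(M.x (j + 1)), (E y * (g y - r.eval y)) ^ 2
        ≤ 2 * B * (∫ y in (M.x j)..(M.x (j + 1)), (p.eval y - g y) ^ 2)
          + 2 * B * ∫ y in (M.x j)..(M.x (j + 1)), (p - r).eval y ^ 2 := by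
    intro g E B p r hg hE hB
    have c1 : ContinuousOn (fun y => p.eval y - g y) (Icc (M.x j) (M.x (j + 1))) :=
      p.continuous.continuousOn.sub (hg.mono hs)
    have c2 : ContinuousOn (fun y => (p - r).eval y) (Icc (M.x j) (M.x (j + 1))) :=
      (p - r).continuous.continuousOn
    have c3 : ContinuousOn (fun y => E y * (g y - r.eval y)) (Icc (M.x j) (M.x (j + 1))) :=
      (hE.mono hs).mul ((hg.mono hs).sub r.continuous.continuousOn)
    rw [← integral_sq_add_sq hcd c1 c2]
    refine intervalIntegral.integral_mono_on hcd (intervalIntegrable_of_Icc hcd (c3.pow 2))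
      (intervalIntegrable_of_Icc hcd ((continuousOn_const.mul (c1.pow 2)).add
        (continuousOn_const.mul (c2.pow 2)))) fun y hy => ?_
    have h1 : (g y - r.eval y) ^ 2 ≤ 2 * (p.eval y - g y) ^ 2 + 2 * (p - r).eval y ^ 2 := by
      rw [eval_sub]
      linarith [sq_nonneg (p.eval y - g y + (p.eval y - r.eval y))]
    have hB0 : 0 ≤ B := (sq_nonneg _).trans (hB y (hs hy))
    calc (E y * (g y - r.eval y)) ^ 2 = E y ^ 2 * (g y - r.eval y) ^ 2 := by ring
      _ ≤ B * (2 * (p.eval y - g y) ^ 2 + 2 * (p - r).eval y ^ 2) :=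
        mul_le_mul (hB y (hs hy)) h1 (sq_nonneg _) hB0
      _ = _ := by ring
  have k1 := key (E := fun _ => 1) (B := 1) (V j) (vh j) hv continuousOn_const
    (fun y _ => by norm_num)
  have k2 := key (E := D) (B := K ^ 2) (derivative (derivative (U j)))
    (derivative (derivative (uh j))) hu h.continuousOn fun y hy => by
      have := h.D_bounds y hy
      exact pow_le_pow_left₀ (hm.le.trans this.1) this.2 2
  simp only [one_mul] at k1
  rw [← derivative_sub, ← derivative_sub] at k2
  have n : ∀ g : ℝ → ℝ, 0 ≤ ∫ y in (M.x j)..(M.x (j + 1)), g y ^ 2 := fun g =>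
    intervalIntegral.integral_nonneg hcd fun _ _ => sq_nonneg _
  have n1 := n fun y => (derivative (derivative (U j))).eval y - dx a b 2 u y
  have n2 := n fun y => (derivative (derivative (U j - uh j))).eval y
  have n3 := mul_nonneg (sq_nonneg K) (n fun y => (V j).eval y - v y)
  have n4 := mul_nonneg (sq_nonneg K) (n fun y => (V j - vh j).eval y)
  linarith

end Energy

set_option maxHeartbeats 600000 in
-- Gronwall's inequality for the difference, followed by the triangle inequality. `Θ` encodes the
-- presence of dissipation, `om` the approximation order, and `R` is any bound of the data, so both
-- rates of the theorem are covered at once.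
theorem exists_energy_error_bound (q s : ℕ) (hq : 3 ≤ q) (hs : s ≤ q) (hqs : q ≤ s + 4)
    (a b : ℝ) (hab : a < b) (σ m K T₀ : ℝ) (hm : 0 < m) (hT₀ : 0 < T₀) (F : FluxParams)
    (hF : F.Admissible) :
    ∃ C : ℝ, 0 < C ∧ ∀ (μ D : ℝ → ℝ), CoeffBounds a b m K μ D → ∀ T : ℝ, T₀ ≤ T →
      ∀ f u v vt : ℝ → ℝ → ℝ, IsSmoothSolution a b T μ D f F.bc q s u v vt →
      ∀ M : Mesh a b, M.Regular σ → ∀ uh vh : ℝ → ℕ → ℝ[X],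
      IsDGSolution M F μ D f T q s uh vh →
      IsProjection M D q s (u 0) (v 0) (uh 0) (vh 0) →
      ∀ Θ : ℝ, (Θ = 1 ∨ (F.Dissipative ∧ Θ = M.h)) → ∀ om : ℝ,
      M.h ^ (2 * q - 2) ≤ om * M.h ^ 4 → M.h ^ (2 * s + 2) ≤ om * M.h ^ 4 → ∀ R : ℝ,
      (∀ t ∈ Icc 0 T, Θ * (om * (sobolevSeminormSq a b (q + 1) (u t)
          + sobolevSeminormSq a b (s + 1) (v t)))
        + M.h ^ (2 * s + 2) * sobolevSeminormSq a b (s + 1) (vt t) ≤ R) →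
      ∀ t ∈ Icc 0 T, energyErrorSq M D (u t) (v t) (uh t) (vh t) ≤ C * T ^ 2 * R := by
  obtain ⟨Cc, hCc, hcomp⟩ := exists_comparison q s hq hs a b σ m K hab hm
  obtain ⟨Cr, hCr, hrate⟩ := exists_energy_rate_bound q s hs hqs a b hab σ m K hm F hF
  set L := b - a with hL
  have hL0 : 0 < L := sub_pos.2 hab
  -- `3` is the overlap of the patches, and `L⁴ + L³` comes from `h⁴ ≤ (L⁴ + L³) Θ` for both values
  -- of `Θ`.
  set G : ℝ := 3 * Cc * (L ^ 4 + L ^ 3) with hG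
  set c : ℝ := 2 * Cr / m with hc
  set C₁ : ℝ := (2 + 2 * K ^ 2) * (2 * G / T₀ ^ 2 + 1 / m * (Real.exp c
    * ((K + K ^ 2 / m) * (2 * G) / T₀ ^ 2 + 6 * Cr * Cc * (1 / T₀ + 1)))) with hC₁
  refine ⟨|C₁| + 1, by positivity, ?_⟩
  intro μ D h T hT f u v vt sol M hM uh vh hDG hproj Θ hΘ om ho ho' R hR
  obtain ⟨ut, vht, ut_mem, vht_mem, uh_deriv, vh_deriv, hscheme⟩ := hDG.scheme
  obtain ⟨U, U', V, V', sl, fam⟩ := hcomp μ D h T f u v vt F.bc sol M hM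
  have hT0 : 0 < T := hT₀.trans_le hT
  have hK := h.nonneg hab
  have hh := M.h_pos hab
  have hhL : M.h ≤ L := M.h_le hab
  have hΘ0 : 0 < Θ := by
    rcases hΘ with rfl | ⟨-, rfl⟩
    · exact one_pos
    · exact hh
  have hh4 : M.h ^ 4 ≤ (L ^ 4 + L ^ 3) * Θ := by
    rcases hΘ with rfl | ⟨-, rfl⟩
    · have := pow_le_pow_left₀ hh.le hhL 4
      have : 0 < L ^ 3 := by positivity
      linarith
    · have h3 := mul_le_mul_of_nonneg_right (pow_le_pow_left₀ hh.le hhL 3) hh.le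
      have : 0 < L ^ 4 * M.h := by positivity
      linarith
  have om0 : 0 ≤ om := nonneg_of_mul_nonneg_left (le_trans (by positivity) ho) (by positivity)
  have su := sol.u_smooth
  have svs : SpatiallySmooth a b T (s + 1) v := sol.v_smooth.of_le (le_max_left _ _)
  have sv2 : SpatiallySmooth a b T (1 + 1) v := sol.v_smooth.of_le (le_max_right _ _)
  have cu2 : ∀ t ∈ Icc 0 T, ContinuousOn (dx a b 2 (u t)) (Icc a b) := fun t ht =>
    su.continuousOn (by omega) ht
  have cv : ∀ t ∈ Icc 0 T, ContinuousOn (v t) (Icc a b) := fun t ht => by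
    simpa only [dx_zero] using sv2.continuousOn (Nat.zero_le _) ht
  have cvt : ∀ t ∈ Icc 0 T, ContinuousOn (vt t) (Icc a b) := fun t ht => by
    simpa only [dx_zero] using sol.vt_smooth.continuousOn (Nat.zero_le _) ht
  have n0 : ∀ t, 0 ≤ om * (sobolevSeminormSq a b (q + 1) (u t)
      + sobolevSeminormSq a b (s + 1) (v t)) := fun t => mul_nonneg om0
    (add_nonneg (sobolevSeminormSq_nonneg hab _ _) (sobolevSeminormSq_nonneg hab _ _))
  have n1 : ∀ t, 0 ≤ M.h ^ (2 * s + 2) * sobolevSeminormSq a b (s + 1) (vt t) := fun t =>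
    mul_nonneg (by positivity) (sobolevSeminormSq_nonneg hab _ _)
  have hR0 : 0 ≤ R := (add_nonneg (mul_nonneg hΘ0.le (n0 0)) (n1 0)).trans
    (hR 0 (left_mem_Icc.2 hT0.le))
  -- the sums of the local error terms
  have hpatch : ∀ t ∈ Icc 0 T, ∑ j ∈ Finset.range M.n,
      Cc * (om * patchData M q s (u t) (v t) j) ≤ 3 * Cc * (om
        * (sobolevSeminormSq a b (q + 1) (u t) + sobolevSeminormSq a b (s + 1) (v t))) := by
    intro t ht
    have h1 := sum_patchData_le M q s (u t) (v t)
    simp only [localData, Finset.sum_add_distrib, sum_elementData su ht,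
      sum_elementData svs ht] at h1
    rw [← Finset.mul_sum, ← Finset.mul_sum]
    have := mul_le_mul_of_nonneg_left h1 (mul_nonneg hCc.le om0)
    linarith
  have hsmall : ∀ t ∈ Icc 0 T, ∀ g : ℕ → ℝ,
      (∀ j < M.n, g j ≤ M.h ^ 4 * (Cc * (om * patchData M q s (u t) (v t) j))) →
      ∑ j ∈ Finset.range M.n, g j ≤ G * R := by
    intro t ht g hg
    have h1 : ∑ j ∈ Finset.range M.n, g j
        ≤ M.h ^ 4 * ∑ j ∈ Finset.range M.n, Cc * (om * patchData M q s (u t) (v t) j) := by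
      rw [Finset.mul_sum]
      exact Finset.sum_le_sum fun j hj => hg j (Finset.mem_range.1 hj)
    set X := om * (sobolevSeminormSq a b (q + 1) (u t) + sobolevSeminormSq a b (s + 1) (v t)) with hX
    have hX0 : 0 ≤ X := n0 t
    calc _ ≤ M.h ^ 4 * (3 * Cc * X) :=
          h1.trans (mul_le_mul_of_nonneg_left (hpatch t ht) (by positivity))
      _ ≤ ((L ^ 4 + L ^ 3) * Θ) * (3 * Cc * X) :=
          mul_le_mul_of_nonneg_right hh4 (by positivity)
      _ = G * (Θ * X) := by rw [hG]; ring
      _ ≤ G * R := by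
          have := hR t ht
          have := n1 t
          exact mul_le_mul_of_nonneg_left (by linarith) (by positivity)
  -- the energy of the difference
  set E : ℝ → ℝ := fun t => energy M μ D
    (fun j => derivative (derivative (U t j - uh t j))) (fun j => V t j - vh t j) with hE
  set E' : ℝ → ℝ := fun t => 2 * ∑ j ∈ Finset.range M.n,
    ((∫ y in (M.x j)..(M.x (j + 1)), moment D (U t j - uh t j) y
          * (U' t j - derivative (derivative (ut t j))).eval y)
      + ∫ y in (M.x j)..(M.x (j + 1)), μ y * (V t j - vh t j).eval y
          * (V' t j - vht t j).eval y) with hE'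
  have hEd : ∀ t ∈ Icc 0 T, HasDerivWithinAt E (E' t) (Icc 0 T) t := by
    intro t ht
    refine h.hasDerivWithinAt_energy hm M (N := q)
      (z := fun t j => derivative (derivative (U t j - uh t j)))
      (z' := fun t j => U' t j - derivative (derivative (ut t j)))
      (w := fun t j => V t j - vh t j) (w' := fun t j => V' t j - vht t j)
      (fun t ht j hj => ?_) (fun t ht j hj => ?_) (fun t ht j hj => ?_) (fun t ht j hj => ?_)
      ht (fun j hj k => ?_) (fun j hj k => ?_)
    · exact (natDegree_derivative_two_le ((natDegree_sub_le _ _).trans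
        (max_le (fam.comparison t ht j hj).U_deg (hDG.u_mem t ht j hj)))).trans (Nat.sub_le _ _)
    · exact (natDegree_sub_le _ _).trans (max_le ((fam.U'_deg t j hj).trans (Nat.sub_le _ _))
        ((natDegree_derivative_two_le (ut_mem t ht j hj)).trans (Nat.sub_le _ _)))
    · exact (natDegree_sub_le _ _).trans (max_le ((fam.comparison t ht j hj).V_deg.trans hs)
        ((hDG.v_mem t ht j hj).trans hs))
    · exact (natDegree_sub_le _ _).trans (max_le ((fam.V'_deg t j hj).trans hs)
        ((vht_mem t ht j hj).trans hs))
    · simp only [derivative_sub, coeff_sub]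
      have d1 := hasDerivWithinAt_coeff_derivative (p := fun r => uh r j) (p' := fun r => ut r j)
        (uh_deriv t ht j hj)
      have d2 := hasDerivWithinAt_coeff_derivative (p := fun r => derivative (uh r j))
        (p' := fun r => derivative (ut r j)) d1 k
      exact (fam.U_deriv t ht j hj k).sub d2
    · simp only [coeff_sub]
      exact (fam.V_deriv t ht j hj k).sub (vh_deriv t ht j hj k)
  have hEm : ∀ t, ∑ j ∈ Finset.range M.n, ((∫ y in (M.x j)..(M.x (j + 1)),
        (derivative (derivative (U t j - uh t j))).eval y ^ 2)
      + ∫ y in (M.x j)..(M.x (j + 1)), (V t j - vh t j).eval y ^ 2) ≤ 1 / m * E t := by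
    intro t
    have := h.mul_le_energy hm M (fun j => derivative (derivative (U t j - uh t j)))
      (fun j => V t j - vh t j)
    rw [one_div_mul_eq_div, le_div_iff₀ hm]
    linarith
  have hEr : ∀ t ∈ Icc 0 T, E' t ≤ c / T * E t + 6 * Cr * Cc * (1 + T) * R := by
    intro t ht
    -- With `lam = 1 / T` the rate becomes `c / T`, whose exponential over `[0,T]` is independent of
    -- `T`; the source grows like `1 + T`.
    have key := hrate μ D h M hM Θ hΘ (1 / T) (by positivity) (u t) (v t) (vt t) (f t)
      ((su.of_le (l := 3 + 1) (by omega)).chain hab ht) (sv2.chain hab ht) (cvt t ht)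
      (sol.pde t ht) (uh t) (vh t) (ut t) (vht t) (U t) (U' t) (V t) (V' t) (sl t)
      (hDG.u_mem t ht) (hDG.v_mem t ht)
      (fun j hj => ⟨(hscheme t ht j hj).1, (hscheme t ht j hj).2.1⟩) (fam.comparison t ht)
      (fam.bc_left t ht) (sol.bc_left₂ t ht) (fam.bc_right t ht) (sol.bc_right₂ t ht)
      (fun j => Cc * (om * patchData M q s (u t) (v t) j))
      (fun j => Cc * (M.h ^ (2 * s + 2) * elementData M (s + 1) (vt t) j))
      (fun j => mul_nonneg hCc.le (mul_nonneg om0 (patchData_nonneg _ _ _ _ _ _)))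
      (fam.trace om ho ho' t ht) (fam.V_err om ho ho' t ht) (fam.V'_err t ht)
    have he' : ∑ j ∈ Finset.range M.n, Cc * (M.h ^ (2 * s + 2) * elementData M (s + 1) (vt t) j)
        = Cc * (M.h ^ (2 * s + 2) * sobolevSeminormSq a b (s + 1) (vt t)) := by
      rw [← Finset.mul_sum, ← Finset.mul_sum, sum_elementData sol.vt_smooth ht]
    rw [one_div_one_div, he'] at key
    have h1 := hpatch t ht
    have h2 := hEm t
    set X := om * (sobolevSeminormSq a b (q + 1) (u t) + sobolevSeminormSq a b (s + 1) (v t)) with hX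
    have h3 := hR t ht
    rw [← hX] at h3
    have h4 := n1 t
    set Y := M.h ^ (2 * s + 2) * sobolevSeminormSq a b (s + 1) (vt t) with hY
    have h5 := mul_le_mul_of_nonneg_left h1 hΘ0.le
    have h6 : Θ * (∑ j ∈ Finset.range M.n, Cc * (om * patchData M q s (u t) (v t) j)) + Cc * Y
        ≤ 3 * Cc * R := by
      have := mul_le_mul_of_nonneg_left h3 (by positivity : 0 ≤ 3 * Cc)
      have : 0 ≤ Cc * Y := mul_nonneg hCc.le h4
      linarith
    have h7 := mul_le_mul_of_nonneg_left h6 (by positivity : 0 ≤ Cr * (1 + T))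
    have h8 := mul_le_mul_of_nonneg_left h2 (by positivity : 0 ≤ Cr * (1 / T))
    have e1 : c / T * E t = 2 * (Cr * (1 / T) * (1 / m * E t)) := by
      rw [hc]; field_simp
    rw [e1, hE']
    linarith
  -- The discrete initial data are unperturbed projections, so by orthogonality their distance to
  -- `U_xx` and `V` is at most the error of these comparison functions, even when `U_xx` is
  -- perturbed.
  have hE0 : E 0 ≤ (K + K ^ 2 / m) * (2 * (G * R)) := by
    have h0 : (0 : ℝ) ∈ Icc 0 T := left_mem_Icc.2 hT0.le
    have key := h.energy_initial_le hm hab M (cu2 0 h0) (cv 0 h0)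
      (fun j => derivative (derivative (U 0 j))) (fun j => derivative (derivative (uh 0 j))) (V 0)
      (vh 0) (fun j hj => by
        rw [← derivative_sub, ← derivative_sub]
        exact hproj.u_orth j hj _ ((natDegree_sub_le _ _).trans
          (max_le (fam.comparison 0 h0 j hj).U_deg (hproj.u_deg j hj))))
      (fun j hj => hproj.v_orth j hj _ ((natDegree_sub_le _ _).trans
          (max_le (fam.comparison 0 h0 j hj).V_deg (hproj.v_deg j hj))))
    have h1 := hsmall 0 h0 _ (fam.U_err om ho ho' 0 h0)
    have h2 := hsmall 0 h0 _ (fam.V_err om ho ho' 0 h0)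
    simp only [hE, derivative_sub]
    refine key.trans (mul_le_mul_of_nonneg_left (by linarith) (by positivity))
  intro t ht
  have hE00 : 0 ≤ E 0 := le_trans (mul_nonneg hm.le (Finset.sum_nonneg fun j hj =>
    add_nonneg (intervalIntegral.integral_nonneg (M.x_lt j (Finset.mem_range.1 hj)).le
      fun _ _ => sq_nonneg _) (intervalIntegral.integral_nonneg
      (M.x_lt j (Finset.mem_range.1 hj)).le fun _ _ => sq_nonneg _)))
    (h.mul_le_energy hm M (fun j => derivative (derivative (U 0 j - uh 0 j)))
      (fun j => V 0 j - vh 0 j))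
  have hc0 : 0 ≤ c := by positivity
  have hGr := le_exp_mul_of_deriv_le hT0 hc0 (by positivity) hEd hEr hE00 ht
  have hfin := h.energyErrorSq_le hm M (cu2 t ht) (cv t ht) (U t) (V t) (uh t) (vh t)
  have hU := hsmall t ht _ (fam.U_err om ho ho' t ht)
  have hV := hsmall t ht _ (fam.V_err om ho ho' t ht)
  have hEt := hEm t
  -- Terms without a factor `T`, or with only one, are absorbed into `T²` by `T₀ ≤ T`; this is how
  -- the constant depends on `T₀`.
  have t1 : 1 ≤ 1 / T₀ ^ 2 * T ^ 2 := by
    rw [one_div_mul_eq_div, one_le_div (by positivity)]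
    exact pow_le_pow_left₀ hT₀.le hT 2
  have t2 : T ≤ 1 / T₀ * T ^ 2 := by
    rw [one_div_mul_eq_div, le_div_iff₀ hT₀, sq]
    exact mul_le_mul_of_nonneg_left hT hT0.le
  calc energyErrorSq M D (u t) (v t) (uh t) (vh t)
      ≤ (2 + 2 * K ^ 2) * (2 * G * R * 1 + 1 / m * (Real.exp c
        * ((K + K ^ 2 / m) * (2 * G) * R * 1 + 6 * Cr * Cc * R * (T + T ^ 2)))) := by
        refine hfin.trans (mul_le_mul_of_nonneg_left ?_ (by positivity))
        have h1 : E t ≤ Real.exp c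
            * ((K + K ^ 2 / m) * (2 * G) * R * 1 + 6 * Cr * Cc * R * (T + T ^ 2)) := by
          refine hGr.trans (mul_le_mul_of_nonneg_left ?_ (Real.exp_pos c).le)
          linarith
        have h2 := mul_le_mul_of_nonneg_left h1 (by positivity : 0 ≤ 1 / m)
        linarith
    _ ≤ (2 + 2 * K ^ 2) * (2 * G * R * (1 / T₀ ^ 2 * T ^ 2) + 1 / m * (Real.exp c
        * ((K + K ^ 2 / m) * (2 * G) * R * (1 / T₀ ^ 2 * T ^ 2)
          + 6 * Cr * Cc * R * (1 / T₀ * T ^ 2 + T ^ 2)))) := by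
        gcongr
    _ = C₁ * T ^ 2 * R := by rw [hC₁]; ring
    _ ≤ (|C₁| + 1) * T ^ 2 * R := by
        have := le_abs_self C₁
        gcongr
        linarith

end BeamDG

/-- What remains is to choose `om` as a multiple of `h^(2 g)`, and `Θ` with `Θ h^(2 g) = h^(2 γ)`.
Real powers are needed because `g = -1` for `s = 0`. -/
theorem theorem3 (q s : ℕ) (hq : 3 ≤ q) (hs : s ≤ q) (hqs : q ≤ s + 4)
    (a b : ℝ) (hab : a < b) (σ m K T₀ : ℝ) (hm : 0 < m) (hT₀ : 0 < T₀)
    (F : BeamDG.FluxParams) (hF : F.Admissible) (γ : ℝ)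
    (hγ : γ = min ((q : ℝ) - 3) ((s : ℝ) - 1) ∨
      (F.Dissipative ∧ γ = min ((q : ℝ) - 3) ((s : ℝ) - 1) + 1 / 2)) :
    ∃ C : ℝ, 0 < C ∧
      ∀ (μ D : ℝ → ℝ), BeamDG.CoeffBounds a b m K μ D →
      ∀ (T : ℝ), T₀ ≤ T →
      ∀ (f u v vt : ℝ → ℝ → ℝ), BeamDG.IsSmoothSolution a b T μ D f F.bc q s u v vt →
      ∀ (M : BeamDG.Mesh a b), M.Regular σ →
      ∀ (uh vh : ℝ → ℕ → Polynomial ℝ), BeamDG.IsDGSolution M F μ D f T q s uh vh →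
      BeamDG.IsProjection M D q s (u 0) (v 0) (uh 0) (vh 0) →
      ∃ tmax ∈ Set.Icc 0 T,
        IsMaxOn (BeamDG.errorData a b M.h γ q s u v vt) (Set.Icc 0 T) tmax ∧
        ∀ t ∈ Set.Icc 0 T,
          BeamDG.energyErrorSq M D (u t) (v t) (uh t) (vh t)
            ≤ C * T ^ 2 * BeamDG.errorData a b M.h γ q s u v vt tmax := by
  obtain ⟨C, hC, hbound⟩ :=
    BeamDG.exists_energy_error_bound q s hq hs hqs a b hab σ m K T₀ hm hT₀ F hF
  set g : ℝ := min ((q : ℝ) - 3) ((s : ℝ) - 1) with hg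
  have hL0 : 0 < b - a := sub_pos.2 hab
  -- The curvature and velocity errors have exponents `2 q - 6` and `2 s - 2`, both at least `2 g`;
  -- the surplus powers of `h` are bounded by powers of `b - a`. The `1` makes `B ≥ 1`, so that the
  -- term with `v_t` can be multiplied by `B` as well.
  set B : ℝ := 1 + (b - a) ^ (((2 * q - 2 : ℕ) : ℝ) - (4 : ℕ) - 2 * g)
    + (b - a) ^ (((2 * s + 2 : ℕ) : ℝ) - (4 : ℕ) - 2 * g) with hB
  have p1 := Real.rpow_nonneg hL0.le (((2 * q - 2 : ℕ) : ℝ) - (4 : ℕ) - 2 * g)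
  have p2 := Real.rpow_nonneg hL0.le (((2 * s + 2 : ℕ) : ℝ) - (4 : ℕ) - 2 * g)
  have hB1 : 1 ≤ B := by linarith
  refine ⟨C * B, by positivity, ?_⟩
  intro μ D h T hT f u v vt sol M hM uh vh hDG hproj
  have hT0 : 0 < T := hT₀.trans_le hT
  have hh := M.h_pos hab
  have hhL := M.h_le hab
  have svs : BeamDG.SpatiallySmooth a b T (s + 1) v := sol.v_smooth.of_le (le_max_left _ _)
  have hcont : ContinuousOn (BeamDG.errorData a b M.h γ q s u v vt) (Icc 0 T) :=
    (continuousOn_const.mul ((BeamDG.continuousOn_sobolevSeminormSq hab sol.u_smooth).add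
      (BeamDG.continuousOn_sobolevSeminormSq hab svs))).add
      (continuousOn_const.mul (BeamDG.continuousOn_sobolevSeminormSq hab sol.vt_smooth))
  obtain ⟨tmax, htmax, hmax⟩ := isCompact_Icc.exists_isMaxOn ⟨0, left_mem_Icc.2 hT0.le⟩ hcont
  refine ⟨tmax, htmax, hmax, fun t ht => ?_⟩
  -- The extra `1/2` in `γ` is one full power of `h` in the square, supplied by `Θ = h` in the
  -- dissipative case.
  obtain ⟨Θ, hΘ, hΘγ⟩ : ∃ Θ : ℝ, (Θ = 1 ∨ (F.Dissipative ∧ Θ = M.h)) ∧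
      Θ * M.h ^ (2 * g) = M.h ^ (2 * γ) := by
    rcases hγ with rfl | ⟨hd, rfl⟩
    · exact ⟨1, Or.inl rfl, one_mul _⟩
    · refine ⟨M.h, Or.inr ⟨hd, rfl⟩, ?_⟩
      rw [mul_add, show (2 : ℝ) * (1 / 2) = 1 by norm_num, Real.rpow_add_one hh.ne', mul_comm]
  have hq2 : ((2 * q - 2 : ℕ) : ℝ) = 2 * q - 2 := by
    rw [Nat.cast_sub (by omega)]; push_cast; ring
  have hs2 : ((2 * s + 2 : ℕ) : ℝ) = 2 * s + 2 := by push_cast; ring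
  have g1 : g ≤ q - 3 := min_le_left _ _
  have g2 : g ≤ s - 1 := min_le_right _ _
  have om0 : 0 < M.h ^ (2 * g) := Real.rpow_pos_of_pos hh _
  have w1 := BeamDG.pow_le_rpow_mul_pow hh hhL (k := 2 * q - 2) (l := 4) (e := 2 * g)
    (by rw [hq2]; push_cast; linarith)
  have w2 := BeamDG.pow_le_rpow_mul_pow hh hhL (k := 2 * s + 2) (l := 4) (e := 2 * g)
    (by rw [hs2]; push_cast; linarith)
  rw [mul_assoc C B, mul_comm B, ← mul_assoc, mul_assoc (C * T ^ 2)]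
  refine hbound μ D h T hT f u v vt sol M hM uh vh hDG hproj Θ hΘ (B * M.h ^ (2 * g))
    (w1.trans ?_) (w2.trans ?_) _ (fun r hr => ?_) t ht
  · gcongr
    linarith
  · gcongr
    linarith
  · have h1 : BeamDG.errorData a b M.h γ q s u v vt r
        ≤ BeamDG.errorData a b M.h γ q s u v vt tmax := hmax hr
    refine le_trans ?_ (mul_le_mul_of_nonneg_left h1 (by linarith : 0 ≤ B))
    rw [BeamDG.errorData, ← hΘγ, mul_add B]
    have n1 : 0 ≤ M.h ^ (2 * s + 2) * BeamDG.sobolevSeminormSq a b (s + 1) (vt r) :=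
      mul_nonneg (by positivity) (BeamDG.sobolevSeminormSq_nonneg hab _ _)
    refine add_le_add (le_of_eq (by ring)) ?_
    rw [show 2 * (s + 1) = 2 * s + 2 by ring]
    exact le_mul_of_one_le_left n1 hB1
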